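/- Let $G=SU(2)$ with normalized Haar measure $dg$ and let $g\ge 1$. **Triangulations.** Cut the $4g$-gon $v_0v_1\cdots v_{4g-1}$ with boundary word $\prod_{i=1}^g a_ib_ia_i^{-1}b_i^{-1}$ along the diagonals from $v_0$ into $4g-2$ triangles. This gives a one-vertex triangulation of the closed oriented surface $\Sigma_g$ with edges $a_i,b_i$ and $4g-3$ diagonals $d_j$. Orient the diagonals away from $v_0$; then the vertices of every triangle are ordered, $x<y<z$. Divide each prism $xyz\times I$ into the tetrahedra $P=x_0y_0z_0z_1$, $I=x_0y_0y_1z_1$, $F=x_0x_1y_1z_1$ (subscript $0$: past, $1$: future). This triangulates $\Sigma_g\times I$, and, after past and future are identified, $\Sigma_g\times S^1$. Over an edge $p<q$ of $\Sigma_g$ lie the lower wall triangle $p_0q_0q_1$ and the upper wall triangle $p_0p_1q_1$. **Amplitudes.** To each dual edge (triangle $f$) belongs $g_f\in G$, and to each edge $e$ of the triangulation the curvature $G_e$, the ordered product of the $g_f^{\pm1}$ around the dual face of $e$. The Ponzano–Regge partition function of a closed manifold is $\int\prod_f dg_f\,\prod_e\delta(G_e)$. Lorentz gauge fixing along a set $T$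 of dual edges without loops (for instance a maximal dual tree) means $g_f=1$ for $f\in T$ and integration over the other $g_f$ only. For $\Sigma_g\times I$, the dual 1-skeleton includes the boundary graphs: one node for each boundary triangle, joined by a dual edge to the adjacent tetrahedron, and one link for each boundary edge. The propagator is the integral of $\prod_e\delta(G_e)$, over all edges including those of the boundary, over the group elements of the dual edges that are not links; the group elements of the links are fixed to be $a_i,b_i$ across the past edges $a_i,b_i$, to be $a_i',b_i'$ across the future ones, and $1$ across the diagonals (a maximal tree of each boundary graph). Gauge transformations being trivial at the boundary nodes, gauge fixing is along a set $T$ of dual edges without loops in the dual 1-skeleton in which the boundary nodes are collapsed to one. **Meaning of the delta functions.** Products of delta functions are read as follows. Single out the $2g+1$ edges whose delta functions appear in the reduced formula: in $\Sigma_g\times S^1$ the edge in the $S^1$ direction and the edges $a_i,b_i$; in $\Sigma_g\times I$ the edge in the $I$ direction and the edges $a_i,b_i$ of the future boundary. On both sides, replace $\delta$ for these edges by arbitrary continuous class functions $\chi_e$ on $G$. For every other edge replace $\delta$ by an arbitrary sequence $\delta_{e,n}$ of nonnegative continuous class functions with $\int\delta_{e,n}f\,dg\to f(1)$ for all continuous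 $f$. The left side "reduces to" the right side if its regularized value converges to the regularized right side as $n\to\infty$, for all such choices. **Residual measure.** Let $H=\{h_\theta=\mathrm{diag}(e^{i\theta},e^{-i\theta})\}$ with $dh=d\theta$, $0<\theta\le2\pi$, let $dx$ be the normalized invariant measure on $G/H$, and $s:G/H\to G$ a measurable section. Put $\int_{G^2}f\,d\mu=\int_{H\times G/H}f(h,s(x))\,dh\,dx$. **Theorem.** 1. The triangulation of $\Sigma_g\times S^1$ has $12g-6$ tetrahedra and one vertex, and the dual edges $IP$ and $IF$ of all prisms together with the dual edges across the lower walls over the diagonals $d_j$ form a maximal dual tree $T_0$. 2. For every set $T$ of dual edges without loops (in particular for every maximal dual tree, and for $T=\emptyset$), the partition function of $\Sigma_g\times S^1$ gauge fixed along $T$ reduces to $$\int_{G^{2g+1}}dk\prod_{i=1}^g da_i\,db_i\;\delta\Big(\prod_{i=1}^g[a_i,b_i]\Big)\prod_{i=1}^g\delta(a_ika_i^{-1}k^{-1})\,\delta(b_ikb_i^{-1}k^{-1}),\qquad [a,b]=aba^{-1}b^{-1}.$$ 3. For every measurable section $s$, the partition function gauge fixed along $T_0$, in which moreover the Haar measure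 for the two group elements across the lower walls over $a_1$ and $b_1$ is replaced by $d\mu$ (residual gauge fixing), reduces to $$\int dk\,d\mu(a_1,b_1)\prod_{i=2}^g da_i\,db_i\;\delta\Big(\prod_{i=1}^g[a_i,b_i]\Big)\prod_{i=1}^g\delta(a_ika_i^{-1}k^{-1})\,\delta(b_ikb_i^{-1}k^{-1}).$$ 4. For all $a_i,b_i,a_i',b_i'\in G$ and every $T$ as above, the propagator of $\Sigma_g\times I$ reduces to $$\int dk\;\delta\Big(\prod_{i=1}^g[a_i,b_i]\Big)\prod_{i=1}^g\delta(a_i'ka_i^{-1}k^{-1})\,\delta(b_i'kb_i^{-1}k^{-1}).$$ -/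

import Mathlib

open MeasureTheory Filter Topology

/-! ## The group `SU(2)`, its Haar measure, delta functions -/

/-- The compact Lie group `SU(2)`, with the topology of complex matrices. -/
abbrev SU2 : Type := Matrix.specialUnitaryGroup (Fin 2) ℂ

instance : IsTopologicalGroup SU2 where
  continuous_mul := by
    refine Continuous.subtype_mk ?_ _
    exact (continuous_subtype_val.comp continuous_fst).matrix_mul
      (continuous_subtype_val.comp continuous_snd)
  continuous_inv := by
    refine Continuous.subtype_mk ?_ _
    exact continuous_subtype_val.matrix_conjTranspose

instance : CompactSpace SU2 := by
  apply isCompact_iff_compactSpace.mp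
  have hU : IsClosed {A : Matrix (Fin 2) (Fin 2) ℂ | A * star A = 1 ∧ A.det = 1} := by
    apply IsClosed.inter
    · exact isClosed_eq (continuous_id.matrix_mul continuous_id.matrix_conjTranspose)
        continuous_const
    · exact isClosed_eq continuous_id.matrix_det continuous_const
  have hK : IsCompact (Set.univ.pi fun _ : Fin 2 => Set.univ.pi fun _ : Fin 2 =>
      Metric.closedBall (0 : ℂ) 1) :=
    isCompact_univ_pi fun _ => isCompact_univ_pi fun _ => isCompact_closedBall _ _
  have hS : ((Matrix.specialUnitaryGroup (Fin 2) ℂ : Set (Matrix (Fin 2) (Fin 2) ℂ)))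
      = {A : Matrix (Fin 2) (Fin 2) ℂ | A * star A = 1 ∧ A.det = 1} := by
    ext A
    rw [SetLike.mem_coe, Matrix.mem_specialUnitaryGroup_iff, Matrix.mem_unitaryGroup_iff]
    rfl
  refine IsCompact.of_isClosed_subset (s := Set.univ.pi fun _ : Fin 2 =>
    Set.univ.pi fun _ : Fin 2 => Metric.closedBall (0 : ℂ) 1) hK (hS ▸ hU) ?_
  intro A hA i _ j _
  rw [mem_closedBall_zero_iff]
  exact entry_norm_bound_of_unitary (Matrix.specialUnitaryGroup_le_unitaryGroup hA) i j

instance : SecondCountableTopology SU2 := by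
  have : SecondCountableTopology (Matrix (Fin 2) (Fin 2) ℂ) :=
    inferInstanceAs (SecondCountableTopology (Fin 2 → Fin 2 → ℂ))
  exact inferInstanceAs (SecondCountableTopology
    ((Matrix.specialUnitaryGroup (Fin 2) ℂ : Set (Matrix (Fin 2) (Fin 2) ℂ))))

noncomputable instance : MeasurableSpace SU2 := borel SU2

instance : BorelSpace SU2 := ⟨rfl⟩

/-- The normalized Haar measure `dg` on `SU(2)`. -/
noncomputable def haarSU2 : Measure SU2 := Measure.haarMeasure ⊤

/-- The product of normalized Haar measures on `SU(2)^ι`, for a finite index set `ι`. -/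
noncomputable def haarPi (ι : Type) [Finite ι] : Measure (ι → SU2) :=
  letI := Fintype.ofFinite ι
  Measure.pi fun _ => haarSU2

/-- Class functions on `SU(2)`. -/
def IsClassFunction (χ : SU2 → ℝ) : Prop := ∀ x y : SU2, χ (y * x * y⁻¹) = χ x

/-- A sequence of regularized delta functions on `SU(2)`: nonnegative continuous class functions
which converge to the delta function at the identity (with respect to `dg`). -/
structure IsDeltaSequence (δ : ℕ → SU2 → ℝ) : Prop where
  continuous : ∀ n, Continuous (δ n)
  nonneg : ∀ n x, 0 ≤ δ n x
  classFunction : ∀ n, IsClassFunction (δ n)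
  tendsto : ∀ f : SU2 → ℝ, Continuous f →
    Tendsto (fun n => ∫ x, δ n x * f x ∂haarSU2) atTop (𝓝 (f 1))

/-- The element `h_θ = diag (e^{iθ}, e^{-iθ})`. -/
noncomputable def torusElt (θ : ℝ) : SU2 :=
  ⟨!![Complex.exp (θ * Complex.I), 0; 0, Complex.exp (-(θ * Complex.I))], by
    rw [Matrix.mem_specialUnitaryGroup_iff, Matrix.mem_unitaryGroup_iff]
    constructor
    · ext i j
      fin_cases i <;> fin_cases j <;>
        simp [Matrix.mul_apply, Fin.sum_univ_two, ← Complex.exp_conj, ← Complex.exp_add]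
    · simp [Matrix.det_fin_two, ← Complex.exp_add]⟩

/-- The Cartan subgroup `H ≅ U(1)` of diagonal matrices. -/
noncomputable def cartan : Subgroup SU2 where
  carrier := {h | h.1 0 1 = 0 ∧ h.1 1 0 = 0}
  one_mem' := by simp
  mul_mem' := by
    rintro a b ⟨ha, ha'⟩ ⟨hb, hb'⟩
    simp [Matrix.mul_apply, Fin.sum_univ_two, ha, ha', hb, hb']
  inv_mem' := by
    rintro a ⟨ha, ha'⟩
    have h : (a⁻¹).1 = star a.1 := rfl
    simp [h, Matrix.star_apply, ha, ha']

/-- The measure `dμ` on `SU(2)²`, `∫ f dμ = ∫_{H × G/H} f (h, s x) dh dx`, where `s` is a section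
of `G → G/H`, `dh = dθ` on `H = {h_θ}` (of volume `2π`) and `dx` is the invariant measure of total
mass one on `G/H`. -/
noncomputable def residualMeasure (s : SU2 ⧸ cartan → SU2) : Measure (SU2 × SU2) :=
  Measure.map (fun p : ℝ × (SU2 ⧸ cartan) => (torusElt p.1, s p.2))
    ((volume.restrict (Set.Ioc 0 (2 * Real.pi))).prod
      (Measure.map (fun x : SU2 => (x : SU2 ⧸ cartan)) haarSU2))

open Classical in
/-- The family equal to `c` on the index set `S` and to `x` off `S`. -/
noncomputable def fillIn {ι : Type} (S : Set ι) (c : ι → SU2) (x : ↥Sᶜ → SU2) : ι → SU2 :=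
  fun i => if h : i ∈ S then c i else x ⟨i, h⟩

/-! ## Triangulations, their dual complexes, lattice gauge theory -/

/-- Ordered tetrahedra (vertices `0 < 1 < 2 < 3`) glued along their triangles by order preserving
maps. `(t, l)` is the triangle of `t` opposite its vertex `l`. A face `f` is the common triangle of
`sides (inl f)` and `sides (inr f)`; the edge of the dual 1-skeleton which crosses `f` is oriented
from the first of the two tetrahedra to the second. -/
structure Gluing (Tet Face : Type) where
  sides : Face ⊕ Face ≃ Tet × Fin 4

namespace Gluing

variable {Tet Face : Type} (Δ : Gluing Tet Face)

/-- Source of the dual edge `f`. -/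
def src (f : Face) : Tet := (Δ.sides (Sum.inl f)).1

/-- Target of the dual edge `f`. -/
def tgt (f : Face) : Tet := (Δ.sides (Sum.inr f)).1

/-- The other occurrence of a triangle. -/
def glue (h : Tet × Fin 4) : Tet × Fin 4 := Δ.sides (Δ.sides.symm h).swap

/-- The holonomy, in the gauge field `u`, of the dual edge which leaves the tetrahedron `h.1`
through its triangle `h`. -/
def cross {A : Type} [Group A] (u : Face → A) (h : Tet × Fin 4) : A :=
  Sum.elim u (fun f => (u f)⁻¹) (Δ.sides.symm h)

/-- The flag `(t, l, m)` is the edge of `t` which is common to its triangles opposite `l` and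
`l.succAbove m`, together with the decision to turn around it by leaving `t` through the triangle
opposite `l`. -/
abbrev Flag (_Δ : Gluing Tet Face) : Type := Tet × Fin 4 × Fin 3

/-- One step around an edge: leave `t` through the triangle opposite `l`, arrive in the tetrahedron
`t'` through its triangle opposite `l'`, and get ready to leave `t'` through its other triangle
containing the edge. -/
def turn (F : Δ.Flag) : Δ.Flag :=
  let h := Δ.glue (F.1, F.2.1)
  (h.1, h.2.succAbove F.2.2, F.2.2.predAbove h.2)

/-- The same edge of the same tetrahedron, with the opposite direction of turning. -/
def flip (F : Δ.Flag) : Δ.Flag :=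
  (F.1, F.2.1.succAbove F.2.2, F.2.2.predAbove F.2.1)

/-- The edges of the triangulation (equivalently, the dual faces): edges of tetrahedra up to the
identifications induced by the gluing. -/
def Edge : Type := Quot fun F F' : Δ.Flag => F' = Δ.turn F ∨ F' = Δ.flip F

/-- The vertices of the triangulation: vertices of tetrahedra up to the identifications induced by
the gluing. -/
def Vertex : Type :=
  Quot fun v w : Tet × Fin 4 => ∃ (l : Fin 4) (m : Fin 3), v.2 = l.succAbove m ∧
    w = ((Δ.glue (v.1, l)).1, (Δ.glue (v.1, l)).2.succAbove m)

/-- The edge opposite the `m`-th vertex in the triangle `f`. -/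
def edgeOpp (f : Face) (m : Fin 3) : Δ.Edge :=
  Quot.mk _ ((Δ.sides (Sum.inl f)).1, (Δ.sides (Sum.inl f)).2, m)

/-- The ordered product of the holonomies of the dual edges met when turning once around an edge,
starting with the flag `F`. -/
noncomputable def holonomy {A : Type} [Group A] (u : Face → A) (F : Δ.Flag) : A :=
  ((List.range (Function.minimalPeriod Δ.turn F)).map fun i =>
    Δ.cross u ((Δ.turn^[i] F).1, (Δ.turn^[i] F).2.1)).prod

/-- The curvature `G_e` at the edge `e`, upon the choice of a starting point of the dual face. -/
noncomputable def curvature {A : Type} [Group A] (u : Face → A) (e : Δ.Edge) : A :=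
  Δ.holonomy u (Quot.out e)

/-- Two tetrahedra are joined by the dual edges of `T`; the tetrahedra of `B` are considered as a
single one. -/
def Joined (B : Set Tet) (T : Set Face) : Tet → Tet → Prop :=
  Relation.EqvGen fun t t' => (t ∈ B ∧ t' ∈ B) ∨ ∃ f ∈ T, Δ.src f = t ∧ Δ.tgt f = t'

/-- `T` forms no loop in the dual 1-skeleton in which `B` has been collapsed to one dual vertex:
no dual edge of `T` joins two dual vertices that are joined by the others. -/
def IsForest (B : Set Tet) (T : Set Face) : Prop :=
  ∀ f ∈ T, ¬ Δ.Joined B (T \ {f}) (Δ.src f) (Δ.tgt f)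

/-- `T` is a maximal tree of the dual 1-skeleton in which `B` has been collapsed. -/
structure IsMaximalTree (B : Set Tet) (T : Set Face) : Prop where
  forest : Δ.IsForest B T
  connected : ∀ t t', Δ.Joined B T t t'

open Classical in
/-- The product `∏_{e ∈ E} δ(G_e)` with regularized delta functions: `χ e` for the edges `e` in
`K`, and `δ e` for the other ones. -/
noncomputable def deltaProduct (E K : Set Δ.Edge) (χ δ : Δ.Edge → SU2 → ℝ) (u : Face → SU2) : ℝ :=
  ∏ᶠ e : E, (if (e : Δ.Edge) ∈ K then χ e else δ e) (Δ.curvature u e)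

/-- The integral of `∏_{e ∈ E} δ(G_e)`, regularized, over the group elements of the dual edges
outside `S`, those of the dual edges in `S` being fixed to the values `c`. -/
noncomputable def amplitude [Finite Face] (S : Set Face) (c : Face → SU2)
    (E K : Set Δ.Edge) (χ δ : Δ.Edge → SU2 → ℝ) : ℝ :=
  ∫ x, Δ.deltaProduct E K χ δ (fillIn S c x) ∂haarPi ↥Sᶜ

end Gluing

/-! ## Triangulated surfaces and the induced triangulations of `Σ × S¹` and `Σ × I` -/

/-- Ordered triangles (vertices `0 < 1 < 2`) glued along their sides by order preserving maps:
`(t, k)` is the side of `t` opposite its vertex `k`. The edge `e` is the common side `sides (inl e)`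
and `sides (inr e)`. -/
structure SurfaceGluing (Tri SEdge : Type) where
  sides : SEdge ⊕ SEdge ≃ Tri × Fin 3

/-- The three tetrahedra `P`, `I`, `F` of the prism over a triangle `x < y < z`: with subscripts
`0` (past) and `1` (future), `P = x₀y₀z₀z₁`, `I = x₀y₀y₁z₁`, `F = x₀x₁y₁z₁`. -/
inductive PrismTet : Type
  | P | I | F
  deriving DecidableEq

/-- The triangles of `Σ × S¹`. Over a triangle `t` of `Σ`: `hor t`, where the future face of the
prism is glued to its past face, `pi t` between `P` and `I`, `fi t` between `I` and `F`. Over an edge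
`p < q` of `Σ`: the lower wall `lo = p₀q₀q₁` and the upper wall `up = p₀p₁q₁`. -/
inductive CircleFace (Tri SEdge : Type) : Type
  | hor (t : Tri) | pi (t : Tri) | fi (t : Tri) | lo (e : SEdge) | up (e : SEdge)

/-- The triangles of `Σ × I`, and the links of the boundary graphs. `bot t` and `top t` are the
copies of `t` in the past and future boundary, `pi`, `fi`, `lo`, `up` are as in `Σ × S¹`;
`past e` and `future e` are the links which cross the edge `e` in the past and future boundary. -/
inductive CylinderFace (Tri SEdge : Type) : Type
  | bot (t : Tri) | top (t : Tri) | pi (t : Tri) | fi (t : Tri) | lo (e : SEdge) | up (e : SEdge)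
  | past (e : SEdge) | future (e : SEdge)

/-- Position of the lower wall in the prism over `t`, for the side opposite the vertex `k`. -/
def loPos : Fin 3 → PrismTet × Fin 4
  | 0 => (.P, 0)
  | 1 => (.P, 1)
  | 2 => (.I, 3)

/-- Position of the upper wall in the prism over `t`, for the side opposite the vertex `k`. -/
def upPos : Fin 3 → PrismTet × Fin 4
  | 0 => (.I, 0)
  | 1 => (.F, 2)
  | 2 => (.F, 3)

namespace SurfaceGluing

variable {Tri SEdge : Type} (S : SurfaceGluing Tri SEdge)

/-- The triangulation of `Σ × S¹`, with three tetrahedra for each triangle of `Σ`. -/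
def timesCircle : Gluing (Tri × PrismTet) (CircleFace Tri SEdge) where
  sides :=
    { toFun := fun x => match x with
        | .inl (.hor t) => ((t, .F), 0)
        | .inr (.hor t) => ((t, .P), 3)
        | .inl (.pi t) => ((t, .P), 2)
        | .inr (.pi t) => ((t, .I), 2)
        | .inl (.fi t) => ((t, .I), 1)
        | .inr (.fi t) => ((t, .F), 1)
        | .inl (.lo e) =>
            (((S.sides (.inl e)).1, (loPos (S.sides (.inl e)).2).1), (loPos (S.sides (.inl e)).2).2)
        | .inr (.lo e) =>
            (((S.sides (.inr e)).1, (loPos (S.sides (.inr e)).2).1), (loPos (S.sides (.inr e)).2).2)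
        | .inl (.up e) =>
            (((S.sides (.inl e)).1, (upPos (S.sides (.inl e)).2).1), (upPos (S.sides (.inl e)).2).2)
        | .inr (.up e) =>
            (((S.sides (.inr e)).1, (upPos (S.sides (.inr e)).2).1), (upPos (S.sides (.inr e)).2).2)
      invFun := fun h => match h with
        | ((t, .P), 0) => (S.sides.symm (t, 0)).map .lo .lo
        | ((t, .P), 1) => (S.sides.symm (t, 1)).map .lo .lo
        | ((t, .P), 2) => .inl (.pi t)
        | ((t, .P), 3) => .inr (.hor t)
        | ((t, .I), 0) => (S.sides.symm (t, 0)).map .up .up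
        | ((t, .I), 1) => .inl (.fi t)
        | ((t, .I), 2) => .inr (.pi t)
        | ((t, .I), 3) => (S.sides.symm (t, 2)).map .lo .lo
        | ((t, .F), 0) => .inl (.hor t)
        | ((t, .F), 1) => .inr (.fi t)
        | ((t, .F), 2) => (S.sides.symm (t, 1)).map .up .up
        | ((t, .F), 3) => (S.sides.symm (t, 2)).map .up .up
      left_inv := by
        have key : ∀ x : SEdge ⊕ SEdge, ∀ k, (S.sides x).2 = k →
            S.sides.symm ((S.sides x).1, k) = x := by
          rintro x _ rfl; simp
        rintro (f | f) <;> cases f with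
        | hor t => rfl
        | pi t => rfl
        | fi t => rfl
        | lo e =>
          dsimp only
          generalize hk : (S.sides (_ : SEdge ⊕ SEdge)).2 = k
          match k, hk with
          | 0, hk | 1, hk | 2, hk => simp [loPos, key _ _ hk]
        | up e =>
          dsimp only
          generalize hk : (S.sides (_ : SEdge ⊕ SEdge)).2 = k
          match k, hk with
          | 0, hk | 1, hk | 2, hk => simp [upPos, key _ _ hk]
      right_inv := by
        have key : ∀ (t : Tri) (k : Fin 3) (y : SEdge ⊕ SEdge), S.sides.symm (t, k) = y →
            S.sides y = (t, k) := by
          rintro t k _ rfl; simp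
        rintro ⟨⟨t, c⟩, l⟩
        cases c <;> fin_cases l <;> first
          | rfl
          | (dsimp only
             generalize hy : S.sides.symm _ = y
             have := key _ _ _ hy
             rcases y with y | y <;> simp [this, loPos, upPos]) }

/-- The triangulation of `Σ × I` with its boundary graphs, with three tetrahedra for each triangle
of `Σ`. To a triangle of the boundary corresponds a node of the boundary graph, and to an edge of
the boundary a link. They are encoded by the cone tetrahedra `x₀y₀z₀∞` (`inr (t, false)`, past) and
`x₁y₁z₁∞'` (`inr (t, true)`, future), glued along their lateral triangles. -/
def timesInterval : Gluing ((Tri × PrismTet) ⊕ (Tri × Bool)) (CylinderFace Tri SEdge) where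
  sides :=
    { toFun := fun x => match x with
        | .inl (.bot t) => (.inr (t, false), 3)
        | .inr (.bot t) => (.inl (t, .P), 3)
        | .inl (.top t) => (.inl (t, .F), 0)
        | .inr (.top t) => (.inr (t, true), 3)
        | .inl (.pi t) => (.inl (t, .P), 2)
        | .inr (.pi t) => (.inl (t, .I), 2)
        | .inl (.fi t) => (.inl (t, .I), 1)
        | .inr (.fi t) => (.inl (t, .F), 1)
        | .inl (.lo e) => (.inl ((S.sides (.inl e)).1, (loPos (S.sides (.inl e)).2).1),
            (loPos (S.sides (.inl e)).2).2)
        | .inr (.lo e) => (.inl ((S.sides (.inr e)).1, (loPos (S.sides (.inr e)).2).1),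
            (loPos (S.sides (.inr e)).2).2)
        | .inl (.up e) => (.inl ((S.sides (.inl e)).1, (upPos (S.sides (.inl e)).2).1),
            (upPos (S.sides (.inl e)).2).2)
        | .inr (.up e) => (.inl ((S.sides (.inr e)).1, (upPos (S.sides (.inr e)).2).1),
            (upPos (S.sides (.inr e)).2).2)
        | .inl (.past e) => (.inr ((S.sides (.inl e)).1, false), (S.sides (.inl e)).2.castSucc)
        | .inr (.past e) => (.inr ((S.sides (.inr e)).1, false), (S.sides (.inr e)).2.castSucc)
        | .inl (.future e) => (.inr ((S.sides (.inl e)).1, true), (S.sides (.inl e)).2.castSucc)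
        | .inr (.future e) => (.inr ((S.sides (.inr e)).1, true), (S.sides (.inr e)).2.castSucc)
      invFun := fun h => match h with
        | (.inl (t, .P), 0) => (S.sides.symm (t, 0)).map .lo .lo
        | (.inl (t, .P), 1) => (S.sides.symm (t, 1)).map .lo .lo
        | (.inl (t, .P), 2) => .inl (.pi t)
        | (.inl (t, .P), 3) => .inr (.bot t)
        | (.inl (t, .I), 0) => (S.sides.symm (t, 0)).map .up .up
        | (.inl (t, .I), 1) => .inl (.fi t)
        | (.inl (t, .I), 2) => .inr (.pi t)
        | (.inl (t, .I), 3) => (S.sides.symm (t, 2)).map .lo .lo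
        | (.inl (t, .F), 0) => .inl (.top t)
        | (.inl (t, .F), 1) => .inr (.fi t)
        | (.inl (t, .F), 2) => (S.sides.symm (t, 1)).map .up .up
        | (.inl (t, .F), 3) => (S.sides.symm (t, 2)).map .up .up
        | (.inr (t, false), 0) => (S.sides.symm (t, 0)).map .past .past
        | (.inr (t, false), 1) => (S.sides.symm (t, 1)).map .past .past
        | (.inr (t, false), 2) => (S.sides.symm (t, 2)).map .past .past
        | (.inr (t, false), 3) => .inl (.bot t)
        | (.inr (t, true), 0) => (S.sides.symm (t, 0)).map .future .future
        | (.inr (t, true), 1) => (S.sides.symm (t, 1)).map .future .future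
        | (.inr (t, true), 2) => (S.sides.symm (t, 2)).map .future .future
        | (.inr (t, true), 3) => .inr (.top t)
      left_inv := by
        have key : ∀ x : SEdge ⊕ SEdge, ∀ k, (S.sides x).2 = k →
            S.sides.symm ((S.sides x).1, k) = x := by
          rintro x _ rfl; simp
        rintro (f | f) <;> cases f with
        | bot t => rfl
        | top t => rfl
        | pi t => rfl
        | fi t => rfl
        | lo e =>
          dsimp only
          generalize hk : (S.sides (_ : SEdge ⊕ SEdge)).2 = k
          match k, hk with
          | 0, hk | 1, hk | 2, hk => simp [loPos, key _ _ hk]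
        | up e =>
          dsimp only
          generalize hk : (S.sides (_ : SEdge ⊕ SEdge)).2 = k
          match k, hk with
          | 0, hk | 1, hk | 2, hk => simp [upPos, key _ _ hk]
        | past e =>
          dsimp only
          generalize hk : (S.sides (_ : SEdge ⊕ SEdge)).2 = k
          match k, hk with
          | 0, hk | 1, hk | 2, hk => simp [key _ _ hk]
        | future e =>
          dsimp only
          generalize hk : (S.sides (_ : SEdge ⊕ SEdge)).2 = k
          match k, hk with
          | 0, hk | 1, hk | 2, hk => simp [key _ _ hk]
      right_inv := by
        have key : ∀ (t : Tri) (k : Fin 3) (y : SEdge ⊕ SEdge), S.sides.symm (t, k) = y →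
            S.sides y = (t, k) := by
          rintro t k _ rfl; simp
        rintro ⟨⟨t, c⟩ | ⟨t, c⟩, l⟩ <;> cases c <;> fin_cases l <;> first
          | rfl
          | (dsimp only
             generalize hy : S.sides.symm _ = y
             have := key _ _ _ hy
             rcases y with y | y <;> simp [this, loPos, upPos]) }

end SurfaceGluing

/-! ## The one-vertex triangulation of the surface of genus `g` -/

/-- The edges of the triangulation of `Σ_g` by `4g - 2` triangles: the `4g`-gon
`v₀, v₁, …, v_{4g-1}` with boundary word `∏ aᵢ bᵢ aᵢ⁻¹ bᵢ⁻¹` is cut along the diagonals from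
`v₀`; `d j` is the diagonal to `v_{j+2}`. -/
inductive FanEdge (g : ℕ) : Type
  | a (i : Fin g) | b (i : Fin g) | d (j : Fin (4 * g - 3))

/-- The place of the side `s = v_s v_{s+1}` of the `4g`-gon in the fan of triangles. The triangle
`t` of the fan has the vertices `v₀`, `v_{t+1}`, `v_{t+2}`. Edges are oriented away from `v₀` and
in the directions given by the boundary word, so that in a triangle `x < y < z` one has `x = v₀`,
and `y = v_{t+1}` if the side `t + 1` is an `a` or a `b`, `y = v_{t+2}` if it is an `a⁻¹` or a
`b⁻¹`. -/
def fanSide {g : ℕ} (s : Fin (4 * g)) : Fin (4 * g - 2) × Fin 3 :=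
  if s.1 = 0 then (⟨0, by have := s.2; omega⟩, 2)
  else if h : s.1 = 4 * g - 1 then (⟨4 * g - 3, by omega⟩, 2)
  else (⟨s.1 - 1, by omega⟩, 0)

/-- The two sides of triangles which are glued to an edge. The gluings are oriented so that the
dual edges across `aᵢ` and `bᵢ` satisfy `∏ [aᵢ, bᵢ] = 1` in the fundamental group. -/
def fanGlue {g : ℕ} : FanEdge g ⊕ FanEdge g → Fin (4 * g - 2) × Fin 3
  | .inl (.a i) => fanSide ⟨4 * i.1, by omega⟩
  | .inr (.a i) => fanSide ⟨4 * i.1 + 2, by omega⟩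
  | .inl (.b i) => fanSide ⟨4 * i.1 + 3, by omega⟩
  | .inr (.b i) => fanSide ⟨4 * i.1 + 1, by omega⟩
  | .inl (.d j) => (⟨j.1, by omega⟩, if (j.1 + 1) % 4 < 2 then 1 else 2)
  | .inr (.d j) => (⟨j.1 + 1, by omega⟩, if (j.1 + 2) % 4 < 2 then 2 else 1)

def fanEdgeEquiv (g : ℕ) : FanEdge g ≃ Fin g ⊕ Fin g ⊕ Fin (4 * g - 3) where
  toFun
    | .a i => .inl i
    | .b i => .inr (.inl i)
    | .d j => .inr (.inr j)
  invFun
    | .inl i => .a i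
    | .inr (.inl i) => .b i
    | .inr (.inr j) => .d j
  left_inv x := by cases x <;> rfl
  right_inv x := by rcases x with x | x | x <;> rfl

instance (g : ℕ) : Fintype (FanEdge g) := Fintype.ofEquiv _ (fanEdgeEquiv g).symm

theorem fanGlue_bijective (g : ℕ) : Function.Bijective (fanGlue (g := g)) := by
  rw [Fintype.bijective_iff_injective_and_card]
  constructor
  · rintro ((i | i | i) | (i | i | i)) ((j | j | j) | (j | j | j)) h <;>
      obtain ⟨i, hi⟩ := i <;> obtain ⟨j, hj⟩ := j <;>
      simp only [fanGlue, fanSide] at h <;>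
      split_ifs at h <;> (try dsimp only at *) <;>
      simp [Prod.ext_iff, Fin.ext_iff] at h ⊢ <;> omega
  · simp only [Fintype.card_sum, Fintype.card_prod, Fintype.card_fin,
      Fintype.card_congr (fanEdgeEquiv g)]
    omega

/-- The one-vertex triangulation of the closed oriented surface `Σ_g` of genus `g ≥ 1` by `4g - 2`
triangles. -/
noncomputable def genusSurface (g : ℕ) : SurfaceGluing (Fin (4 * g - 2)) (FanEdge g) where
  sides := Equiv.ofBijective fanGlue (fanGlue_bijective g)

def circleFaceEquiv (Tri SEdge : Type) :
    CircleFace Tri SEdge ≃ (Tri ⊕ Tri ⊕ Tri) ⊕ (SEdge ⊕ SEdge) where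
  toFun
    | .hor t => .inl (.inl t)
    | .pi t => .inl (.inr (.inl t))
    | .fi t => .inl (.inr (.inr t))
    | .lo e => .inr (.inl e)
    | .up e => .inr (.inr e)
  invFun
    | .inl (.inl t) => .hor t
    | .inl (.inr (.inl t)) => .pi t
    | .inl (.inr (.inr t)) => .fi t
    | .inr (.inl e) => .lo e
    | .inr (.inr e) => .up e
  left_inv x := by cases x <;> rfl
  right_inv x := by rcases x with (x | x | x) | (x | x) <;> rfl

def cylinderFaceEquiv (Tri SEdge : Type) :
    CylinderFace Tri SEdge ≃ CircleFace Tri SEdge ⊕ (Tri ⊕ SEdge ⊕ SEdge) where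
  toFun
    | .bot t => .inr (.inl t)
    | .top t => .inl (.hor t)
    | .pi t => .inl (.pi t)
    | .fi t => .inl (.fi t)
    | .lo e => .inl (.lo e)
    | .up e => .inl (.up e)
    | .past e => .inr (.inr (.inl e))
    | .future e => .inr (.inr (.inr e))
  invFun
    | .inr (.inl t) => .bot t
    | .inl (.hor t) => .top t
    | .inl (.pi t) => .pi t
    | .inl (.fi t) => .fi t
    | .inl (.lo e) => .lo e
    | .inl (.up e) => .up e
    | .inr (.inr (.inl e)) => .past e
    | .inr (.inr (.inr e)) => .future e
  left_inv x := by cases x <;> rfl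
  right_inv x := by rcases x with (x | x | x | x | x) | (x | x | x) <;> rfl

instance (Tri SEdge : Type) [Finite Tri] [Finite SEdge] : Finite (CircleFace Tri SEdge) :=
  Finite.of_equiv _ (circleFaceEquiv Tri SEdge).symm

instance (Tri SEdge : Type) [Finite Tri] [Finite SEdge] : Finite (CylinderFace Tri SEdge) :=
  Finite.of_equiv _ (cylinderFaceEquiv Tri SEdge).symm

/-- The ordered product `[a₁, b₁] ⋯ [a_g, b_g]`, where
`[a, b] = a b a⁻¹ b⁻¹`. -/
noncomputable def surfaceWord {g : ℕ} (a b : Fin g → SU2) : SU2 :=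
  (List.ofFn fun i => a i * b i * (a i)⁻¹ * (b i)⁻¹).prod

/-! ## The closed manifold `Σ_g × S¹` -/

namespace ClosedCase

/-- The triangulation of `Σ_g × S¹` by `12g - 6` tetrahedra. -/
noncomputable abbrev Δ (g : ℕ) :
    Gluing (Fin (4 * g - 2) × PrismTet) (CircleFace (Fin (4 * g - 2)) (FanEdge g)) :=
  (genusSurface g).timesCircle

/-- The copy of the edge `e` of `Σ_g` in `Σ_g × S¹` (the edge `p₀q₀` of the wall `p₀q₀q₁`). -/
noncomputable def hor {g : ℕ} (e : FanEdge g) : (Δ g).Edge := (Δ g).edgeOpp (.lo e) 2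

/-- The edge in the direction of `S¹` (the edge `q₀q₁` of the wall `p₀q₀q₁`). -/
noncomputable def vert (g : ℕ) [NeZero g] : (Δ g).Edge := (Δ g).edgeOpp (.lo (.a 0)) 0

/-- The edges whose delta functions are left at the end of the computation. -/
def kept (g : ℕ) [NeZero g] : Set (Δ g).Edge :=
  {e | e = vert g ∨ (∃ i, e = hor (.a i)) ∨ ∃ i, e = hor (.b i)}

/-- The maximal dual tree used for the Lorentz gauge fixing: the dual edges `IP` and `IF` of all
prisms, and the dual edges across the lower walls over the diagonals. -/
def tree (g : ℕ) : Set (CircleFace (Fin (4 * g - 2)) (FanEdge g)) :=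
  {f | (∃ t, f = .pi t) ∨ (∃ t, f = .fi t) ∨ ∃ j, f = .lo (.d j)}

open Classical in
/-- The group elements of the dual edges that are not integrated with the Haar measure once the
residual gauge invariance is fixed: `p.1`, `p.2` across the lower walls over `a₁`, `b₁`, and `1`
on the tree. -/
noncomputable def fixedValues {g : ℕ} [NeZero g] (p : SU2 × SU2) :
    CircleFace (Fin (4 * g - 2)) (FanEdge g) → SU2 :=
  fun f => if f = .lo (.a 0) then p.1 else if f = .lo (.b 0) then p.2 else 1

/-- `δ(∏ [aᵢ, bᵢ]) ∏ δ(aᵢ k aᵢ⁻¹ k⁻¹) δ(bᵢ k bᵢ⁻¹ k⁻¹)`, with regularized delta functions. -/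
noncomputable def reduced {g : ℕ} [NeZero g] (χ : (Δ g).Edge → SU2 → ℝ) (k : SU2)
    (a b : Fin g → SU2) : ℝ :=
  χ (vert g) (surfaceWord a b) *
    ∏ i, (χ (hor (.a i)) (a i * k * (a i)⁻¹ * k⁻¹) * χ (hor (.b i)) (b i * k * (b i)⁻¹ * k⁻¹))

end ClosedCase

/-! ## The cylinder `Σ_g × I` -/

namespace CylinderCase

/-- The triangulation of `Σ_g × I` by `12g - 6` tetrahedra, with its boundary graphs. -/
noncomputable abbrev Δ (g : ℕ) :
    Gluing ((Fin (4 * g - 2) × PrismTet) ⊕ (Fin (4 * g - 2) × Bool))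
      (CylinderFace (Fin (4 * g - 2)) (FanEdge g)) :=
  (genusSurface g).timesInterval

/-- The nodes of the two boundary graphs. -/
def nodes (g : ℕ) : Set ((Fin (4 * g - 2) × PrismTet) ⊕ (Fin (4 * g - 2) × Bool)) :=
  Set.range Sum.inr

/-- The links of the two boundary graphs. -/
def links (g : ℕ) : Set (CylinderFace (Fin (4 * g - 2)) (FanEdge g)) :=
  {f | (∃ e, f = .past e) ∨ ∃ e, f = .future e}

/-- The edges of the triangulation of `Σ_g × I`, boundary edges included: all the edges of its
triangles (this leaves out the edges at the apices of the auxiliary cones). -/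
def edges (g : ℕ) : Set (Δ g).Edge := {e | ∃ f ∉ links g, ∃ m, e = (Δ g).edgeOpp f m}

/-- The copy of the edge `e` of `Σ_g` in the future boundary (the edge `p₁q₁` of `p₀p₁q₁`). -/
noncomputable def top {g : ℕ} (e : FanEdge g) : (Δ g).Edge := (Δ g).edgeOpp (.up e) 0

/-- The edge in the direction of `I` (the edge `q₀q₁` of the wall `p₀q₀q₁`). -/
noncomputable def vert (g : ℕ) [NeZero g] : (Δ g).Edge := (Δ g).edgeOpp (.lo (.a 0)) 0

/-- The edges whose delta functions are left at the end of the computation. -/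
def kept (g : ℕ) [NeZero g] : Set (Δ g).Edge :=
  {e | e = vert g ∨ (∃ i, e = top (.a i)) ∨ ∃ i, e = top (.b i)}

/-- The boundary connections, gauge fixed to `1` on the diagonals (which form a maximal tree of
each boundary graph), and the value `1` on the other dual edges. -/
def fixedValues {g : ℕ} (a b a' b' : Fin g → SU2) :
    CylinderFace (Fin (4 * g - 2)) (FanEdge g) → SU2
  | .past (.a i) => a i
  | .past (.b i) => b i
  | .future (.a i) => a' i
  | .future (.b i) => b' i
  | _ => 1

/-- `δ(∏ [aᵢ, bᵢ]) ∏ δ(aᵢ' k aᵢ⁻¹ k⁻¹) δ(bᵢ' k bᵢ⁻¹ k⁻¹)`, with regularized delta functions. -/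
noncomputable def reduced {g : ℕ} [NeZero g] (χ : (Δ g).Edge → SU2 → ℝ) (k : SU2)
    (a b a' b' : Fin g → SU2) : ℝ :=
  χ (vert g) (surfaceWord a b) *
    ∏ i, (χ (top (.a i)) (a' i * k * (a i)⁻¹ * k⁻¹) * χ (top (.b i)) (b' i * k * (b i)⁻¹ * k⁻¹))

end CylinderCase

/-!
The product of delta functions is a gauge invariant function of the gauge field, so the first
freedom to exploit is the gauge. Averaging over the gauge transformations supported on one side of a
dual edge which is not the last edge of a loop shows that its group element may be fixed without
changing the integral (`Gluing.integral_gaugeFixing`). Hence the amplitude is the same for all sets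
`T` without loops, and only one convenient gauge has to be computed: `T₀` for `Σ_g × S¹`, and for
`Σ_g × I` the dual edges inside the prisms together with those towards the past boundary.

In such a gauge the curvatures are short words. A class function on `SU(2)` is invariant under
inversion (`SU2.exists_conj_eq_inv`), so its value at a curvature does not depend on the place and
the direction in which one starts to turn around the edge (`Gluing.classFunction_curvature`), and it
is enough to follow the turns from one triangle to the next until they close up (`WalkTo`,
`Gluing.classFunction_curvature_of_walkTo`). Write `l` and `v` for the group elements across the
lower and the upper wall over an edge `e` of `Σ_g`, and `h`, `h'` for those across the horizontal
triangles on the two sides of `e`, that is, between past and future for `Σ_g × S¹` and towards the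
future boundary for `Σ_g × I`.

* At the diagonal of the walls the curvature is `l v⁻¹` (`PrismGluing.curvature_diag`).
* At the edge `e` itself it is `l h'⁻¹ v⁻¹ h` in `Σ_g × S¹`. In `Σ_g × I` it is `l p⁻¹` at the past
  copy of `e` and `f h'⁻¹ v⁻¹ h` at the future copy, where `p` and `f` are the values on the links
  (`SurfaceGluing.curvature_circle_hor`, `SurfaceGluing.curvature_interval_past`,
  `SurfaceGluing.curvature_interval_future`).
* At the edge in the direction of `S¹` or `I` one turns around the vertex of `Σ_g`, through
  all the corners of the `4g`-gon and across each of its sides. When `l = v` everywhere, with value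
  `1` over the diagonals of the polygon, the word read is `∏ [aᵢ, bᵢ]`
  (`genusSurface.walk_turn_apexCorner`, `PrismGluing.curvature_vert`).

That these are all the edges, each counted once, is seen from a labelling of the sides of triangles
which is compatible with the gluing (`PrismGluing.label_flip`, `Gluing.edgeLift`).

The delta functions to be removed thus belong to `l v⁻¹`, to `h'⁻¹ v⁻¹ h` for the diagonals of the
polygon and, in the case of `Σ_g × I`, to `l p⁻¹`. The triangles of the fan form a chain joined by
the diagonals, so a triangular change of variables, which preserves Haar measure
(`measurePreserving_partialProd`, `integral_chain`), makes the arguments of these delta functions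
independent variables, the group element `k` of the first triangle remaining free. As the other
factors are continuous, the delta functions set these variables to `1` in the limit
(`tendsto_integral_prod_delta`, `tendsto_integral_chain`). Then `l = v`, all horizontal triangles
carry the same `k`, and the remaining factors are those of the reduced formula with `k⁻¹` in place
of `k`; inversion preserves Haar measure. The residual gauge fixing only changes the measure of two
parameters, whose distribution plays no role in the argument.

Finally, `T₀` has no loops because for each of its dual edges there is a two-colouring of the
tetrahedra which distinguishes its end points and is constant along the rest of `T₀`
(`Gluing.Joined.eq_of_invariant`), and the triangulation has one vertex because the link of the
vertex of `Σ_g` is connected (`genusSurface.eq_of_turn_flip_invariant`), which identifies the edges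
in the direction of `S¹`, while the gluing identifies the two end points of this edge.
-/

/-! ### Class functions on `SU(2)` -/

/-- Every element of `SU(2)` is conjugate to its inverse: a half turn about an axis orthogonal to
that of the rotation reverses the rotation. -/
theorem SU2.exists_conj_eq_inv (x : SU2) : ∃ y : SU2, y * x * y⁻¹ = x⁻¹ := by
  obtain ⟨ζ, hζ, hb⟩ : ∃ ζ : ℂ, ζ * star ζ = 1 ∧
      -(ζ * star (x.1 0 1)) = x.1 0 1 * star ζ := by
    by_cases h : x.1 0 1 = 0
    · exact ⟨1, by simp, by simp [h]⟩
    · have hn : (‖x.1 0 1‖ : ℂ) ≠ 0 := by simpa using h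
      have hc : x.1 0 1 * (starRingEnd ℂ) (x.1 0 1) = (‖x.1 0 1‖ : ℂ) ^ 2 := Complex.mul_conj' _
      refine ⟨Complex.I * x.1 0 1 / ‖x.1 0 1‖, ?_, ?_⟩
      · simp only [star_div₀, star_mul', Complex.star_def, Complex.conj_I, Complex.conj_ofReal]
        field_simp
        linear_combination (-Complex.I ^ 2) * hc - (‖x.1 0 1‖ : ℂ) ^ 2 * Complex.I_sq
      · simp only [star_div₀, star_mul', Complex.star_def, Complex.conj_I, Complex.conj_ofReal]
        field_simp
  have hx := x.2
  rw [Matrix.mem_specialUnitaryGroup_iff, Matrix.mem_unitaryGroup_iff'] at hx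
  have hadj : (x⁻¹).1 = x.1.adjugate := by
    have h1 : (x⁻¹).1 * x.1 = 1 := hx.1
    calc (x⁻¹).1 = (x⁻¹).1 * (x.1 * x.1.adjugate) := by rw [Matrix.mul_adjugate, hx.2]; simp
      _ = x.1.adjugate := by rw [← mul_assoc, h1, one_mul]
  have hstar : (x⁻¹).1 = star x.1 := rfl
  have e00 : x.1 1 1 = star (x.1 0 0) := by
    have := congrFun (congrFun (hadj.symm.trans hstar) 0) 0
    simpa [Matrix.adjugate_fin_two, Matrix.star_apply] using this
  have e10 : x.1 1 0 = -star (x.1 0 1) := by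
    have := congrFun (congrFun (hadj.symm.trans hstar) 1) 0
    simp only [Matrix.adjugate_fin_two, Matrix.star_apply, Matrix.of_apply, Matrix.cons_val',
      Matrix.cons_val_zero, Matrix.cons_val_one, Matrix.cons_val_fin_one] at this
    rw [← this, neg_neg]
  refine ⟨⟨!![0, ζ; -star ζ, 0], ?_⟩, ?_⟩
  · rw [Matrix.mem_specialUnitaryGroup_iff, Matrix.mem_unitaryGroup_iff]
    constructor
    · ext i j
      fin_cases i <;> fin_cases j <;> simp [Matrix.mul_apply, Fin.sum_univ_two]
      · exact hζ
      · rw [_root_.mul_comm]; exact hζ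
    · simpa [Matrix.det_fin_two] using hζ
  · rw [mul_inv_eq_iff_eq_mul]
    apply Subtype.ext
    change _ * x.1 = (x⁻¹).1 * _
    rw [hadj, Matrix.adjugate_fin_two]
    ext i j
    fin_cases i <;> fin_cases j <;>
      simp [Matrix.mul_apply, Fin.sum_univ_two, e00, e10, -Complex.star_def]
    · exact hb
    · exact _root_.mul_comm _ _
    · exact _root_.mul_comm _ _
    · have := congrArg star hb
      simp only [star_neg, star_mul', star_star] at this
      simp only [← Complex.star_def]
      linear_combination this

theorem IsClassFunction.inv {χ : SU2 → ℝ} (h : IsClassFunction χ) (x : SU2) : χ x⁻¹ = χ x := by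
  obtain ⟨y, hy⟩ := SU2.exists_conj_eq_inv x
  rw [← hy, h]

theorem IsClassFunction.mul_comm {χ : SU2 → ℝ} (h : IsClassFunction χ) (x y : SU2) :
    χ (x * y) = χ (y * x) := by
  rw [← h (y * x) x]; congr 1; group

/-! ### Haar measure on powers of `SU(2)` -/

instance : haarSU2.IsHaarMeasure := by unfold haarSU2; infer_instance

instance : IsProbabilityMeasure haarSU2 := ⟨by
  have := Measure.haarMeasure_self (K₀ := (⊤ : TopologicalSpace.PositiveCompacts SU2))
  simpa [haarSU2] using this⟩

instance : haarSU2.IsMulRightInvariant where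
  map_mul_right_eq_self g := by
    have : IsProbabilityMeasure (Measure.map (· * g) haarSU2) :=
      Measure.isProbabilityMeasure_map (by fun_prop)
    exact Measure.isHaarMeasure_eq_of_isProbabilityMeasure _ _

instance : haarSU2.IsInvInvariant where
  inv_eq_self := by
    have : IsProbabilityMeasure haarSU2.inv := Measure.isProbabilityMeasure_map (by fun_prop)
    have : haarSU2.inv.IsHaarMeasure :=
      Measure.isHaarMeasure_of_isCompact_nonempty_interior _ Set.univ isCompact_univ
        (by simp) (by simp) (by simp)
    exact Measure.isHaarMeasure_eq_of_isProbabilityMeasure _ _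

theorem haarPi_eq_pi (ι : Type) [Fintype ι] : haarPi ι = Measure.pi fun _ => haarSU2 := by
  unfold haarPi
  congr!

section
variable {ι κ : Type} [Finite ι] [Finite κ]

instance : IsProbabilityMeasure (haarPi ι) := by
  have := Fintype.ofFinite ι
  rw [haarPi_eq_pi]; infer_instance

instance : (haarPi ι).IsMulLeftInvariant := by
  have := Fintype.ofFinite ι
  rw [haarPi_eq_pi]; infer_instance

instance : (haarPi ι).IsMulRightInvariant := by
  have := Fintype.ofFinite ι
  rw [haarPi_eq_pi]
  refine ⟨fun g => ?_⟩
  exact (measurePreserving_pi _ _ fun i => measurePreserving_mul_right haarSU2 (g i)).map_eq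

/-- Restricting a family to a set of indices (up to a bijection) pushes the product of Haar
measures forward to the product of Haar measures. -/
theorem measurePreserving_comp_injective {j : κ → ι} (hj : Function.Injective j) :
    MeasurePreserving (fun x : ι → SU2 => x ∘ j) (haarPi ι) (haarPi κ) := by
  have := Fintype.ofFinite ι
  have := Fintype.ofFinite κ
  have hm : Measurable (fun x : ι → SU2 => x ∘ j) :=
    measurable_pi_lambda _ fun k => measurable_pi_apply _
  refine ⟨hm, ?_⟩
  rw [haarPi_eq_pi, haarPi_eq_pi]
  symm
  refine Measure.pi_eq fun s hs => ?_
  rw [Measure.map_apply hm (MeasurableSet.univ_pi hs)]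
  have : (fun x : ι → SU2 => x ∘ j) ⁻¹' Set.univ.pi s
      = Set.univ.pi (Function.extend j s fun _ => Set.univ) := by
    ext x
    simp only [Set.mem_preimage, Set.mem_pi, Set.mem_univ, true_implies, Function.comp_apply]
    constructor
    · intro h i
      by_cases hi : ∃ k, j k = i
      · obtain ⟨k, rfl⟩ := hi
        rw [hj.extend_apply]; exact h k
      · rw [Function.extend_apply' _ _ _ hi]; trivial
    · intro h k
      have := h (j k)
      rwa [hj.extend_apply] at this
  rw [this, Measure.pi_pi]
  symm
  refine Fintype.prod_of_injective j hj _ _ ?_ ?_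
  · intro i hi
    rw [Function.extend_apply' _ _ _ hi]; simp
  · intro k
    rw [hj.extend_apply]

open Classical in
/-- The family `x`, overwritten by `c` on the index set `S`. -/
noncomputable def overwrite {ι : Type} (S : Set ι) (c x : ι → SU2) : ι → SU2 :=
  fun i => if i ∈ S then c i else x i

theorem overwrite_of_mem {ι : Type} {S : Set ι} {i : ι} (h : i ∈ S) (c x : ι → SU2) :
    overwrite S c x i = c i := if_pos h

theorem overwrite_of_notMem {ι : Type} {S : Set ι} {i : ι} (h : i ∉ S) (c x : ι → SU2) :
    overwrite S c x i = x i := if_neg h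

theorem continuous_overwrite {ι : Type} (S : Set ι) :
    Continuous fun p : (ι → SU2) × (ι → SU2) => overwrite S p.1 p.2 := by
  refine continuous_pi fun i => ?_
  by_cases h : i ∈ S
  · simp only [overwrite_of_mem h]; fun_prop
  · simp only [overwrite_of_notMem h]; fun_prop

open Classical in
/-- Independent coordinates may be drawn from two independent copies. -/
theorem measurePreserving_overwrite (S : Set ι) :
    MeasurePreserving (fun p : (ι → SU2) × (ι → SU2) => overwrite S p.1 p.2)
      ((haarPi ι).prod (haarPi ι)) (haarPi ι) := by
  have := Fintype.ofFinite ι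
  have hm : Measurable (fun p : (ι → SU2) × (ι → SU2) => overwrite S p.1 p.2) := by
    exact (continuous_overwrite S).measurable
  refine ⟨hm, ?_⟩
  rw [haarPi_eq_pi]
  symm
  refine Measure.pi_eq fun s hs => ?_
  rw [Measure.map_apply hm (MeasurableSet.univ_pi hs)]
  have : (fun p : (ι → SU2) × (ι → SU2) => overwrite S p.1 p.2) ⁻¹' Set.univ.pi s
      = (Set.univ.pi fun i => if i ∈ S then s i else Set.univ) ×ˢ
        (Set.univ.pi fun i => if i ∈ S then Set.univ else s i) := by
    ext p
    simp only [Set.mem_preimage, Set.mem_pi, Set.mem_univ, true_implies, Set.mem_prod]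
    rw [← forall_and]
    refine forall_congr' fun i => ?_
    by_cases hi : i ∈ S <;> simp [hi, overwrite]
  rw [this, Measure.prod_prod, Measure.pi_pi, Measure.pi_pi, ← Finset.prod_mul_distrib]
  refine Finset.prod_congr rfl fun i _ => ?_
  by_cases hi : i ∈ S <;> simp [hi]

end

/-! ### Integrals of continuous functions on compact spaces -/

theorem Continuous.integrable_of_compactSpace {X : Type*} [TopologicalSpace X] [CompactSpace X]
    [MeasurableSpace X] [OpensMeasurableSpace X] (μ : Measure X) [IsFiniteMeasure μ] {f : X → ℝ}
    (hf : Continuous f) : Integrable f μ := by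
  obtain ⟨C, hC⟩ := isCompact_univ.exists_bound_of_continuousOn hf.continuousOn
  exact Integrable.of_bound hf.aestronglyMeasurable C (ae_of_all _ fun x => hC x trivial)

section
variable {X Y : Type*} [TopologicalSpace X] [CompactSpace X] [MeasurableSpace X]
  [OpensMeasurableSpace X] [SecondCountableTopology X]
  [TopologicalSpace Y] [CompactSpace Y] [MeasurableSpace Y] [OpensMeasurableSpace Y]
  [SecondCountableTopology Y] (μ : Measure X) [IsFiniteMeasure μ] (ν : Measure Y)
  [IsFiniteMeasure ν]

theorem integral_prod_of_continuous {f : X × Y → ℝ} (hf : Continuous f) :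
    ∫ z, f z ∂μ.prod ν = ∫ x, ∫ y, f (x, y) ∂ν ∂μ :=
  integral_prod _ (hf.integrable_of_compactSpace _)

theorem integral_integral_swap_of_continuous {f : X → Y → ℝ}
    (hf : Continuous (Function.uncurry f)) :
    ∫ x, ∫ y, f x y ∂ν ∂μ = ∫ y, ∫ x, f x y ∂μ ∂ν :=
  integral_integral_swap (hf.integrable_of_compactSpace _)

end

theorem continuous_integral_of_continuous {X Y : Type*} [TopologicalSpace X]
    [FirstCountableTopology X] [LocallyCompactSpace X] [TopologicalSpace Y] [CompactSpace Y]
    [MeasurableSpace Y] [OpensMeasurableSpace Y] (ν : Measure Y)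
    [IsFiniteMeasure ν] {f : X → Y → ℝ} (hf : Continuous (Function.uncurry f)) :
    Continuous fun x => ∫ y, f x y ∂ν := by
  simpa using continuous_parametric_integral_of_continuous (μ := ν) hf isCompact_univ

theorem MeasureTheory.MeasurePreserving.integral_comp_of_continuous {X Y : Type*}
    [MeasurableSpace X] [TopologicalSpace Y] [MeasurableSpace Y] [OpensMeasurableSpace Y]
    {μ : Measure X} {ν : Measure Y} {f : X → Y} (hf : MeasurePreserving f μ ν)
    {Ψ : Y → ℝ} (hΨ : Continuous Ψ) : ∫ x, Ψ (f x) ∂μ = ∫ y, Ψ y ∂ν := by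
  rw [← hf.map_eq, integral_map hf.measurable.aemeasurable]
  exact hΨ.aestronglyMeasurable

/-- Disjoint families of coordinates are independent and Haar distributed. -/
theorem measurePreserving_comp_sum {ι κ₁ κ₂ : Type} [Finite ι] [Finite κ₁] [Finite κ₂]
    {j₁ : κ₁ → ι} {j₂ : κ₂ → ι} (hj : Function.Injective (Sum.elim j₁ j₂)) :
    MeasurePreserving (fun x : ι → SU2 => (x ∘ j₁, x ∘ j₂)) (haarPi ι)
      ((haarPi κ₁).prod (haarPi κ₂)) := by
  have := Fintype.ofFinite κ₁
  have := Fintype.ofFinite κ₂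
  have h := measurePreserving_comp_injective hj
  rw [haarPi_eq_pi κ₁, haarPi_eq_pi κ₂]
  rw [haarPi_eq_pi (κ₁ ⊕ κ₂)] at h
  exact (measurePreserving_sumPiEquivProdPi (X := fun _ : κ₁ ⊕ κ₂ => SU2)
    (fun _ => haarSU2)).comp h

/-- If `Ψ z` does not depend on the coordinate `i`, then the coordinate `x i` in `Ψ (x i) x` may be
replaced by an independent variable. -/
theorem integral_decouple {ι : Type} [Finite ι] [DecidableEq ι] (i : ι)
    {Ψ : SU2 → (ι → SU2) → ℝ} (hΨ : Continuous (Function.uncurry Ψ))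
    (hi : ∀ z x y, Ψ z (Function.update x i y) = Ψ z x) :
    ∫ x, Ψ (x i) x ∂haarPi ι = ∫ z, ∫ x, Ψ z x ∂haarPi ι ∂haarSU2 := by
  have key : ∀ z : SU2, ∫ x, Ψ (x i) x ∂haarPi ι = ∫ x, Ψ (z * x i) x ∂haarPi ι := by
    intro z
    rw [← integral_mul_left_eq_self _ (Pi.mulSingle i z)]
    refine integral_congr_ae (ae_of_all _ fun x => ?_)
    have : Pi.mulSingle i z * x = Function.update x i (z * x i) := by
      ext1 l
      by_cases h : l = i
      · subst h; simp
      · simp [h]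
    simp only [this, hi, Function.update_self]
  have hc : Continuous (Function.uncurry fun (z : SU2) (x : ι → SU2) => Ψ (z * x i) x) :=
    hΨ.comp (f := fun p : SU2 × (ι → SU2) => (p.1 * p.2 i, p.2)) (by fun_prop)
  calc ∫ x, Ψ (x i) x ∂haarPi ι
      = ∫ z, ∫ x, Ψ (x i) x ∂haarPi ι ∂haarSU2 := by simp
    _ = ∫ z, ∫ x, Ψ (z * x i) x ∂haarPi ι ∂haarSU2 := integral_congr_ae (ae_of_all _ key)
    _ = ∫ x, ∫ z, Ψ (z * x i) x ∂haarSU2 ∂haarPi ι :=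
        integral_integral_swap_of_continuous _ _ hc
    _ = ∫ x, ∫ z, Ψ z x ∂haarSU2 ∂haarPi ι :=
        integral_congr_ae (ae_of_all _ fun x => integral_mul_right_eq_self (fun z => Ψ z x) (x i))
    _ = ∫ z, ∫ x, Ψ z x ∂haarPi ι ∂haarSU2 :=
        (integral_integral_swap_of_continuous _ _ hΨ).symm

/-! ### Products of delta sequences -/

theorem IsDeltaSequence.tendsto_integral {δ : ℕ → SU2 → ℝ} (hδ : IsDeltaSequence δ) :
    Tendsto (fun n => ∫ x, δ n x ∂haarSU2) atTop (𝓝 1) := by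
  simpa using hδ.tendsto (fun _ => 1) continuous_const

theorem exists_bump_of_mem_nhds_one {U : Set SU2} (hU : U ∈ 𝓝 (1 : SU2)) :
    ∃ f : SU2 → ℝ, Continuous f ∧ f 1 = 0 ∧ (∀ x, 0 ≤ f x) ∧ ∀ x ∉ U, 1 ≤ f x := by
  obtain ⟨V, hVU, hVo, h1⟩ := mem_nhds_iff.1 hU
  obtain ⟨f, hf0, hf1, hf⟩ := exists_continuous_zero_one_of_isClosed
    (isClosed_singleton (x := (1 : SU2))) hVo.isClosed_compl (by simpa using h1)
  refine ⟨f, f.continuous, hf0 rfl, fun x => (hf x).1, fun x hx => ?_⟩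
  exact (hf1 (show x ∈ Vᶜ from fun h => hx (hVU h))).ge

section
variable {J : Type} [Fintype J]

theorem continuous_prod_delta {δ : J → SU2 → ℝ} (hδ : ∀ j, Continuous (δ j)) :
    Continuous fun s : J → SU2 => ∏ j, δ j (s j) :=
  continuous_finsetProd _ fun j _ => (hδ j).comp (continuous_apply j)

theorem integral_prod_delta (δ : J → SU2 → ℝ) :
    ∫ s, ∏ j, δ j (s j) ∂haarPi J = ∏ j, ∫ x, δ j x ∂haarSU2 := by
  rw [haarPi_eq_pi]
  exact integral_fintype_prod_eq_prod (𝕜 := ℝ) δ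

open Classical in
/-- The mass of a product of delta sequences concentrates near `1`: the estimate is made with
continuous functions `f` which vanish at `1` and are at least `1` off a neighbourhood of `1`. -/
theorem tendsto_integral_prod_delta {δ : ℕ → J → SU2 → ℝ}
    (hδ : ∀ j, IsDeltaSequence fun n => δ n j) {φ : (J → SU2) → ℝ} (hφ : Continuous φ) :
    Tendsto (fun n => ∫ s, (∏ j, δ n j (s j)) * φ s ∂haarPi J) atTop (𝓝 (φ 1)) := by
  have hc : ∀ n, Continuous fun s : J → SU2 => ∏ j, δ n j (s j) := fun n =>
    continuous_prod_delta fun j => (hδ j).continuous n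
  have hint : ∀ {ψ : (J → SU2) → ℝ}, Continuous ψ → Integrable ψ (haarPi J) := fun h =>
    h.integrable_of_compactSpace _
  have hmass : Tendsto (fun n => ∫ s, ∏ j, δ n j (s j) ∂haarPi J) atTop (𝓝 1) := by
    simp only [integral_prod_delta]
    simpa using tendsto_finsetProd Finset.univ fun j _ => (hδ j).tendsto_integral
  suffices h : Tendsto (fun n => ∫ s, (∏ j, δ n j (s j)) * |φ s - φ 1| ∂haarPi J) atTop (𝓝 0) by
    have h2 : Tendsto (fun n => ∫ s, (∏ j, δ n j (s j)) * (φ s - φ 1) ∂haarPi J) atTop (𝓝 0) := by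
      refine squeeze_zero_norm (fun n => ?_) h
      refine (norm_integral_le_integral_norm _).trans (le_of_eq ?_)
      refine integral_congr_ae (ae_of_all _ fun s => ?_)
      simp only [norm_mul, Real.norm_eq_abs]
      rw [abs_of_nonneg (Finset.prod_nonneg fun j _ => (hδ j).nonneg n _)]
    have h3 := h2.add (hmass.mul_const (φ 1))
    rw [zero_add, one_mul] at h3
    refine h3.congr fun n => ?_
    rw [← integral_mul_const, ← integral_add]
    · congr 1; ext s; ring
    · exact hint ((hc n).mul (hφ.sub continuous_const))
    · exact hint ((hc n).mul continuous_const)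
  obtain ⟨M, hM⟩ := isCompact_univ.exists_bound_of_continuousOn
    (hφ.sub (continuous_const (y := φ 1))).continuousOn
  have hM0 : 0 ≤ M := (norm_nonneg _).trans (hM 1 trivial)
  rw [Metric.tendsto_atTop]
  intro ε hε
  obtain ⟨U, hU, hUφ⟩ : ∃ U ∈ 𝓝 (1 : SU2), ∀ s : J → SU2, (∀ j, s j ∈ U) →
      |φ s - φ 1| < ε / 2 := by
    have h1 : {s | |φ s - φ 1| < ε / 2} ∈ 𝓝 (1 : J → SU2) := by
      have := Metric.continuousAt_iff'.1 (hφ.continuousAt (x := 1)) (ε / 2) (by positivity)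
      simp only [Real.dist_eq] at this
      exact this
    rw [nhds_pi, Filter.mem_pi] at h1
    obtain ⟨I, -, t, ht, hIt⟩ := h1
    refine ⟨⋂ j, t j, (Filter.iInter_mem).2 ht, fun s hs => hIt fun j _ => ?_⟩
    exact Set.mem_iInter.1 (hs j) j
  obtain ⟨f, hfc, hf1, hf0, hfU⟩ := exists_bump_of_mem_nhds_one hU
  have hbound : ∀ s : J → SU2, |φ s - φ 1| ≤ ε / 2 + ∑ i, M * f (s i) := by
    intro s
    by_cases h : ∀ j, s j ∈ U
    · have : 0 ≤ ∑ i, M * f (s i) := Finset.sum_nonneg fun i _ => mul_nonneg hM0 (hf0 _)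
      linarith [hUφ s h]
    · push Not at h
      obtain ⟨j, hj⟩ := h
      have h1 : M * f (s j) ≤ ∑ i, M * f (s i) :=
        Finset.single_le_sum (f := fun i => M * f (s i))
          (fun i _ => mul_nonneg hM0 (hf0 _)) (Finset.mem_univ j)
      have h2 : |φ s - φ 1| ≤ M := hM s trivial
      nlinarith [hfU _ hj]
  have hupper : Tendsto (fun n => ∫ s, (∏ j, δ n j (s j)) * (ε / 2 + ∑ i, M * f (s i)) ∂haarPi J)
      atTop (𝓝 (ε / 2)) := by
    have hterm : ∀ i, Tendsto (fun n => ∫ s, (∏ j, δ n j (s j)) * f (s i) ∂haarPi J) atTop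
        (𝓝 0) := by
      intro i
      have e : ∀ n, ∫ s, (∏ j, δ n j (s j)) * f (s i) ∂haarPi J
          = ∏ j, ∫ x, δ n j x * (if j = i then f x else 1) ∂haarSU2 := by
        intro n
        rw [← integral_prod_delta (fun j x => δ n j x * (if j = i then f x else 1))]
        congr 1; ext s
        rw [Finset.prod_mul_distrib]
        simp
      simp only [e]
      have : (0 : ℝ) = ∏ j, (if j = i then f 1 else 1) := by simp [hf1]
      rw [this]
      refine tendsto_finsetProd _ fun j _ => ?_
      by_cases hji : j = i
      · simpa [hji] using (hδ i).tendsto f hfc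
      · simpa [hji] using (hδ j).tendsto_integral
    have e : ∀ n, ∫ s, (∏ j, δ n j (s j)) * (ε / 2 + ∑ i, M * f (s i)) ∂haarPi J
        = (∫ s, ∏ j, δ n j (s j) ∂haarPi J) * (ε / 2)
          + ∑ i, M * ∫ s, (∏ j, δ n j (s j)) * f (s i) ∂haarPi J := by
      intro n
      simp only [← integral_const_mul]
      rw [← integral_mul_const, ← integral_finsetSum, ← integral_add]
      · congr 1; ext s
        rw [mul_add, Finset.mul_sum]
        congr 1
        exact Finset.sum_congr rfl fun i _ => by ring
      · exact hint ((hc n).mul continuous_const)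
      · refine hint (continuous_finsetSum _ fun i _ => continuous_const.mul ((hc n).mul ?_))
        exact hfc.comp (continuous_apply i)
      · intro i _
        exact hint (continuous_const.mul ((hc n).mul (hfc.comp (continuous_apply i))))
    simp only [e]
    have := (hmass.mul_const (ε / 2)).add
      (tendsto_finsetSum Finset.univ fun i _ => (hterm i).const_mul M)
    simpa using this
  obtain ⟨N, hN⟩ := (Metric.tendsto_atTop.1 hupper) (ε / 2) (by positivity)
  refine ⟨N, fun n hn => ?_⟩
  have h1 : 0 ≤ ∫ s, (∏ j, δ n j (s j)) * |φ s - φ 1| ∂haarPi J :=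
    integral_nonneg fun s =>
      mul_nonneg (Finset.prod_nonneg fun j _ => (hδ j).nonneg n _) (abs_nonneg _)
  have h2 : ∫ s, (∏ j, δ n j (s j)) * |φ s - φ 1| ∂haarPi J
      ≤ ∫ s, (∏ j, δ n j (s j)) * (ε / 2 + ∑ i, M * f (s i)) ∂haarPi J := by
    refine integral_mono ?_ ?_ fun s => ?_
    · exact hint ((hc n).mul (hφ.sub continuous_const).abs)
    · refine hint ((hc n).mul (continuous_const.add (continuous_finsetSum _ fun i _ => ?_)))
      exact continuous_const.mul (hfc.comp (continuous_apply i))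
    · exact mul_le_mul_of_nonneg_left (hbound s)
        (Finset.prod_nonneg fun j _ => (hδ j).nonneg n _)
  have h3 := hN n hn
  rw [Real.dist_eq] at h3 ⊢
  rw [sub_zero, abs_of_nonneg h1]
  linarith [(abs_lt.1 h3).2]

/-- The delta sequences may be removed under an integral over parameters. -/
theorem tendsto_integral_integral_prod_delta {Ω : Type*} [TopologicalSpace Ω] [CompactSpace Ω]
    [SecondCountableTopology Ω] [MeasurableSpace Ω] [OpensMeasurableSpace Ω]
    (ν : Measure Ω) [IsFiniteMeasure ν] {δ : ℕ → J → SU2 → ℝ}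
    (hδ : ∀ j, IsDeltaSequence fun n => δ n j) {Φ : Ω → (J → SU2) → ℝ}
    (hΦ : Continuous (Function.uncurry Φ)) :
    Tendsto (fun n => ∫ ω, ∫ s, (∏ j, δ n j (s j)) * Φ ω s ∂haarPi J ∂ν) atTop
      (𝓝 (∫ ω, Φ ω 1 ∂ν)) := by
  have hΦ' : Continuous (Function.uncurry fun s ω => Φ ω s) :=
    hΦ.comp (f := fun p : (J → SU2) × Ω => (p.2, p.1)) (by fun_prop)
  refine (tendsto_integral_prod_delta hδ (φ := fun s => ∫ ω, Φ ω s ∂ν)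
    (continuous_integral_of_continuous ν hΦ')).congr fun n => ?_
  rw [integral_integral_swap_of_continuous]
  · simp only [integral_const_mul]
  · have := continuous_prod_delta fun j => (hδ j).continuous n
    exact (this.comp continuous_snd).mul hΦ

end

/-! ### Change of variables along a chain of triangles -/

theorem continuous_partialProd {n : ℕ} (i : Fin (n + 1)) :
    Continuous fun f : Fin n → SU2 => Fin.partialProd f i := by
  induction i using Fin.induction with
  | zero => simpa using continuous_const
  | succ j ih =>
    simp only [Fin.partialProd_succ]
    exact ih.mul (continuous_apply j)

/-- The partial products of independent Haar distributed elements are independent and Haar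
distributed. -/
theorem measurePreserving_partialProd (n : ℕ) :
    MeasurePreserving (fun (x : Fin n → SU2) (j : Fin n) => Fin.partialProd x j.succ)
      (haarPi (Fin n)) (haarPi (Fin n)) := by
  induction n with
  | zero =>
    convert MeasurePreserving.id (haarPi (Fin 0)) using 1
  | succ n ih =>
    rw [haarPi_eq_pi] at ih ⊢
    have e := measurePreserving_piFinSuccAbove (fun _ : Fin (n + 1) => haarSU2) 0
    have hs : MeasurePreserving
        (fun p : SU2 × (Fin n → SU2) => (p.1, fun j => p.1 * Fin.partialProd p.2 j.succ))
        (haarSU2.prod (Measure.pi fun _ : Fin n => haarSU2))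
        (haarSU2.prod (Measure.pi fun _ : Fin n => haarSU2)) := by
      refine (MeasurePreserving.id haarSU2).skew_product
        (g := fun (k : SU2) (x : Fin n → SU2) (j : Fin n) => k * Fin.partialProd x j.succ) ?_ ?_
      · refine Continuous.measurable (continuous_pi fun j => ?_)
        exact continuous_fst.mul ((continuous_partialProd j.succ).comp continuous_snd)
      · refine ae_of_all _ fun k => ?_
        exact ((measurePreserving_mul_left (Measure.pi fun _ : Fin n => haarSU2)
          (fun _ => k)).comp ih).map_eq
    convert e.symm.comp (hs.comp e) using 1
    ext1 x
    ext1 j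
    simp only [Function.comp_apply, MeasurableEquiv.piFinSuccAbove_symm_apply,
      MeasurableEquiv.piFinSuccAbove_apply, Fin.insertNthEquiv, Equiv.coe_fn_mk,
      Equiv.coe_fn_symm_mk]
    refine Fin.cases ?_ (fun i => ?_) j
    · simpa using Fin.partialProd_succ x 0
    · rw [Fin.partialProd_succ']
      simp

/-- Two families of variables are exchanged for variables on which the delta functions depend
one by one: `v e` becomes `s e * ℓ e`, and, along a chain of triangles `0, 1, …, m`, the variable of
a triangle is expressed by that of the first one and the defects `r j` of the delta functions of the
walls `d j` between the triangles `j` and `j + 1`. -/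
theorem integral_chain {E : Type} [Fintype E] {m : ℕ} (d : Fin m → E) (ℓ : E → SU2)
    {δ : E → SU2 → ℝ} (hδ : ∀ e, Continuous (δ e) ∧ IsClassFunction (δ e))
    {η : Fin m → SU2 → ℝ} (hη : ∀ j, Continuous (η j) ∧ IsClassFunction (η j))
    {V : (Fin (m + 1) → SU2) → (E → SU2) → ℝ} (hV : Continuous (Function.uncurry V)) :
    ∫ h, ∫ v, (∏ e, δ e (ℓ e * (v e)⁻¹)) *
        (∏ j, η j ((h j.succ)⁻¹ * (v (d j))⁻¹ * h j.castSucc)) * V h v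
        ∂haarPi E ∂haarPi (Fin (m + 1)) =
      ∫ k, ∫ p : E ⊕ Fin m → SU2, (∏ i, Sum.elim δ η i (p i)) *
        V (fun i => (Fin.partialProd (fun j => p (.inl (d j)) * ℓ (d j)) i)⁻¹ *
            (k * Fin.partialProd (fun j => p (.inr j)) i))
          (fun e => p (.inl e) * ℓ e) ∂haarPi (E ⊕ Fin m) ∂haarSU2 := by
  set U : (E → SU2) → Fin (m + 1) → SU2 :=
    fun s i => (Fin.partialProd (fun j => s (d j) * ℓ (d j)) i)⁻¹ with hU
  have hUc : Continuous U := by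
    refine continuous_pi fun i => ((continuous_partialProd i).comp ?_).inv
    fun_prop
  set W : SU2 → (E → SU2) → (Fin m → SU2) → ℝ := fun k s r =>
    V (fun i => U s i * (k * Fin.partialProd r i)) (s * ℓ) with hW
  have hWc : Continuous fun p : SU2 × (E → SU2) × (Fin m → SU2) => W p.1 p.2.1 p.2.2 := by
    refine hV.comp (f := fun p : SU2 × (E → SU2) × (Fin m → SU2) =>
      ((fun i => U p.2.1 i * (p.1 * Fin.partialProd p.2.2 i)), p.2.1 * ℓ)) ?_
    refine Continuous.prodMk (continuous_pi fun i => ?_) (by fun_prop)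
    refine ((continuous_apply i).comp (hUc.comp (by fun_prop))).mul (continuous_fst.mul ?_)
    exact (continuous_partialProd i).comp (by fun_prop)
  have hδc := continuous_prod_delta fun e => (hδ e).1
  have hηc := continuous_prod_delta fun e => (hη e).1
  -- the substitution `v = s * ℓ`
  have h1 : ∀ h : Fin (m + 1) → SU2,
      ∫ v, (∏ e, δ e (ℓ e * (v e)⁻¹)) *
        (∏ j, η j ((h j.succ)⁻¹ * (v (d j))⁻¹ * h j.castSucc)) * V h v ∂haarPi E =
      ∫ s, (∏ e, δ e (s e)) *
        (∏ j, η j ((h j.succ)⁻¹ * (s (d j) * ℓ (d j))⁻¹ * h j.castSucc)) * V h (s * ℓ)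
        ∂haarPi E := by
    intro h
    rw [← integral_mul_right_eq_self _ ℓ]
    refine integral_congr_ae (ae_of_all _ fun s => ?_)
    simp only [Pi.mul_apply, mul_inv_rev, mul_inv_cancel_left, (hδ _).2.inv]
  -- the substitution `h = U s * Q x`, `Q x` being the partial products of `x`
  have h2 : ∀ s : E → SU2,
      ∫ h, (∏ e, δ e (s e)) *
        (∏ j, η j ((h j.succ)⁻¹ * (s (d j) * ℓ (d j))⁻¹ * h j.castSucc)) * V h (s * ℓ)
        ∂haarPi (Fin (m + 1)) =
      ∫ k, ∫ r : Fin m → SU2, (∏ e, δ e (s e)) * (∏ j, η j (r j)) * W k s r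
        ∂haarPi (Fin m) ∂haarSU2 := by
    intro s
    have hVs : Continuous fun h : Fin (m + 1) → SU2 => (∏ e, δ e (s e)) *
        (∏ j, η j ((h j.succ)⁻¹ * (s (d j) * ℓ (d j))⁻¹ * h j.castSucc)) * V h (s * ℓ) := by
      refine (continuous_const.mul (continuous_finsetProd _ fun j _ => (hη j).1.comp ?_)).mul
        (hV.comp (f := fun h => (h, s * ℓ)) ?_) <;> fun_prop
    have hQ : ∀ {ψ : (Fin (m + 1) → SU2) → ℝ}, Continuous ψ →
        ∫ h, ψ h ∂haarPi (Fin (m + 1)) =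
          ∫ x, ψ (U s * fun j => Fin.partialProd x j.succ) ∂haarPi (Fin (m + 1)) := by
      intro ψ hψ
      rw [← integral_mul_left_eq_self _ (U s)]
      exact ((measurePreserving_partialProd (m + 1)).integral_comp_of_continuous
        (hψ.comp (continuous_const_mul (U s)))).symm
    rw [hQ hVs]
    have hj : Function.Injective (Sum.elim (fun _ : Unit => (0 : Fin (m + 1))) Fin.succ) := by
      rintro (_ | a) (_ | b) h
      · rfl
      · exact absurd h.symm (Fin.succ_ne_zero b)
      · exact absurd h (Fin.succ_ne_zero a)
      · simpa using h
    have hc : Continuous fun p : (Unit → SU2) × (Fin m → SU2) =>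
        (∏ e, δ e (s e)) * (∏ j, η j (p.2 j)) * W (p.1 ()) s p.2 := by
      refine (continuous_const.mul (hηc.comp continuous_snd)).mul
        (hWc.comp (f := fun p : (Unit → SU2) × (Fin m → SU2) => (p.1 (), s, p.2)) ?_)
      fun_prop
    have hk : Continuous fun k => ∫ r : Fin m → SU2,
        (∏ e, δ e (s e)) * (∏ j, η j (r j)) * W k s r ∂haarPi (Fin m) := by
      refine continuous_integral_of_continuous _
        ((continuous_const.mul (hηc.comp continuous_snd)).mul
        (hWc.comp (f := fun p : SU2 × (Fin m → SU2) => (p.1, s, p.2)) ?_))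
      fun_prop
    have hu : MeasurePreserving (fun x : Unit → SU2 => x ()) (haarPi Unit) haarSU2 := by
      rw [haarPi_eq_pi]
      exact measurePreserving_eval (fun _ : Unit => haarSU2) ()
    rw [← hu.integral_comp_of_continuous hk, ← integral_prod_of_continuous _ _ hc,
      ← (measurePreserving_comp_sum hj).integral_comp_of_continuous hc]
    refine integral_congr_ae (ae_of_all _ fun x => ?_)
    have hP : ∀ i : Fin (m + 1), Fin.partialProd x i.succ
        = x 0 * Fin.partialProd (x ∘ Fin.succ) i := fun i => Fin.partialProd_succ' x i
    simp only [Function.comp_apply, Pi.mul_apply, hP, W]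
    congr 2
    refine Finset.prod_congr rfl fun j _ => ?_
    rw [← (hη j).2.inv (x j.succ)]
    congr 1
    rw [hU]
    simp only [Fin.partialProd_succ, Function.comp_apply]
    group
  have hF : Continuous fun p : (Fin (m + 1) → SU2) × (E → SU2) => (∏ e, δ e (p.2 e)) *
      (∏ j, η j ((p.1 j.succ)⁻¹ * (p.2 (d j) * ℓ (d j))⁻¹ * p.1 j.castSucc)) *
        V p.1 (p.2 * ℓ) := by
    refine ((hδc.comp continuous_snd).mul
      (continuous_finsetProd _ fun j _ => (hη j).1.comp ?_)).mul
        (hV.comp (f := fun p : (Fin (m + 1) → SU2) × (E → SU2) => (p.1, p.2 * ℓ)) ?_) <;> fun_prop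
  have hG : Continuous fun p : ((E → SU2) × SU2) × (Fin m → SU2) => (∏ e, δ e (p.1.1 e)) *
      (∏ j, η j (p.2 j)) * W p.1.2 p.1.1 p.2 := by
    refine ((hδc.comp (by fun_prop)).mul (hηc.comp (by fun_prop))).mul
      (hWc.comp (f := fun p : ((E → SU2) × SU2) × (Fin m → SU2) => (p.1.2, p.1.1, p.2)) ?_)
    fun_prop
  calc _ = ∫ h, ∫ s, (∏ e, δ e (s e)) *
        (∏ j, η j ((h j.succ)⁻¹ * (s (d j) * ℓ (d j))⁻¹ * h j.castSucc)) * V h (s * ℓ)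
        ∂haarPi E ∂haarPi (Fin (m + 1)) := integral_congr_ae (ae_of_all _ h1)
    _ = ∫ s, ∫ k, ∫ r : Fin m → SU2, (∏ e, δ e (s e)) * (∏ j, η j (r j)) * W k s r
        ∂haarPi (Fin m) ∂haarSU2 ∂haarPi E := by
      rw [integral_integral_swap_of_continuous _ _ hF]
      exact integral_congr_ae (ae_of_all _ h2)
    _ = ∫ k, ∫ s, ∫ r : Fin m → SU2, (∏ e, δ e (s e)) * (∏ j, η j (r j)) * W k s r
        ∂haarPi (Fin m) ∂haarPi E ∂haarSU2 := by
      refine integral_integral_swap_of_continuous _ _ (continuous_integral_of_continuous _ ?_)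
      exact hG
    _ = _ := by
      refine integral_congr_ae (ae_of_all _ fun k => ?_)
      have hc : Continuous fun p : (E → SU2) × (Fin m → SU2) =>
          (∏ e, δ e (p.1 e)) * (∏ j, η j (p.2 j)) * W k p.1 p.2 :=
        hG.comp (f := fun p : (E → SU2) × (Fin m → SU2) => ((p.1, k), p.2)) (by fun_prop)
      have hj : Function.Injective (Sum.elim (Sum.inl : E → E ⊕ Fin m) Sum.inr) := by
        rw [Sum.elim_inl_inr]; exact Function.injective_id
      dsimp only
      rw [← integral_prod_of_continuous _ _ hc,
        ← (measurePreserving_comp_sum hj).integral_comp_of_continuous hc]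
      refine integral_congr_ae (ae_of_all _ fun p => ?_)
      simp only [Fintype.prod_sum_type, Sum.elim_inl, Sum.elim_inr]
      rfl

/-- Overwriting on a larger set: the additional coordinates are integrated first. -/
theorem integral_overwrite_of_subset {ι : Type} [Finite ι] {S S' : Set ι} (h : S ⊆ S')
    (c : ι → SU2) {D : (ι → SU2) → ℝ} (hD : Continuous D) :
    ∫ x, D (overwrite S c x) ∂haarPi ι =
      ∫ x, ∫ y, D (overwrite S' (overwrite S c x) y) ∂haarPi ι ∂haarPi ι := by
  have hc : ∀ S : Set ι, ∀ c, Continuous fun x => overwrite S c x := fun S c =>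
    (continuous_overwrite S).comp (Continuous.prodMk_right c)
  rw [← (measurePreserving_overwrite S').integral_comp_of_continuous
    (Ψ := fun x => D (overwrite S c x)) (hD.comp (hc S c)), integral_prod_of_continuous]
  · refine integral_congr_ae (ae_of_all _ fun x => integral_congr_ae (ae_of_all _ fun y => ?_))
    refine congrArg D (funext fun i => ?_)
    by_cases h1 : i ∈ S
    · simp [overwrite, h1, h h1]
    · by_cases h2 : i ∈ S' <;> simp [overwrite, h1, h2]
  · exact (hD.comp (hc S c)).comp (continuous_overwrite S')

theorem continuous_sum_elim_pi {X κ₁ κ₂ : Type*} [TopologicalSpace X] {f : X → κ₁ → SU2}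
    {f' : X → κ₂ → SU2} (hf : Continuous f) (hf' : Continuous f') :
    Continuous fun x => (Sum.elim (f x) (f' x) : κ₁ ⊕ κ₂ → SU2) := by
  refine continuous_pi fun i => ?_
  rcases i with i | i
  · exact (continuous_apply i).comp hf
  · exact (continuous_apply i).comp hf'

/-- The limit of the integrals of `integral_chain` for delta sequences. The values `ℓ` depend on
parameters `ω`, which are integrated with an arbitrary finite measure, and on variables `z` which
are themselves constrained by delta sequences. -/
theorem tendsto_integral_chain {Ω : Type*} [TopologicalSpace Ω] [CompactSpace Ω]
    [LocallyCompactSpace Ω] [SecondCountableTopology Ω] [MeasurableSpace Ω] [OpensMeasurableSpace Ω]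
    (ν : Measure Ω) [IsFiniteMeasure ν] {κ E : Type} [Fintype κ] [Fintype E] {m : ℕ}
    (d : Fin m → E) {β : ℕ → κ → SU2 → ℝ} (hβ : ∀ i, IsDeltaSequence fun n => β n i)
    {δ : ℕ → E → SU2 → ℝ} (hδ : ∀ e, IsDeltaSequence fun n => δ n e)
    {η : ℕ → Fin m → SU2 → ℝ} (hη : ∀ j, IsDeltaSequence fun n => η n j)
    {ℓ : Ω × (κ → SU2) → E → SU2} (hℓ : Continuous ℓ)
    {V : Ω × (κ → SU2) → (Fin (m + 1) → SU2) × (E → SU2) → ℝ}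
    (hV : Continuous (Function.uncurry V)) :
    Tendsto (fun n => ∫ ω, ∫ z, (∏ i, β n i (z i)) *
        ∫ h, ∫ v, (∏ e, δ n e (ℓ (ω, z) e * (v e)⁻¹)) *
          (∏ j, η n j ((h j.succ)⁻¹ * (v (d j))⁻¹ * h j.castSucc)) * V (ω, z) (h, v)
          ∂haarPi E ∂haarPi (Fin (m + 1)) ∂haarPi κ ∂ν) atTop
      (𝓝 (∫ ω, ∫ k, V (ω, 1)
        ((fun i => (Fin.partialProd (fun j => ℓ (ω, 1) (d j)) i)⁻¹ * k), ℓ (ω, 1))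
          ∂haarSU2 ∂ν)) := by
  set J := κ ⊕ (E ⊕ Fin m)
  set w : ℕ → J → SU2 → ℝ := fun n => Sum.elim (β n) (Sum.elim (δ n) (η n)) with hw
  have hwδ : ∀ i, IsDeltaSequence fun n => w n i := by
    rintro (i | i | i)
    exacts [hβ i, hδ i, hη i]
  set Φ : Ω × SU2 → (J → SU2) → ℝ := fun q s =>
    V (q.1, fun i => s (.inl i))
      ((fun i => (Fin.partialProd (fun j => s (.inr (.inl (d j))) *
          ℓ (q.1, fun i => s (.inl i)) (d j)) i)⁻¹ *
            (q.2 * Fin.partialProd (fun j => s (.inr (.inr j))) i)),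
        fun e => s (.inr (.inl e)) * ℓ (q.1, fun i => s (.inl i)) e) with hΦ
  have hΦc : Continuous (Function.uncurry Φ) := by
    have hℓc : ∀ e, Continuous fun p : (Ω × SU2) × (J → SU2) =>
        ℓ (p.1.1, fun i => p.2 (.inl i)) e := fun e =>
      (continuous_apply e).comp (hℓ.comp (by fun_prop))
    refine hV.comp (f := fun p : (Ω × SU2) × (J → SU2) =>
      (((p.1.1, fun i => p.2 (.inl i)) : Ω × (κ → SU2)), (_ : (Fin (m + 1) → SU2) × (E → SU2)))) ?_
    refine Continuous.prodMk (by fun_prop) (Continuous.prodMk (continuous_pi fun i => ?_)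
      (continuous_pi fun e => ?_))
    · refine (Continuous.inv ?_).mul (Continuous.mul (by fun_prop) ?_)
      · refine (continuous_partialProd i).comp (continuous_pi fun j => ?_)
        exact Continuous.mul (by fun_prop) (hℓc _)
      · exact (continuous_partialProd i).comp (by fun_prop)
    · exact Continuous.mul (by fun_prop) (hℓc _)
  have main := tendsto_integral_integral_prod_delta (ν.prod haarSU2) hwδ hΦc
  have hlim : ∫ q, Φ q 1 ∂ν.prod haarSU2 = ∫ ω, ∫ k, V (ω, 1)
      ((fun i => (Fin.partialProd (fun j => ℓ (ω, 1) (d j)) i)⁻¹ * k), ℓ (ω, 1)) ∂haarSU2 ∂ν := by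
    rw [integral_prod_of_continuous]
    · refine integral_congr_ae (ae_of_all _ fun ω => integral_congr_ae (ae_of_all _ fun k => ?_))
      have h1 : ∀ i : Fin (m + 1), Fin.partialProd (fun _ : Fin m => (1 : SU2)) i = 1 := by
        intro i
        induction i using Fin.induction with
        | zero => simp
        | succ j ih => simp [Fin.partialProd_succ, ih]
      have h2 : (fun _ : κ => (1 : SU2)) = 1 := rfl
      simp [hΦ, h1, h2]
    · exact hΦc.comp (Continuous.prodMk_left _)
  rw [← hlim]
  refine main.congr fun n => ?_
  have hwc := continuous_prod_delta fun i => (hwδ i).continuous n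
  have hwΦ : Continuous fun p : (Ω × SU2) × (J → SU2) => (∏ i, w n i (p.2 i)) * Φ p.1 p.2 :=
    (hwc.comp continuous_snd).mul hΦc
  rw [integral_prod_of_continuous _ _
    (f := fun q => ∫ s, (∏ i, w n i (s i)) * Φ q s ∂haarPi J)
    (continuous_integral_of_continuous _ hwΦ)]
  refine integral_congr_ae (ae_of_all _ fun ω => ?_)
  have hj : Function.Injective (Sum.elim (Sum.inl : κ → J) Sum.inr) := by
    rw [Sum.elim_inl_inr]; exact Function.injective_id
  have hsplit : ∀ k, ∫ s, (∏ i, w n i (s i)) * Φ (ω, k) s ∂haarPi J =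
      ∫ z, ∫ p : E ⊕ Fin m → SU2, (∏ i, w n i (Sum.elim z p i)) * Φ (ω, k) (Sum.elim z p)
        ∂haarPi (E ⊕ Fin m) ∂haarPi κ := by
    intro k
    have hc : Continuous fun q : (κ → SU2) × (E ⊕ Fin m → SU2) =>
        (∏ i, w n i (Sum.elim q.1 q.2 i)) * Φ (ω, k) (Sum.elim q.1 q.2) := by
      refine hwΦ.comp (f := fun q : (κ → SU2) × (E ⊕ Fin m → SU2) =>
        ((ω, k), Sum.elim q.1 q.2)) (Continuous.prodMk continuous_const ?_)
      exact continuous_sum_elim_pi (by fun_prop) (by fun_prop)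
    rw [← integral_prod_of_continuous _ _ hc,
      ← (measurePreserving_comp_sum hj).integral_comp_of_continuous hc]
    refine integral_congr_ae (ae_of_all _ fun s => ?_)
    have : Sum.elim (s ∘ Sum.inl) (s ∘ Sum.inr) = s := Sum.elim_comp_inl_inr s
    simp only [this]
  simp only [hsplit]
  rw [integral_integral_swap_of_continuous]
  · refine integral_congr_ae (ae_of_all _ fun z => ?_)
    have hcl : ∀ e, Continuous (δ n e) ∧ IsClassFunction (δ n e) := fun e =>
      ⟨(hδ e).continuous n, (hδ e).classFunction n⟩
    have hcl' : ∀ j, Continuous (η n j) ∧ IsClassFunction (η n j) := fun j =>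
      ⟨(hη j).continuous n, (hη j).classFunction n⟩
    have hVz : Continuous (Function.uncurry fun h v => V (ω, z) (h, v)) :=
      hV.comp (f := fun q : (Fin (m + 1) → SU2) × (E → SU2) => ((ω, z), q)) (by fun_prop)
    dsimp only
    rw [integral_chain d (ℓ (ω, z)) hcl hcl' hVz, ← integral_const_mul]
    refine integral_congr_ae (ae_of_all _ fun k => ?_)
    dsimp only
    rw [← integral_const_mul]
    refine integral_congr_ae (ae_of_all _ fun p => ?_)
    simp only [hw, hΦ, Sum.elim_inl, Sum.elim_inr]
    have hprod : ∏ x : J, Sum.elim (β n) (Sum.elim (δ n) (η n)) x (Sum.elim z p x) =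
        (∏ i, β n i (z i)) * ∏ i, Sum.elim (δ n) (η n) i (p i) := Fintype.prod_sum_type _
    rw [hprod, mul_assoc]
  · refine continuous_integral_of_continuous _ ?_
    refine hwΦ.comp (f := fun q : (SU2 × (κ → SU2)) × (E ⊕ Fin m → SU2) =>
      ((ω, q.1.1), Sum.elim q.1.2 q.2)) (Continuous.prodMk (by fun_prop) ?_)
    exact continuous_sum_elim_pi (by fun_prop) (by fun_prop)

/-! ### First return words of a dynamical system -/

/-- `WalkTo step wt x₀ x w`: the orbit of `x` under `step` reaches `x₀`, and `w` is the ordered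
product of the weights `wt` of the points which it visits before its first arrival there. -/
inductive WalkTo {X A : Type} [Group A] (step : X → X) (wt : X → A) (x₀ : X) : X → A → Prop
  | done : WalkTo step wt x₀ x₀ 1
  | cons {x : X} {w : A} : x ≠ x₀ → WalkTo step wt x₀ (step x) w →
      WalkTo step wt x₀ x (wt x * w)

namespace WalkTo

variable {X Y A : Type} [Group A] {step : X → X} {wt : X → A} {x₀ x y : X} {w : A}

theorem step_to (hx : x ≠ x₀) (hy : step x = y) (h : WalkTo step wt x₀ y w) :
    WalkTo step wt x₀ x (wt x * w) := by
  subst hy; exact cons hx h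

theorem step_of_wt_eq_one (hx : x ≠ x₀) (hy : step x = y) (hw : wt x = 1)
    (h : WalkTo step wt x₀ y w) : WalkTo step wt x₀ x w := by
  simpa [hw] using step_to hx hy h

theorem map {stepY : Y → Y} {wtY : Y → A} {φ : X → Y} (hφ : Function.Injective φ)
    (hs : ∀ x, stepY (φ x) = φ (step x)) (hw : ∀ x, wtY (φ x) = wt x)
    (h : WalkTo step wt x₀ x w) : WalkTo stepY wtY (φ x₀) (φ x) w := by
  induction h with
  | done => exact done
  | cons hx _ ih => exact (hw _) ▸ step_to (hφ.ne hx) (hs _) ih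

theorem eq_of_invariant {α : Type} {Z : X → α} (hZ : ∀ x, Z (step x) = Z x)
    (h : WalkTo step wt x₀ x w) : Z x = Z x₀ := by
  induction h with
  | done => rfl
  | cons _ _ ih => rw [← hZ, ih]

theorem exists_iterate (h : WalkTo step wt x₀ x w) : ∃ n, step^[n] x = x₀ ∧
    (∀ i < n, step^[i] x ≠ x₀) ∧ w = ((List.range n).map fun i => wt (step^[i] x)).prod := by
  induction h with
  | done => exact ⟨0, rfl, by simp, by simp⟩
  | cons hx _ ih =>
    obtain ⟨n, h1, h2, h3⟩ := ih
    refine ⟨n + 1, h1, ?_, ?_⟩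
    · rintro (_ | i) hi
      · exact hx
      · exact h2 i (by omega)
    · rw [h3, List.range_succ_eq_map]
      simp [Function.comp_def, Function.iterate_succ_apply]

/-- The product of the weights over one period is the weight of the base point times its first
return word. -/
theorem prod_minimalPeriod (h : WalkTo step wt x₀ (step x₀) w) :
    ((List.range (Function.minimalPeriod step x₀)).map fun i => wt (step^[i] x₀)).prod
      = wt x₀ * w := by
  obtain ⟨n, h1, h2, h3⟩ := h.exists_iterate
  have hp : Function.IsPeriodicPt step (n + 1) x₀ := h1
  have hpos := hp.minimalPeriod_pos (Nat.succ_pos n)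
  have hle := hp.minimalPeriod_le (Nat.succ_pos n)
  have : Function.minimalPeriod step x₀ = n + 1 := by
    by_contra hne
    obtain ⟨i, hi⟩ := Nat.exists_eq_succ_of_ne_zero hpos.ne'
    refine h2 i (by omega) ?_
    rw [← Function.iterate_succ_apply,
      show step^[i + 1] x₀ = step^[Function.minimalPeriod step x₀] x₀ by rw [hi]]
    exact Function.isPeriodicPt_minimalPeriod step x₀
  rw [this, h3, List.range_succ_eq_map]
  simp [Function.comp_def, Function.iterate_succ_apply]

end WalkTo

/-! ### Curvature: independence of the choices, gauge invariance -/

namespace Gluing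

variable {Tet Face : Type} (Δ : Gluing Tet Face)

theorem glue_glue (h : Tet × Fin 4) : Δ.glue (Δ.glue h) = h := by
  simp [glue]

theorem glue_inl (f : Face) : Δ.glue (Δ.sides (.inl f)) = Δ.sides (.inr f) := by simp [glue]

theorem glue_inr (f : Face) : Δ.glue (Δ.sides (.inr f)) = Δ.sides (.inl f) := by simp [glue]

section holonomy
variable {A : Type} [Group A]

theorem cross_inl (u : Face → A) (f : Face) : Δ.cross u (Δ.sides (.inl f)) = u f := by simp [cross]

theorem cross_inr (u : Face → A) (f : Face) : Δ.cross u (Δ.sides (.inr f)) = (u f)⁻¹ := by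
  simp [cross]

theorem cross_glue (u : Face → A) (h : Tet × Fin 4) :
    Δ.cross u (Δ.glue h) = (Δ.cross u h)⁻¹ := by
  obtain ⟨x, rfl⟩ := Δ.sides.surjective h
  rcases x with f | f
  · rw [glue_inl, cross_inl, cross_inr]
  · rw [glue_inr, cross_inl, cross_inr, inv_inv]

/-- The triangle through which a flag leaves its tetrahedron. -/
def exit (F : Δ.Flag) : Tet × Fin 4 := (F.1, F.2.1)

/-- The same edge of the same triangle, in the tetrahedron on the other side of the triangle. -/
def across (F : Δ.Flag) : Δ.Flag :=
  ((Δ.glue (Δ.exit F)).1, (Δ.glue (Δ.exit F)).2, F.2.2)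

theorem flip_across (F : Δ.Flag) : Δ.flip (Δ.across F) = Δ.turn F := rfl

theorem across_across (F : Δ.Flag) : Δ.across (Δ.across F) = F := by
  simp [across, exit, glue_glue]

theorem flip_flip (F : Δ.Flag) : Δ.flip (Δ.flip F) = F := by
  have : ∀ (l : Fin 4) (m : Fin 3),
      (l.succAbove m).succAbove (m.predAbove l) = l ∧
        (m.predAbove l).predAbove (l.succAbove m) = m := by decide
  obtain ⟨t, l, m⟩ := F
  simp [flip, this l m]

theorem turn_flip_turn (F : Δ.Flag) : Δ.turn (Δ.flip (Δ.turn F)) = Δ.flip F := by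
  rw [← flip_across, ← flip_across, flip_flip, across_across]

theorem cross_exit_flip_turn (u : Face → A) (F : Δ.Flag) :
    Δ.cross u (Δ.exit (Δ.flip (Δ.turn F))) = (Δ.cross u (Δ.exit F))⁻¹ := by
  rw [← flip_across, flip_flip]
  exact Δ.cross_glue u _

theorem turn_injective : Function.Injective Δ.turn := by
  intro F F' h
  have := congrArg (fun G => Δ.across (Δ.flip G)) h
  simpa only [← flip_across, flip_flip, across_across] using this

/-- The product of the holonomies of the first `n` dual edges met when turning around an edge. -/
def partialHolonomy (u : Face → A) (n : ℕ) (F : Δ.Flag) : A :=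
  ((List.range n).map fun i => Δ.cross u (Δ.exit (Δ.turn^[i] F))).prod

theorem holonomy_eq (u : Face → A) (F : Δ.Flag) :
    Δ.holonomy u F = Δ.partialHolonomy u (Function.minimalPeriod Δ.turn F) F := rfl

theorem partialHolonomy_succ (u : Face → A) (n : ℕ) (F : Δ.Flag) :
    Δ.partialHolonomy u (n + 1) F
      = Δ.partialHolonomy u n F * Δ.cross u (Δ.exit (Δ.turn^[n] F)) := by
  simp [partialHolonomy, List.range_succ]

theorem partialHolonomy_succ' (u : Face → A) (n : ℕ) (F : Δ.Flag) :
    Δ.partialHolonomy u (n + 1) F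
      = Δ.cross u (Δ.exit F) * Δ.partialHolonomy u n (Δ.turn F) := by
  simp [partialHolonomy, List.range_succ_eq_map, Function.comp_def]

theorem holonomy_turn [Finite Tet] (u : Face → A) (F : Δ.Flag) :
    Δ.holonomy u (Δ.turn F)
      = (Δ.cross u (Δ.exit F))⁻¹ * Δ.holonomy u F * Δ.cross u (Δ.exit F) := by
  have hF : F ∈ Function.periodicPts Δ.turn := Δ.turn_injective.mem_periodicPts F
  rw [holonomy_eq, holonomy_eq, Function.minimalPeriod_apply hF, mul_assoc, eq_inv_mul_iff_mul_eq,
    ← partialHolonomy_succ', partialHolonomy_succ, Function.iterate_minimalPeriod]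

theorem partialHolonomy_flip (u : Face → A) (n : ℕ) (F : Δ.Flag) :
    Δ.partialHolonomy u n (Δ.flip (Δ.turn^[n] F)) = (Δ.partialHolonomy u n F)⁻¹ := by
  induction n with
  | zero => simp [partialHolonomy]
  | succ n ih =>
    rw [partialHolonomy_succ', partialHolonomy_succ, Function.iterate_succ_apply',
      cross_exit_flip_turn, turn_flip_turn, ih, mul_inv_rev]

theorem iterate_turn_flip (n : ℕ) (F : Δ.Flag) :
    Δ.turn^[n] (Δ.flip (Δ.turn^[n] F)) = Δ.flip F := by
  induction n with
  | zero => rfl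
  | succ n ih => rw [Function.iterate_succ_apply, Function.iterate_succ_apply' _ n F,
      turn_flip_turn, ih]

theorem minimalPeriod_flip (F : Δ.Flag) :
    Function.minimalPeriod Δ.turn (Δ.flip F) = Function.minimalPeriod Δ.turn F := by
  have key : ∀ (F : Δ.Flag) n, Function.IsPeriodicPt Δ.turn n F →
      Function.IsPeriodicPt Δ.turn n (Δ.flip F) := by
    intro F n h
    have h' : Δ.turn^[n] F = F := h
    have := Δ.iterate_turn_flip n F
    rwa [h'] at this
  refine Function.minimalPeriod_eq_minimalPeriod_iff.2 fun n => ⟨fun h => ?_, key F n⟩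
  simpa [flip_flip] using key _ n h

theorem holonomy_flip (u : Face → A) (F : Δ.Flag) :
    Δ.holonomy u (Δ.flip F) = (Δ.holonomy u F)⁻¹ := by
  have := Δ.partialHolonomy_flip u (Function.minimalPeriod Δ.turn F) F
  rwa [Function.iterate_minimalPeriod, ← minimalPeriod_flip, ← holonomy_eq, minimalPeriod_flip,
    ← holonomy_eq] at this

theorem holonomy_eq_of_walkTo {u : Face → A} {F : Δ.Flag} {w : A}
    (h : WalkTo Δ.turn (fun F => Δ.cross u (Δ.exit F)) F (Δ.turn F) w) :
    Δ.holonomy u F = Δ.cross u (Δ.exit F) * w :=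
  h.prod_minimalPeriod

/-- The action of a gauge transformation `h` on a gauge field `u`. -/
def gauge (h : Tet → A) (u : Face → A) : Face → A :=
  fun f => h (Δ.src f) * u f * (h (Δ.tgt f))⁻¹

theorem cross_gauge (h : Tet → A) (u : Face → A) (x : Tet × Fin 4) :
    Δ.cross (Δ.gauge h u) x = h x.1 * Δ.cross u x * (h (Δ.glue x).1)⁻¹ := by
  obtain ⟨y, rfl⟩ := Δ.sides.surjective x
  rcases y with f | f
  · rw [glue_inl, cross_inl, cross_inl]; rfl
  · rw [glue_inr, cross_inr, cross_inr]; simp [gauge, src, tgt, mul_assoc]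

theorem partialHolonomy_gauge (h : Tet → A) (u : Face → A) (n : ℕ) (F : Δ.Flag) :
    Δ.partialHolonomy (Δ.gauge h u) n F
      = h F.1 * Δ.partialHolonomy u n F * (h (Δ.turn^[n] F).1)⁻¹ := by
  induction n with
  | zero => simp [partialHolonomy]
  | succ n ih =>
    have : (Δ.glue (Δ.exit (Δ.turn^[n] F))).1 = (Δ.turn (Δ.turn^[n] F)).1 := rfl
    rw [partialHolonomy_succ, partialHolonomy_succ, ih, cross_gauge, this,
      Function.iterate_succ_apply']
    simp only [exit]
    group

theorem curvature_gauge (h : Tet → A) (u : Face → A) (e : Δ.Edge) :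
    Δ.curvature (Δ.gauge h u) e
      = h (Quot.out e).1 * Δ.curvature u e * (h (Quot.out e).1)⁻¹ := by
  rw [curvature, holonomy_eq, partialHolonomy_gauge, Function.iterate_minimalPeriod]
  rfl

end holonomy

/-- The value of a class function at the curvature does not depend on the flag chosen to represent
the edge, because class functions on `SU(2)` are invariant under inversion. -/
theorem classFunction_curvature [Finite Tet] {χ : SU2 → ℝ} (hχ : IsClassFunction χ)
    (u : Face → SU2) (F : Δ.Flag) :
    χ (Δ.curvature u (Quot.mk _ F)) = χ (Δ.holonomy u F) := by
  have key : ∀ F F' : Δ.Flag, Relation.EqvGen (fun F F' => F' = Δ.turn F ∨ F' = Δ.flip F) F F' →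
      χ (Δ.holonomy u F) = χ (Δ.holonomy u F') := by
    intro F F' h
    induction h with
    | rel F F' h =>
      rcases h with rfl | rfl
      · rw [holonomy_turn]
        have := hχ (Δ.holonomy u F) (Δ.cross u (Δ.exit F))⁻¹
        rw [inv_inv] at this
        exact this.symm
      · rw [holonomy_flip, hχ.inv]
    | refl => rfl
    | symm _ _ _ ih => exact ih.symm
    | trans _ _ _ _ _ ih1 ih2 => exact ih1.trans ih2
  exact key _ _ (Quot.eqvGen_exact (Quot.out_eq _))

theorem classFunction_curvature_of_walkTo [Finite Tet] {χ : SU2 → ℝ} (hχ : IsClassFunction χ)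
    {u : Face → SU2} {F : Δ.Flag} {w : SU2}
    (h : WalkTo Δ.turn (fun F => Δ.cross u (Δ.exit F)) F (Δ.turn F) w) :
    χ (Δ.curvature u (Quot.mk _ F)) = χ (Δ.cross u (Δ.exit F) * w) := by
  rw [classFunction_curvature _ hχ, holonomy_eq_of_walkTo _ h]

theorem continuous_curvature (e : Δ.Edge) :
    Continuous fun u : Face → SU2 => Δ.curvature u e := by
  unfold curvature holonomy
  refine continuous_list_prod _ fun i _ => ?_
  unfold cross
  rcases Δ.sides.symm _ with f | f
  · exact continuous_apply f
  · exact (continuous_apply f).inv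

instance [Finite Tet] : Finite Δ.Edge := by
  unfold Edge; infer_instance

open Classical in
theorem continuous_deltaProduct [Finite Tet] {E K : Set Δ.Edge} {χ δ : Δ.Edge → SU2 → ℝ}
    (h : ∀ e ∈ E, Continuous (if e ∈ K then χ e else δ e)) :
    Continuous (Δ.deltaProduct E K χ δ) := by
  have := Fintype.ofFinite E
  unfold deltaProduct
  simp only [finprod_eq_prod_of_fintype]
  exact continuous_finsetProd _ fun e _ => (h e e.2).comp (Δ.continuous_curvature e)

open Classical in
theorem deltaProduct_gauge {E K : Set Δ.Edge} {χ δ : Δ.Edge → SU2 → ℝ}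
    (h : ∀ e ∈ E, IsClassFunction (if e ∈ K then χ e else δ e)) (γ : Tet → SU2) (u : Face → SU2) :
    Δ.deltaProduct E K χ δ (Δ.gauge γ u) = Δ.deltaProduct E K χ δ u := by
  unfold deltaProduct
  refine finprod_congr fun e => ?_
  rw [curvature_gauge]
  exact h e e.2 _ _

end Gluing

/-! ### Lorentz gauge fixing -/

theorem continuous_fillIn {ι : Type} (S : Set ι) (c : ι → SU2) : Continuous (fillIn S c) := by
  refine continuous_pi fun i => ?_
  by_cases h : i ∈ S
  · simp only [fillIn, h, dif_pos]; fun_prop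
  · simp only [fillIn, h, dif_neg, not_false_eq_true]; fun_prop

/-- Integrating over the coordinates off `S` amounts to integrating over all of them and
overwriting those in `S`. -/
theorem integral_fillIn {ι : Type} [Finite ι] (S : Set ι) (c : ι → SU2) {D : (ι → SU2) → ℝ}
    (hD : Continuous D) :
    ∫ x, D (fillIn S c x) ∂haarPi ↥Sᶜ = ∫ x, D (overwrite S c x) ∂haarPi ι := by
  rw [← (measurePreserving_comp_injective
    (Subtype.val_injective (p := (· ∈ Sᶜ)))).integral_comp_of_continuous
      (Ψ := fun x => D (fillIn S c x)) (hD.comp (continuous_fillIn S c))]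
  rfl

namespace Gluing

variable {Tet Face : Type} (Δ : Gluing Tet Face)

theorem Joined.mono {B : Set Tet} {T T' : Set Face} (h : T ⊆ T') {t t' : Tet}
    (ht : Δ.Joined B T t t') : Δ.Joined B T' t t' :=
  Relation.EqvGen.mono
    (r := fun t t' => (t ∈ B ∧ t' ∈ B) ∨ ∃ f ∈ T, Δ.src f = t ∧ Δ.tgt f = t')
    (fun _ _ h' => h'.imp id fun ⟨f, hf, h1⟩ => ⟨f, h hf, h1⟩) _ _ ht

theorem IsForest.subset {B : Set Tet} {T T' : Set Face} (hT : Δ.IsForest B T') (h : T ⊆ T') :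
    Δ.IsForest B T := fun f hf hj =>
  hT f (h hf) (Joined.mono Δ (Set.sdiff_subset_sdiff_left h) hj)

/-- A dual vertex set which separates the end points of a dual edge `f` from each other, but not
those of the dual edges of `T`, and which avoids `B`. -/
theorem exists_separating {B : Set Tet} {T : Set Face} {f : Face}
    (h : ¬ Δ.Joined B T (Δ.src f) (Δ.tgt f)) :
    ∃ C : Set Tet, (∀ b ∈ B, b ∉ C) ∧ (∀ e ∈ T, Δ.src e ∈ C ↔ Δ.tgt e ∈ C) ∧
      ((Δ.src f ∈ C ∧ Δ.tgt f ∉ C) ∨ (Δ.src f ∉ C ∧ Δ.tgt f ∈ C)) := by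
  have hT : ∀ t, ∀ e ∈ T, Δ.Joined B T t (Δ.src e) ↔ Δ.Joined B T t (Δ.tgt e) := by
    intro t e he
    have hj : Δ.Joined B T (Δ.src e) (Δ.tgt e) := .rel _ _ (.inr ⟨e, he, rfl, rfl⟩)
    exact ⟨fun h => h.trans _ _ _ hj, fun h => h.trans _ _ _ (hj.symm _ _)⟩
  by_cases hB : ∃ b ∈ B, Δ.Joined B T (Δ.src f) b
  · obtain ⟨b, hb, hsb⟩ := hB
    refine ⟨{t | Δ.Joined B T (Δ.tgt f) t}, fun b' hb' ht => h ?_, hT _, .inr ⟨?_, ?_⟩⟩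
    · have : Δ.Joined B T b b' := .rel _ _ (.inl ⟨hb, hb'⟩)
      exact hsb.trans _ _ _ (this.trans _ _ _ (ht.symm _ _))
    · exact fun ht => h (ht.symm _ _)
    · exact .refl _
  · push Not at hB
    exact ⟨{t | Δ.Joined B T (Δ.src f) t}, hB, hT _, .inl ⟨.refl _, h⟩⟩

open Classical in
/-- One step of the gauge fixing: if the gauge transformations `h z` leave the fixed values on `S`
unchanged and move the value `z` on the dual edge `f` to `c f`, then `f` may be fixed, too. -/
theorem integral_piecewise_insert [Finite Face] {B : Set Tet} {S : Set Face} {c : Face → SU2}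
    {f : Face} {D : (Face → SU2) → ℝ} (hD : Continuous D)
    (hinv : ∀ γ u, (∀ b ∈ B, γ b = 1) → D (Δ.gauge γ u) = D u)
    {h : SU2 → Tet → SU2} (hc : ∀ t, Continuous fun z => h z t) (hB : ∀ z, ∀ b ∈ B, h z b = 1)
    (hS : ∀ z, ∀ e ∈ S, h z (Δ.src e) * c e * (h z (Δ.tgt e))⁻¹ = c e)
    (hf : ∀ z, h z (Δ.src f) * z * (h z (Δ.tgt f))⁻¹ = c f) (hfS : f ∉ S) :
    ∫ x, D (overwrite S c x) ∂haarPi Face = ∫ x, D (overwrite (insert f S) c x) ∂haarPi Face := by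
  set A : SU2 → (Face → SU2) → ℝ := fun z x =>
    D (overwrite (insert f S) c (Δ.gauge (h z) x)) with hA
  have hDc : Continuous fun x => D (overwrite (insert f S) c x) :=
    hD.comp ((continuous_overwrite _).comp (Continuous.prodMk_right c))
  have h1 : ∀ x, D (overwrite S c x) = A (x f) x := by
    intro x
    rw [hA, ← hinv (h (x f)) _ (hB _)]
    dsimp only
    congr 1
    ext1 e
    by_cases he : e ∈ S
    · simp [overwrite, he, gauge, hS]
    · by_cases hef : e = f
      · subst hef
        simp [overwrite, he, gauge, hf]
      · simp [overwrite, he, hef, gauge]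
  have hAc : Continuous (Function.uncurry A) := by
    refine hDc.comp (f := fun p : SU2 × (Face → SU2) => Δ.gauge (h p.1) p.2)
      (continuous_pi fun e => ?_)
    unfold gauge
    exact (((hc _).comp continuous_fst).mul (by fun_prop)).mul ((hc _).comp continuous_fst).inv
  simp only [h1]
  rw [integral_decouple f hAc]
  · have h2 : ∀ z, ∫ x, A z x ∂haarPi Face
        = ∫ x, D (overwrite (insert f S) c x) ∂haarPi Face := by
      intro z
      symm
      rw [← integral_mul_left_eq_self _ (fun e => h z (Δ.src e)),
        ← integral_mul_right_eq_self _ (fun e => (h z (Δ.tgt e))⁻¹)]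
      refine integral_congr_ae (ae_of_all _ fun x => ?_)
      simp only [hA]
      congr 2
      ext1 e
      simp [gauge, mul_assoc]
    simp [h2]
  · intro z x y
    simp only [hA]
    congr 1
    ext1 e
    by_cases hef : e = f
    · subst hef; simp [overwrite]
    · by_cases he : e ∈ S <;> simp [overwrite, he, hef, gauge]

/-- Lorentz gauge fixing along a forest does not change the integral of a gauge invariant
function. Gauge transformations are trivial on `B`, and `L` is a set of dual edges between dual
vertices of `B`, on which the gauge field is fixed anyway. -/
theorem integral_gaugeFixing [Finite Face] {B : Set Tet} {L T : Set Face} {c : Face → SU2}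
    {D : (Face → SU2) → ℝ} (hD : Continuous D)
    (hinv : ∀ γ u, (∀ b ∈ B, γ b = 1) → D (Δ.gauge γ u) = D u)
    (hL : ∀ f ∈ L, Δ.src f ∈ B ∧ Δ.tgt f ∈ B) (hc : ∀ f ∉ L, c f = 1)
    (hT : Δ.IsForest B T) :
    ∫ x, D (overwrite (L ∪ T) c x) ∂haarPi Face = ∫ x, D (overwrite L c x) ∂haarPi Face := by
  classical
  induction T, Set.toFinite T using Set.Finite.induction_on with
  | empty => rw [Set.union_empty]
  | @insert f T hfT _ ih =>
    have hsub := hT.subset Δ (Set.subset_insert f T)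
    have hf := hT f (Set.mem_insert f T)
    rw [Set.insert_sdiff_of_mem _ (by simp), Set.sdiff_singleton_eq_self hfT] at hf
    have hfL : f ∉ L := fun h => hf (.rel _ _ (.inl (hL f h)))
    have hTL : ∀ e ∈ T, e ∉ L := fun e he h => hsub e he (.rel _ _ (.inl (hL e h)))
    obtain ⟨C, hCB, hCT, hCf⟩ := Δ.exists_separating hf
    rw [← ih hsub, Set.union_insert]
    symm
    rcases hCf with ⟨h1, h2⟩ | ⟨h1, h2⟩
    · refine Δ.integral_piecewise_insert (h := fun z t => if t ∈ C then z⁻¹ else 1) hD hinv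
        (fun t => ?_) (fun z b hb => if_neg (hCB b hb)) (fun z e he => ?_) (fun z => ?_)
        (by simp [hfL, hfT])
      · by_cases ht : t ∈ C <;> simp only [ht, if_true, if_false] <;> fun_prop
      · rcases he with he | he
        · simp [hCB _ (hL e he).1, hCB _ (hL e he).2]
        · by_cases h : Δ.src e ∈ C
          · simp [h, (hCT e he).1 h, hc e (hTL e he)]
          · simp [h, mt (hCT e he).2 h]
      · simp [h1, h2, hc f hfL]
    · refine Δ.integral_piecewise_insert (h := fun z t => if t ∈ C then z else 1) hD hinv
        (fun t => ?_) (fun z b hb => if_neg (hCB b hb)) (fun z e he => ?_) (fun z => ?_)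
        (by simp [hfL, hfT])
      · by_cases ht : t ∈ C <;> simp only [ht, if_true, if_false] <;> fun_prop
      · rcases he with he | he
        · simp [hCB _ (hL e he).1, hCB _ (hL e he).2]
        · by_cases h : Δ.src e ∈ C
          · simp [h, (hCT e he).1 h, hc e (hTL e he)]
          · simp [h, mt (hCT e he).2 h]
      · simp [h1, h2, hc f hfL]

end Gluing

/-! ### The vertex links of a triangulated surface -/

namespace SurfaceGluing

variable {Tri SEdge : Type} (S : SurfaceGluing Tri SEdge)

/-- The other occurrence of a side of a triangle. -/
def glue (h : Tri × Fin 3) : Tri × Fin 3 := S.sides (S.sides.symm h).swap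

/-- The edge of the surface to which a side of a triangle is glued. -/
def edgeOf (h : Tri × Fin 3) : SEdge := Sum.elim id id (S.sides.symm h)

/-- The holonomy, in the gauge field `u`, of the path which leaves the triangle `h.1` through its
side `h`. -/
def cross {A : Type} [Group A] (u : SEdge → A) (h : Tri × Fin 3) : A :=
  Sum.elim u (fun e => (u e)⁻¹) (S.sides.symm h)

/-- The corner `(t, k, m)` is the vertex of `t` which is common to its sides opposite `k` and
`k.succAbove m`, together with the decision to turn around it by leaving `t` through the side
opposite `k`. It is the last vertex of this side if `m = 0`, and the first one if `m = 1`. -/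
abbrev Corner (_S : SurfaceGluing Tri SEdge) : Type := Tri × Fin 3 × Fin 2

/-- The same corner, with the opposite direction of turning. -/
def flip (F : S.Corner) : S.Corner := (F.1, F.2.1.succAbove F.2.2, F.2.2.predAbove F.2.1)

/-- One step around a vertex. -/
def turn (F : S.Corner) : S.Corner :=
  S.flip ((S.glue (F.1, F.2.1)).1, (S.glue (F.1, F.2.1)).2, F.2.2)

theorem glue_sides (x : SEdge ⊕ SEdge) : S.glue (S.sides x) = S.sides x.swap := by simp [glue]

theorem turn_sides (x : SEdge ⊕ SEdge) (m : Fin 2) :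
    S.turn ((S.sides x).1, (S.sides x).2, m)
      = S.flip ((S.sides x.swap).1, (S.sides x.swap).2, m) := by
  have : S.glue ((S.sides x).1, (S.sides x).2) = S.sides x.swap := S.glue_sides x
  simp only [turn, this]

theorem edgeOf_sides (x : SEdge ⊕ SEdge) : S.edgeOf (S.sides x) = Sum.elim id id x := by
  simp [edgeOf]

theorem cross_sides {A : Type} [Group A] (u : SEdge → A) (x : SEdge ⊕ SEdge) :
    S.cross u (S.sides x) = Sum.elim u (fun e => (u e)⁻¹) x := by
  simp [cross]

end SurfaceGluing

/-! ### The vertex link of the one-vertex triangulation of `Σ_g` -/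

namespace genusSurface

variable {g : ℕ}

/-- The corner at `v₀` of the triangle `t` of the fan, left through the side `v₀ v_{t+1}`. -/
noncomputable def apexCorner (t : ℕ) (ht : t < 4 * g - 2) : (genusSurface g).Corner :=
  (⟨t, ht⟩, if (t + 1) % 4 < 2 then 2 else 1, 1)

/-- The corner at `v_s` of the `4g`-gon, about to cross the side `s = v_s v_{s+1}`. -/
noncomputable def departure (s : ℕ) (hs : s < 4 * g) : (genusSurface g).Corner :=
  ((fanSide ⟨s, hs⟩).1, (fanSide ⟨s, hs⟩).2, if s % 4 < 2 then 1 else 0)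

/-- The corner at `v_{s+1}` of the `4g`-gon, just after having entered it through the side `s`. -/
noncomputable def arrival (s : ℕ) (hs : s < 4 * g) : (genusSurface g).Corner :=
  (genusSurface g).flip ((fanSide ⟨s, hs⟩).1, (fanSide ⟨s, hs⟩).2, if s % 4 < 2 then 0 else 1)

theorem fanSide_zero (h : 0 < 4 * g) : fanSide (g := g) ⟨0, h⟩ = (⟨0, by omega⟩, 2) := rfl

theorem fanSide_last {s : ℕ} (hs : s < 4 * g) (h : s + 1 = 4 * g) :
    fanSide ⟨s, hs⟩ = (⟨4 * g - 3, by omega⟩, 2) := by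
  have h1 : s ≠ 0 := by omega
  have h2 : s = 4 * g - 1 := by omega
  rw [fanSide, if_neg h1, dif_pos h2]

theorem fanSide_mid {s : ℕ} (hs : s < 4 * g) (h0 : s ≠ 0) (h : s + 1 ≠ 4 * g) :
    fanSide ⟨s, hs⟩ = (⟨s - 1, by omega⟩, 0) := by
  have h2 : s ≠ 4 * g - 1 := by omega
  rw [fanSide, if_neg h0, dif_neg h2]

variable {A : Type} [Group A]

/-- Words read when turning around the vertex of the surface up to the corner at `v₀` of the first
triangle. -/
abbrev Walk (ℓ : FanEdge g → A) (hg : 0 < 4 * g - 2) : (genusSurface g).Corner → A → Prop :=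
  WalkTo (genusSurface g).turn (fun F => (genusSurface g).cross ℓ (F.1, F.2.1)) (apexCorner 0 hg)

section
variable {ℓ : FanEdge g → A} (hg : 0 < 4 * g - 2)

/-- Crossing the side of a triangle of the fan. -/
theorem walk_cross {x y : FanEdge g ⊕ FanEdge g} (hxy : x.swap = y) {m : Fin 2} {w : A}
    (hne : ((fanGlue x).1, (fanGlue x).2, m) ≠ apexCorner 0 hg)
    (h : Walk ℓ hg ((genusSurface g).flip ((fanGlue y).1, (fanGlue y).2, m)) w) :
    Walk ℓ hg ((fanGlue x).1, (fanGlue x).2, m) (Sum.elim ℓ (fun e => (ℓ e)⁻¹) x * w) := by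
  subst hxy
  have := WalkTo.step_to (wt := fun F => (genusSurface g).cross ℓ (F.1, F.2.1)) hne
    ((genusSurface g).turn_sides x m) h
  have hc := (genusSurface g).cross_sides ℓ x
  dsimp only at this
  rwa [show (fanGlue x).1 = ((genusSurface g).sides x).1 from rfl,
    show (fanGlue x).2 = ((genusSurface g).sides x).2 from rfl, ← hc]

theorem walk_apexCorner (hℓ : ∀ j, ℓ (.d j) = 1) (t : ℕ) (ht : t < 4 * g - 2) :
    Walk ℓ hg (apexCorner t ht) 1 := by
  induction t with
  | zero => exact .done
  | succ t ih =>
    have hj : t < 4 * g - 3 := by omega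
    have h := ih (by omega)
    have := walk_cross (ℓ := ℓ) hg (x := .inr (.d ⟨t, hj⟩)) (y := .inl (.d ⟨t, hj⟩)) rfl
      (m := 1) (w := 1) (by simp [fanGlue, apexCorner]) (by
        convert h using 1
        by_cases ho : (t + 1) % 4 < 2 <;> simp [fanGlue, apexCorner, SurfaceGluing.flip, ho] <;>
          decide)
    simpa [hℓ, apexCorner, fanGlue] using this

theorem walk_arrival_last (hℓ : ∀ j, ℓ (.d j) = 1) (s : ℕ) (hs : s < 4 * g) (h : s + 1 = 4 * g) :
    Walk ℓ hg (arrival s hs) 1 := by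
  convert walk_apexCorner hg hℓ (4 * g - 3) (by omega) using 1
  have h3 : ¬ s % 4 < 2 := by omega
  have h4 : ¬ (4 * g - 3 + 1) % 4 < 2 := by omega
  rw [arrival, apexCorner, fanSide_last hs h, if_neg h3, if_neg h4]
  rfl

theorem walk_arrival (hℓ : ∀ j, ℓ (.d j) = 1) {s : ℕ} (hs : s + 1 < 4 * g) {w : A}
    (h : Walk ℓ hg (departure (s + 1) hs) w) : Walk ℓ hg (arrival s (by omega)) w := by
  by_cases h0 : s = 0
  · subst h0
    convert h using 1
    rw [arrival, departure, fanSide_zero, fanSide_mid hs (by omega) (by omega)]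
    rfl
  by_cases hl : s + 2 = 4 * g
  · convert h using 1
    have h3 : ¬ s % 4 < 2 := by omega
    have h4 : ¬ (s + 1) % 4 < 2 := by omega
    have h5 : s - 1 = 4 * g - 3 := by omega
    rw [arrival, departure, fanSide_last hs (by omega), fanSide_mid _ h0 (by omega), if_neg h3,
      if_neg h4]
    simp only [SurfaceGluing.flip, h5]
    rfl
  · have hj : s - 1 < 4 * g - 3 := by omega
    have h3 : s - 1 + 1 = s := by omega
    have h4 : s - 1 + 2 = s + 1 := by omega
    have := walk_cross (ℓ := ℓ) hg (x := .inl (.d ⟨s - 1, hj⟩)) (y := .inr (.d ⟨s - 1, hj⟩)) rfl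
      (m := 0) (w := w) (by simp [apexCorner]) (by
        convert h using 1
        rw [departure, fanSide_mid _ (by omega) (by omega)]
        by_cases ho : (s + 1) % 4 < 2 <;>
          simp only [fanGlue, SurfaceGluing.flip, ho, h3, h4, if_true, if_false] <;> rfl)
    convert this using 1
    · rw [arrival, fanSide_mid _ (by omega) (by omega)]
      by_cases ho : s % 4 < 2 <;>
        simp only [fanGlue, SurfaceGluing.flip, ho, h3, if_true, if_false] <;> rfl
    · simp [hℓ]

theorem departure_ne {s : ℕ} (hs : s < 4 * g) (h : s ≠ 0) : departure s hs ≠ apexCorner 0 hg := by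
  intro he
  rw [departure, apexCorner] at he
  by_cases hl : s + 1 = 4 * g
  · rw [fanSide_last hs hl] at he
    have h3 : ¬ s % 4 < 2 := by omega
    simp [h3] at he
  · rw [fanSide_mid hs h hl] at he
    simp at he

/-- The holonomy of the path which leaves the `4g`-gon through the side `s`. -/
def sideHolonomy (ℓ : FanEdge g → A) (i : Fin g) : Fin 4 → A
  | 0 => ℓ (.a i)
  | 1 => (ℓ (.b i))⁻¹
  | 2 => (ℓ (.a i))⁻¹
  | 3 => ℓ (.b i)

/-- The side `4 i + c` of the `4g`-gon is glued to the side `4 i + (c + 2)`, the sum being taken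
modulo `4`. -/
theorem walk_departure (i : Fin g) (c : Fin 4) (h : 4 * i.1 + c.1 ≠ 0) {w : A}
    (hw : Walk ℓ hg (arrival (4 * i.1 + (c + 2).1) (by omega)) w) :
    Walk ℓ hg (departure (4 * i.1 + c.1) (by omega)) (sideHolonomy ℓ i c * w) := by
  have hne := departure_ne hg (s := 4 * i.1 + c.1) (by omega) h
  rw [departure] at hne ⊢
  rw [arrival] at hw
  fin_cases c
  all_goals simp only [Nat.mul_add_mod, Fin.isValue, Fin.mk_one, Fin.zero_eta, Fin.reduceFinMk]
    at hne hw ⊢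
  · exact walk_cross hg (x := .inl (.a i)) (y := .inr (.a i)) rfl hne hw
  · exact walk_cross hg (x := .inr (.b i)) (y := .inl (.b i)) rfl hne hw
  · exact walk_cross hg (x := .inr (.a i)) (y := .inl (.a i)) rfl hne hw
  · exact walk_cross hg (x := .inl (.b i)) (y := .inr (.b i)) rfl hne hw

end

section
variable {A : Type} [Group A] {ℓ : FanEdge g → A} (hg : 0 < 4 * g - 2)

/-- The commutators of the word `∏ [aᵢ, bᵢ]`. -/
def commutators (ℓ : FanEdge g → A) : List A :=
  List.ofFn fun i => ℓ (.a i) * ℓ (.b i) * (ℓ (.a i))⁻¹ * (ℓ (.b i))⁻¹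

/-- The four corners of the polygon passed between the crossings of the sides `aᵢ`, `bᵢ`, `aᵢ⁻¹` and
`bᵢ⁻¹`, in the order of the turn around the vertex: `4 i + 2`, `4 i + 1`, `4 i`, `4 i + 3`. -/
theorem walk_block (hℓ : ∀ j, ℓ (.d j) = 1) (i : Fin g) {w : A}
    (hw : Walk ℓ hg (arrival (4 * i.1 + 3) (by omega)) w) :
    Walk ℓ hg (arrival (4 * i.1) (by omega)) ((ℓ (.b i))⁻¹ * w) ∧
    Walk ℓ hg (arrival (4 * i.1 + 1) (by omega)) ((ℓ (.a i))⁻¹ * ((ℓ (.b i))⁻¹ * w)) ∧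
    Walk ℓ hg (arrival (4 * i.1 + 2) (by omega))
      (ℓ (.b i) * ((ℓ (.a i))⁻¹ * ((ℓ (.b i))⁻¹ * w))) := by
  have h0 := walk_arrival hg hℓ _ (walk_departure hg i 1 (by simp) hw)
  have h1 := walk_arrival hg hℓ _ (walk_departure hg i 2 (by simp) h0)
  have h2 := walk_arrival hg hℓ _ (walk_departure hg i 3 (by simp) h1)
  exact ⟨h0, h1, h2⟩

theorem walk_arrival_block (hℓ : ∀ j, ℓ (.d j) = 1) (n : ℕ) : ∀ i : Fin g, i.1 + 1 + n = g →
    Walk ℓ hg (arrival (4 * i.1 + 3) (by omega)) ((commutators ℓ).drop (i.1 + 1)).prod := by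
  induction n with
  | zero =>
    intro i hi
    rw [List.drop_of_length_le (by simp [commutators]; omega)]
    exact walk_arrival_last hg hℓ _ _ (by omega)
  | succ n ih =>
    intro i hi
    have hi1 : i.1 + 1 < g := by omega
    have h2 := (walk_block hg hℓ ⟨i.1 + 1, hi1⟩ (ih ⟨i.1 + 1, hi1⟩ (by simp only; omega))).2.2
    have := walk_arrival hg hℓ (s := 4 * i.1 + 3) (by omega)
      (walk_departure hg ⟨i.1 + 1, hi1⟩ 0 (by simp) h2)
    convert this using 1
    rw [List.drop_eq_getElem_cons (by simp [commutators]; omega), List.prod_cons]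
    simp [commutators, sideHolonomy, mul_assoc]

theorem exists_walk_arrival (hℓ : ∀ j, ℓ (.d j) = 1) (s : ℕ) (hs : s < 4 * g) :
    ∃ w, Walk ℓ hg (arrival s hs) w := by
  obtain ⟨i, c, hc, rfl⟩ : ∃ i c, c < 4 ∧ s = 4 * i + c := ⟨s / 4, s % 4, by omega, by omega⟩
  have h3 := walk_arrival_block hg hℓ (g - i - 1) ⟨i, by omega⟩ (by simp only; omega)
  obtain ⟨h0, h1, h2⟩ := walk_block hg hℓ ⟨i, by omega⟩ h3
  interval_cases c
  · exact ⟨_, h0⟩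
  · exact ⟨_, h1⟩
  · exact ⟨_, h2⟩
  · exact ⟨_, h3⟩

theorem exists_walk_departure (hℓ : ∀ j, ℓ (.d j) = 1) (s : ℕ) (hs : s < 4 * g) (h : s ≠ 0) :
    ∃ w, Walk ℓ hg (departure s hs) w := by
  obtain ⟨i, c, hc, rfl⟩ : ∃ i c, c < 4 ∧ s = 4 * i + c := ⟨s / 4, s % 4, by omega, by omega⟩
  obtain ⟨w, hw⟩ := exists_walk_arrival hg hℓ (4 * i + ((⟨c, hc⟩ : Fin 4) + 2).1) (by omega)
  exact ⟨_, walk_departure hg ⟨i, by omega⟩ ⟨c, hc⟩ h hw⟩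

/-- Turning once around the vertex of the surface, the word `∏ [aᵢ, bᵢ]` is read. -/
theorem walk_turn_apexCorner (hℓ : ∀ j, ℓ (.d j) = 1) : ∃ w,
    Walk ℓ hg ((genusSurface g).turn (apexCorner 0 hg)) w ∧
      (genusSurface g).cross ℓ ((apexCorner 0 hg).1, (apexCorner 0 hg).2.1) * w
        = (commutators ℓ).prod := by
  have hg0 : 0 < g := by omega
  have h3 := walk_arrival_block hg hℓ (g - 1) ⟨0, hg0⟩ (by simp only; omega)
  have h2 := (walk_block hg hℓ ⟨0, hg0⟩ h3).2.2
  have ht : (genusSurface g).turn (apexCorner 0 hg)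
      = arrival (4 * (⟨0, hg0⟩ : Fin g).1 + 2) (by simp only; omega) :=
    (genusSurface g).turn_sides (.inl (.a ⟨0, hg0⟩)) 1
  rw [← ht] at h2
  refine ⟨_, h2, ?_⟩
  have hc := (genusSurface g).cross_sides ℓ (.inl (.a ⟨0, hg0⟩))
  have hs : (genusSurface g).sides (.inl (.a ⟨0, hg0⟩))
    = ((apexCorner 0 hg).1, (apexCorner 0 hg).2.1) := rfl
  rw [← hs, hc]
  conv_rhs => rw [← List.drop_zero (l := commutators ℓ),
    List.drop_eq_getElem_cons (by simp [commutators]; omega), List.prod_cons]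
  simp [commutators, mul_assoc]

/-- Up to the direction of turning, every corner of the surface is met. -/
theorem exists_walk (hℓ : ∀ j, ℓ (.d j) = 1) (F : (genusSurface g).Corner) :
    (∃ w, Walk ℓ hg F w) ∨ ∃ w, Walk ℓ hg ((genusSurface g).flip F) w := by
  obtain ⟨⟨t, ht⟩, k, m⟩ := F
  have h0 := walk_apexCorner hg hℓ t ht
  obtain ⟨w1, h1⟩ := exists_walk_departure hg hℓ (t + 1) (by omega) (by omega)
  obtain ⟨w2, h2⟩ := exists_walk_arrival hg hℓ (t + 1) (by omega)
  rw [departure, fanSide_mid _ (by omega) (by omega)] at h1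
  rw [arrival, fanSide_mid _ (by omega) (by omega)] at h2
  rw [apexCorner] at h0
  simp only [Nat.add_sub_cancel] at h0 h1 h2
  by_cases ho : (t + 1) % 4 < 2 <;> simp only [ho, if_true, if_false] at h0 h1 h2 <;>
    fin_cases k <;> fin_cases m <;>
    first
      | exact .inl ⟨_, h0⟩
      | exact .inl ⟨_, h1⟩
      | exact .inl ⟨_, h2⟩
      | exact .inr ⟨_, h0⟩
      | exact .inr ⟨_, h1⟩
      | exact .inr ⟨_, h2⟩

/-- The vertex link of the surface is connected. -/
theorem eq_of_turn_flip_invariant {α : Type} {Z : (genusSurface g).Corner → α}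
    (ht : ∀ F, Z ((genusSurface g).turn F) = Z F) (hf : ∀ F, Z ((genusSurface g).flip F) = Z F)
    (hg : 0 < 4 * g - 2) (F : (genusSurface g).Corner) : Z F = Z (apexCorner 0 hg) := by
  rcases exists_walk (A := SU2) (ℓ := fun _ => 1) hg (fun _ => rfl) F with ⟨w, h⟩ | ⟨w, h⟩
  · exact h.eq_of_invariant ht
  · rw [← hf]; exact h.eq_of_invariant ht

end

end genusSurface

/-! ### Edges and vertices of a gluing -/

namespace Gluing

variable {Tet Face : Type} (Δ : Gluing Tet Face)

/-- The edge of the triangulation represented by a flag. -/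
def edge (F : Δ.Flag) : Δ.Edge := Quot.mk _ F

theorem edge_flip (F : Δ.Flag) : Δ.edge (Δ.flip F) = Δ.edge F := (Quot.sound (.inr rfl)).symm

theorem edge_turn (F : Δ.Flag) : Δ.edge (Δ.turn F) = Δ.edge F := (Quot.sound (.inl rfl)).symm

theorem edge_across (F : Δ.Flag) : Δ.edge (Δ.across F) = Δ.edge F := by
  rw [← edge_flip, flip_across, edge_turn]

/-- The triangle of the triangulation to which a triangle of a tetrahedron is glued. -/
def faceOf (h : Tet × Fin 4) : Face := Sum.elim id id (Δ.sides.symm h)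

theorem faceOf_sides (x : Face ⊕ Face) : Δ.faceOf (Δ.sides x) = Sum.elim id id x := by
  simp [faceOf]

theorem faceOf_glue (h : Tet × Fin 4) : Δ.faceOf (Δ.glue h) = Δ.faceOf h := by
  obtain ⟨x | x, rfl⟩ := Δ.sides.surjective h
  · rw [glue_inl, faceOf_sides, faceOf_sides]; rfl
  · rw [glue_inr, faceOf_sides, faceOf_sides]; rfl

theorem edgeOpp_faceOf (F : Δ.Flag) : Δ.edgeOpp (Δ.faceOf (Δ.exit F)) F.2.2 = Δ.edge F := by
  obtain ⟨x, hx⟩ := Δ.sides.surjective (Δ.exit F)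
  rw [← hx, faceOf_sides]
  rcases x with f | f
  · change Δ.edge ((Δ.sides (.inl f)).1, (Δ.sides (.inl f)).2, F.2.2) = _
    rw [hx]; rfl
  · rw [← edge_across, across, ← hx, glue_inr]; rfl

/-- A function of the sides of triangles which is the same for the two triangles of a tetrahedron at
each of its edges is a function of the edges of the triangulation. -/
def edgeLift {α : Type} (lab : Face → Fin 3 → α)
    (h : ∀ F : Δ.Flag, lab (Δ.faceOf (Δ.exit (Δ.flip F))) (Δ.flip F).2.2
      = lab (Δ.faceOf (Δ.exit F)) F.2.2) : Δ.Edge → α :=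
  Quot.lift (fun F => lab (Δ.faceOf (Δ.exit F)) F.2.2) (by
    rintro F F' (rfl | rfl)
    · rw [← flip_across, h]
      change _ = lab (Δ.faceOf (Δ.glue (Δ.exit F))) F.2.2
      rw [faceOf_glue]
    · exact (h F).symm)

theorem edgeLift_edgeOpp {α : Type} (lab : Face → Fin 3 → α) (h) (f : Face) (m : Fin 3) :
    Δ.edgeLift lab h (Δ.edgeOpp f m) = lab f m := by
  change lab (Δ.faceOf (Δ.sides (.inl f))) m = _
  rw [faceOf_sides]; rfl

/-- The vertex of the triangulation represented by a vertex of a tetrahedron. -/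
def vertex (v : Tet × Fin 4) : Δ.Vertex := Quot.mk _ v

theorem vertex_glue (h : Tet × Fin 4) (m : Fin 3) :
    Δ.vertex ((Δ.glue h).1, (Δ.glue h).2.succAbove m) = Δ.vertex (h.1, h.2.succAbove m) :=
  (Quot.sound ⟨h.2, m, rfl, rfl⟩).symm

/-- The first (`j = 0`) or last (`j = 1`) vertex of the edge represented by a flag. -/
def endpoint (j : Fin 2) (F : Δ.Flag) : Δ.Vertex :=
  Δ.vertex (F.1, F.2.1.succAbove (F.2.2.succAbove j))

theorem endpoint_flip (j : Fin 2) (F : Δ.Flag) : Δ.endpoint j (Δ.flip F) = Δ.endpoint j F := by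
  have : ∀ (l : Fin 4) (m : Fin 3) (j : Fin 2),
      (l.succAbove m).succAbove ((m.predAbove l).succAbove j) = l.succAbove (m.succAbove j) := by
    decide
  simp only [endpoint, flip, this]

theorem endpoint_turn (j : Fin 2) (F : Δ.Flag) : Δ.endpoint j (Δ.turn F) = Δ.endpoint j F := by
  rw [← flip_across, endpoint_flip]
  exact Δ.vertex_glue (Δ.exit F) (F.2.2.succAbove j)

end Gluing

/-! ### Triangulations by prisms -/

/-- An embedding of the prisms over the triangles of a triangulated surface in a triangulation: the
common structure of `Σ × S¹` and `Σ × I`. -/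
structure PrismGluing {Tri SEdge : Type} (S : SurfaceGluing Tri SEdge) {Tet Face : Type}
    (Δ : Gluing Tet Face) where
  /-- The tetrahedra of the prisms. -/
  tet : Tri × PrismTet → Tet
  /-- The triangles between the tetrahedra `P` and `I`. -/
  pi : Tri → Face
  /-- The triangles between the tetrahedra `I` and `F`. -/
  fi : Tri → Face
  /-- The lower walls. -/
  lo : SEdge → Face
  /-- The upper walls. -/
  up : SEdge → Face
  tet_injective : Function.Injective tet
  sides_pi_inl : ∀ t, Δ.sides (.inl (pi t)) = (tet (t, .P), 2)
  sides_pi_inr : ∀ t, Δ.sides (.inr (pi t)) = (tet (t, .I), 2)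
  sides_fi_inl : ∀ t, Δ.sides (.inl (fi t)) = (tet (t, .I), 1)
  sides_fi_inr : ∀ t, Δ.sides (.inr (fi t)) = (tet (t, .F), 1)
  sides_lo : ∀ x : SEdge ⊕ SEdge, Δ.sides (x.map lo lo) =
    (tet ((S.sides x).1, (loPos (S.sides x).2).1), (loPos (S.sides x).2).2)
  sides_up : ∀ x : SEdge ⊕ SEdge, Δ.sides (x.map up up) =
    (tet ((S.sides x).1, (upPos (S.sides x).2).1), (upPos (S.sides x).2).2)

namespace PrismGluing

variable {Tri SEdge : Type} {S : SurfaceGluing Tri SEdge} {Tet Face : Type}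
  {Δ : Gluing Tet Face} (Q : PrismGluing S Δ)

/-- A flag in the prism over `t`, which leaves through the triangle at the position `p`. -/
def flag (t : Tri) (p : PrismTet × Fin 4) (m : Fin 3) : Δ.Flag := (Q.tet (t, p.1), p.2, m)

/-- A flag at the edge over a corner of the surface: at the last vertex of a side of a triangle,
this edge belongs to the lower wall, and at the first vertex to the upper wall. -/
def vertFlag (F : S.Corner) : Δ.Flag :=
  if F.2.2 = 0 then Q.flag F.1 (loPos F.2.1) 0 else Q.flag F.1 (upPos F.2.1) 2

theorem sides_lo' (t : Tri) (k : Fin 3) : (Q.tet (t, (loPos k).1), (loPos k).2)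
    = Δ.sides ((S.sides.symm (t, k)).map Q.lo Q.lo) := by
  rw [Q.sides_lo, Equiv.apply_symm_apply]

theorem sides_up' (t : Tri) (k : Fin 3) : (Q.tet (t, (upPos k).1), (upPos k).2)
    = Δ.sides ((S.sides.symm (t, k)).map Q.up Q.up) := by
  rw [Q.sides_up, Equiv.apply_symm_apply]

theorem glue_lo (t : Tri) (k : Fin 3) : Δ.glue (Q.tet (t, (loPos k).1), (loPos k).2)
    = (Q.tet ((S.glue (t, k)).1, (loPos (S.glue (t, k)).2).1), (loPos (S.glue (t, k)).2).2) := by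
  rw [sides_lo', sides_lo', SurfaceGluing.glue, Gluing.glue, Prod.mk.eta, Equiv.symm_apply_apply,
    Equiv.symm_apply_apply]
  cases S.sides.symm (t, k) <;> rfl

theorem glue_up (t : Tri) (k : Fin 3) : Δ.glue (Q.tet (t, (upPos k).1), (upPos k).2)
    = (Q.tet ((S.glue (t, k)).1, (upPos (S.glue (t, k)).2).1), (upPos (S.glue (t, k)).2).2) := by
  rw [sides_up', sides_up', SurfaceGluing.glue, Gluing.glue, Prod.mk.eta, Equiv.symm_apply_apply,
    Equiv.symm_apply_apply]
  cases S.sides.symm (t, k) <;> rfl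

theorem turn_lo (t : Tri) (k m : Fin 3) : Δ.turn (Q.flag t (loPos k) m)
    = Δ.flip (Q.flag (S.glue (t, k)).1 (loPos (S.glue (t, k)).2) m) := by
  have := Q.glue_lo t k
  rw [← Gluing.flip_across, Gluing.across]
  simp only [Gluing.exit, flag, this]

theorem turn_up (t : Tri) (k m : Fin 3) : Δ.turn (Q.flag t (upPos k) m)
    = Δ.flip (Q.flag (S.glue (t, k)).1 (upPos (S.glue (t, k)).2) m) := by
  have := Q.glue_up t k
  rw [← Gluing.flip_across, Gluing.across]
  simp only [Gluing.exit, flag, this]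

theorem turn_of_glue {F : Δ.Flag} {h : Tet × Fin 4} (hF : Δ.glue (Δ.exit F) = h) :
    Δ.turn F = Δ.flip (h.1, h.2, F.2.2) := by
  subst hF; rfl

theorem turn_P (t : Tri) (m : Fin 3) :
    Δ.turn (Q.flag t (.P, 2) m) = Δ.flip (Q.flag t (.I, 2) m) :=
  turn_of_glue (h := (Q.tet (t, .I), 2))
    (by rw [← Q.sides_pi_inr, ← Gluing.glue_inl, Q.sides_pi_inl]; rfl)

theorem turn_I (t : Tri) (m : Fin 3) :
    Δ.turn (Q.flag t (.I, 2) m) = Δ.flip (Q.flag t (.P, 2) m) :=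
  turn_of_glue (h := (Q.tet (t, .P), 2))
    (by rw [← Q.sides_pi_inl, ← Gluing.glue_inr, Q.sides_pi_inr]; rfl)

theorem turn_I' (t : Tri) (m : Fin 3) :
    Δ.turn (Q.flag t (.I, 1) m) = Δ.flip (Q.flag t (.F, 1) m) :=
  turn_of_glue (h := (Q.tet (t, .F), 1))
    (by rw [← Q.sides_fi_inr, ← Gluing.glue_inl, Q.sides_fi_inl]; rfl)

theorem turn_F (t : Tri) (m : Fin 3) :
    Δ.turn (Q.flag t (.F, 1) m) = Δ.flip (Q.flag t (.I, 1) m) :=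
  turn_of_glue (h := (Q.tet (t, .I), 1))
    (by rw [← Q.sides_fi_inl, ← Gluing.glue_inr, Q.sides_fi_inr]; rfl)

theorem flag_ne {t t' : Tri} {p p' : PrismTet × Fin 4} {m m' : Fin 3} (h : p ≠ p') :
    Q.flag t p m ≠ Q.flag t' p' m' := by
  intro he
  simp only [flag, Prod.mk.injEq] at he
  exact h (Prod.ext (Prod.mk.inj (Q.tet_injective he.1)).2 he.2.1)

theorem flip_vertFlag (F : S.Corner) : Δ.flip (Q.vertFlag F) = Q.vertFlag (S.flip F) := by
  obtain ⟨t, k, m⟩ := F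
  fin_cases k <;> fin_cases m <;> rfl

theorem turn_vertFlag (F : S.Corner) : Δ.turn (Q.vertFlag F) = Q.vertFlag (S.turn F) := by
  rw [SurfaceGluing.turn, ← flip_vertFlag]
  obtain ⟨t, k, m⟩ := F
  by_cases hm : m = 0
  · simp only [vertFlag, hm, if_true]
    exact Q.turn_lo t k 0
  · simp only [vertFlag, hm, if_false]
    exact Q.turn_up t k 2

theorem vertFlag_injective : Function.Injective Q.vertFlag := by
  have key : ∀ (k k' : Fin 3) (m m' : Fin 2), (if m = 0 then loPos k else upPos k)
      = (if m' = 0 then loPos k' else upPos k') → k = k' ∧ m = m' := by decide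
  have hv : ∀ F : S.Corner, ((Q.vertFlag F).1, (Q.vertFlag F).2.1)
      = (Q.tet (F.1, (if F.2.2 = 0 then loPos F.2.1 else upPos F.2.1).1),
        (if F.2.2 = 0 then loPos F.2.1 else upPos F.2.1).2) := by
    intro F
    by_cases hm : F.2.2 = 0 <;> simp only [vertFlag, hm, if_true, if_false] <;> rfl
  rintro ⟨t, k, m⟩ ⟨t', k', m'⟩ h
  have h1 := congrArg (fun F : Δ.Flag => (F.1, F.2.1)) h
  simp only [hv, Prod.mk.injEq] at h1
  obtain ⟨ht, hp⟩ := Prod.mk.inj (Q.tet_injective h1.1)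
  obtain ⟨rfl, rfl⟩ := key _ _ _ _ (Prod.ext hp h1.2)
  rw [ht]

section cross
variable {A : Type} [Group A] (u : Face → A)

theorem cross_lo (t : Tri) (k : Fin 3) : Δ.cross u (Q.tet (t, (loPos k).1), (loPos k).2)
    = S.cross (u ∘ Q.lo) (t, k) := by
  rw [sides_lo', Gluing.cross, Equiv.symm_apply_apply, SurfaceGluing.cross]
  cases S.sides.symm (t, k) <;> rfl

theorem cross_up (t : Tri) (k : Fin 3) : Δ.cross u (Q.tet (t, (upPos k).1), (upPos k).2)
    = S.cross (u ∘ Q.up) (t, k) := by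
  rw [sides_up', Gluing.cross, Equiv.symm_apply_apply, SurfaceGluing.cross]
  cases S.sides.symm (t, k) <;> rfl

variable {u}

theorem cross_P (hu : ∀ t, u (Q.pi t) = 1) (t : Tri) : Δ.cross u (Q.tet (t, .P), 2) = 1 := by
  rw [← Q.sides_pi_inl, Gluing.cross_inl, hu]

theorem cross_I (hu : ∀ t, u (Q.pi t) = 1) (t : Tri) : Δ.cross u (Q.tet (t, .I), 2) = 1 := by
  rw [← Q.sides_pi_inr, Gluing.cross_inr, hu, inv_one]

theorem cross_I' (hu : ∀ t, u (Q.fi t) = 1) (t : Tri) : Δ.cross u (Q.tet (t, .I), 1) = 1 := by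
  rw [← Q.sides_fi_inl, Gluing.cross_inl, hu]

theorem cross_F (hu : ∀ t, u (Q.fi t) = 1) (t : Tri) : Δ.cross u (Q.tet (t, .F), 1) = 1 := by
  rw [← Q.sides_fi_inr, Gluing.cross_inr, hu, inv_one]

/-- The word read at the edge over the vertices of the surface, when upper and lower walls carry the
same gauge field. -/
theorem walk_vertFlag {ℓ : SEdge → A} (hlo : ∀ e, u (Q.lo e) = ℓ e) (hup : ∀ e, u (Q.up e) = ℓ e)
    {x₀ x : S.Corner} {w : A} (h : WalkTo S.turn (fun F => S.cross ℓ (F.1, F.2.1)) x₀ x w) :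
    WalkTo Δ.turn (fun F => Δ.cross u (Δ.exit F)) (Q.vertFlag x₀) (Q.vertFlag x) w := by
  refine h.map Q.vertFlag_injective Q.turn_vertFlag fun F => ?_
  obtain ⟨t, k, m⟩ := F
  by_cases hm : m = 0
  · simp only [vertFlag, hm, if_true]
    exact (Q.cross_lo u t k).trans (by rw [show u ∘ Q.lo = ℓ from funext hlo])
  · simp only [vertFlag, hm, if_false]
    exact (Q.cross_up u t k).trans (by rw [show u ∘ Q.up = ℓ from funext hup])

/-! ### Passing through a prism when turning around an edge -/

/-- The positions of the walls and of the horizontal triangles, where a prism is left. -/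
def IsOuter (p : PrismTet × Fin 4) : Prop :=
  p ≠ (.P, 2) ∧ p ≠ (.I, 2) ∧ p ≠ (.I, 1) ∧ p ≠ (.F, 1)

/-- Words of the dual edges met when turning around an edge of a prism. -/
abbrev Walk (u : Face → A) (t₀ : Tri) (p₀ : PrismTet × Fin 4) (m₀ : Fin 3) : Δ.Flag → A → Prop :=
  WalkTo Δ.turn (fun F => Δ.cross u (Δ.exit F)) (Q.flag t₀ p₀ m₀)

section segments
variable {Q} {t₀ t : Tri} {p₀ : PrismTet × Fin 4} {m₀ m : Fin 3} {w : A}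

theorem walk_P (hp : ∀ t, u (Q.pi t) = 1) (h₀ : IsOuter p₀)
    (h : Q.Walk u t₀ p₀ m₀ (Δ.flip (Q.flag t (.I, 2) m)) w) :
    Q.Walk u t₀ p₀ m₀ (Q.flag t (.P, 2) m) w :=
  .step_of_wt_eq_one (Q.flag_ne h₀.1.symm) (Q.turn_P t m) (Q.cross_P hp t) h

theorem walk_I (hp : ∀ t, u (Q.pi t) = 1) (h₀ : IsOuter p₀)
    (h : Q.Walk u t₀ p₀ m₀ (Δ.flip (Q.flag t (.P, 2) m)) w) :
    Q.Walk u t₀ p₀ m₀ (Q.flag t (.I, 2) m) w :=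
  .step_of_wt_eq_one (Q.flag_ne h₀.2.1.symm) (Q.turn_I t m) (Q.cross_I hp t) h

theorem walk_I' (hf : ∀ t, u (Q.fi t) = 1) (h₀ : IsOuter p₀)
    (h : Q.Walk u t₀ p₀ m₀ (Δ.flip (Q.flag t (.F, 1) m)) w) :
    Q.Walk u t₀ p₀ m₀ (Q.flag t (.I, 1) m) w :=
  .step_of_wt_eq_one (Q.flag_ne h₀.2.2.1.symm) (Q.turn_I' t m) (Q.cross_I' hf t) h

theorem walk_F (hf : ∀ t, u (Q.fi t) = 1) (h₀ : IsOuter p₀)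
    (h : Q.Walk u t₀ p₀ m₀ (Δ.flip (Q.flag t (.I, 1) m)) w) :
    Q.Walk u t₀ p₀ m₀ (Q.flag t (.F, 1) m) w :=
  .step_of_wt_eq_one (Q.flag_ne h₀.2.2.2.symm) (Q.turn_F t m) (Q.cross_F hf t) h

/-- Around a diagonal of a wall: from the lower wall to the upper wall. -/
theorem walk_lo_up (hp : ∀ t, u (Q.pi t) = 1) (hf : ∀ t, u (Q.fi t) = 1) (h₀ : IsOuter p₀)
    (k : Fin 3) (h : Q.Walk u t₀ p₀ m₀ (Q.flag t (upPos k) 1) w) :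
    Q.Walk u t₀ p₀ m₀ (Δ.flip (Q.flag t (loPos k) 1)) w := by
  fin_cases k
  · exact walk_P (m := 0) hp h₀ h
  · exact walk_P (m := 1) hp h₀ (walk_I' (m := 1) hf h₀ h)
  · exact walk_I' (m := 2) hf h₀ h

/-- Around a diagonal of a wall: from the upper wall to the lower wall. -/
theorem walk_up_lo (hp : ∀ t, u (Q.pi t) = 1) (hf : ∀ t, u (Q.fi t) = 1) (h₀ : IsOuter p₀)
    (k : Fin 3) (h : Q.Walk u t₀ p₀ m₀ (Q.flag t (loPos k) 1) w) :
    Q.Walk u t₀ p₀ m₀ (Δ.flip (Q.flag t (upPos k) 1)) w := by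
  fin_cases k
  · exact walk_I (m := 0) hp h₀ h
  · exact walk_F (m := 1) hf h₀ (walk_I (m := 1) hp h₀ h)
  · exact walk_F (m := 2) hf h₀ h

/-- Around a past edge: from the lower wall to the past triangle. -/
theorem walk_lo_past (hp : ∀ t, u (Q.pi t) = 1) (h₀ : IsOuter p₀)
    (k : Fin 3) (h : Q.Walk u t₀ p₀ m₀ (Q.flag t (.P, 3) k) w) :
    Q.Walk u t₀ p₀ m₀ (Δ.flip (Q.flag t (loPos k) 2)) w := by
  fin_cases k
  · exact h
  · exact h
  · exact walk_I (m := 2) hp h₀ h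

/-- Around a past edge: from the past triangle to the lower wall. -/
theorem walk_past_lo (hp : ∀ t, u (Q.pi t) = 1) (h₀ : IsOuter p₀)
    (k : Fin 3) (h : Q.Walk u t₀ p₀ m₀ (Q.flag t (loPos k) 2) w) :
    Q.Walk u t₀ p₀ m₀ (Δ.flip (Q.flag t (.P, 3) k)) w := by
  fin_cases k
  · exact h
  · exact h
  · exact walk_P (m := 2) hp h₀ h

/-- Around a future edge: from the upper wall to the future triangle. -/
theorem walk_up_future (hf : ∀ t, u (Q.fi t) = 1) (h₀ : IsOuter p₀)
    (k : Fin 3) (h : Q.Walk u t₀ p₀ m₀ (Q.flag t (.F, 0) k) w) :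
    Q.Walk u t₀ p₀ m₀ (Δ.flip (Q.flag t (upPos k) 0)) w := by
  fin_cases k
  · exact walk_I' (m := 0) hf h₀ h
  · exact h
  · exact h

/-- Around a future edge: from the future triangle to the upper wall. -/
theorem walk_future_up (hf : ∀ t, u (Q.fi t) = 1) (h₀ : IsOuter p₀)
    (k : Fin 3) (h : Q.Walk u t₀ p₀ m₀ (Q.flag t (upPos k) 0) w) :
    Q.Walk u t₀ p₀ m₀ (Δ.flip (Q.flag t (.F, 0) k)) w := by
  fin_cases k
  · exact walk_F (m := 0) hf h₀ h
  · exact h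
  · exact h

end segments

theorem isOuter_loPos (k : Fin 3) : IsOuter (loPos k) := by
  revert k; unfold IsOuter; decide

theorem isOuter_upPos (k : Fin 3) : IsOuter (upPos k) := by
  revert k; unfold IsOuter; decide

theorem loPos_ne_upPos (k k' : Fin 3) : loPos k ≠ upPos k' := by
  revert k k'; decide

/-- The side of the surface triangle, at which a wall is attached. -/
theorem flag_sides_lo (x : SEdge ⊕ SEdge) (m : Fin 3) :
    Q.flag (S.sides x).1 (loPos (S.sides x).2) m
      = ((Δ.sides (x.map Q.lo Q.lo)).1, (Δ.sides (x.map Q.lo Q.lo)).2, m) := by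
  rw [Q.sides_lo]; rfl

theorem flag_sides_up (x : SEdge ⊕ SEdge) (m : Fin 3) :
    Q.flag (S.sides x).1 (upPos (S.sides x).2) m
      = ((Δ.sides (x.map Q.up Q.up)).1, (Δ.sides (x.map Q.up Q.up)).2, m) := by
  rw [Q.sides_up]; rfl

theorem walk_cross_up {t₀ : Tri} {p₀ : PrismTet × Fin 4} {m₀ m : Fin 3} {w : A}
    (x : SEdge ⊕ SEdge)
    (hne : Q.flag (S.sides x).1 (upPos (S.sides x).2) m ≠ Q.flag t₀ p₀ m₀)
    (h : Q.Walk u t₀ p₀ m₀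
      (Δ.flip (Q.flag (S.sides x.swap).1 (upPos (S.sides x.swap).2) m)) w) :
    Q.Walk u t₀ p₀ m₀ (Q.flag (S.sides x).1 (upPos (S.sides x).2) m)
      (Sum.elim (u ∘ Q.up) (fun e => (u (Q.up e))⁻¹) x * w) := by
  have ht := Q.turn_up (S.sides x).1 (S.sides x).2 m
  have hc := Q.cross_up u (S.sides x).1 (S.sides x).2
  rw [Prod.mk.eta, S.glue_sides] at ht
  rw [Prod.mk.eta, S.cross_sides] at hc
  have := WalkTo.step_to (wt := fun F => Δ.cross u (Δ.exit F)) hne ht h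
  exact (show Δ.cross u (Δ.exit (Q.flag (S.sides x).1 (upPos (S.sides x).2) m)) = _ from hc) ▸ this

end cross

/-! ### The edges of a prism and their curvatures -/

section edges

theorem edgeOpp_lo (e : SEdge) (m : Fin 3) : Δ.edgeOpp (Q.lo e) m
    = Δ.edge (Q.flag (S.sides (.inl e)).1 (loPos (S.sides (.inl e)).2) m) := by
  rw [flag_sides_lo]; rfl

theorem edgeOpp_up (e : SEdge) (m : Fin 3) : Δ.edgeOpp (Q.up e) m
    = Δ.edge (Q.flag (S.sides (.inl e)).1 (upPos (S.sides (.inl e)).2) m) := by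
  rw [flag_sides_up]; rfl

theorem edge_flag_lo (t : Tri) (k m : Fin 3) :
    Δ.edge (Q.flag t (loPos k) m) = Δ.edgeOpp (Q.lo (S.edgeOf (t, k))) m := by
  rw [← Gluing.edgeOpp_faceOf]
  congr 1
  change Δ.faceOf (Q.tet (t, (loPos k).1), (loPos k).2) = _
  rw [sides_lo', Gluing.faceOf_sides, SurfaceGluing.edgeOf]
  cases S.sides.symm (t, k) <;> rfl

theorem edge_flag_up (t : Tri) (k m : Fin 3) :
    Δ.edge (Q.flag t (upPos k) m) = Δ.edgeOpp (Q.up (S.edgeOf (t, k))) m := by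
  rw [← Gluing.edgeOpp_faceOf]
  congr 1
  change Δ.faceOf (Q.tet (t, (upPos k).1), (upPos k).2) = _
  rw [sides_up', Gluing.faceOf_sides, SurfaceGluing.edgeOf]
  cases S.sides.symm (t, k) <;> rfl

theorem edge_flag_P (t : Tri) (m : Fin 3) :
    Δ.edge (Q.flag t (.P, 2) m) = Δ.edge (Q.flag t (.I, 2) m) := by
  rw [← Δ.edge_turn, turn_P, Δ.edge_flip]

theorem edge_flag_F (t : Tri) (m : Fin 3) :
    Δ.edge (Q.flag t (.F, 1) m) = Δ.edge (Q.flag t (.I, 1) m) := by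
  rw [← Δ.edge_turn, turn_F, Δ.edge_flip]

theorem edge_flag_up_diag (t : Tri) (k : Fin 3) :
    Δ.edge (Q.flag t (upPos k) 1) = Δ.edge (Q.flag t (loPos k) 1) := by
  fin_cases k
  · exact ((Δ.edge_flip (Q.flag t (.I, 2) 0)).trans (Q.edge_flag_P t 0).symm).trans
      (Δ.edge_flip (Q.flag t (.P, 2) 0)).symm
  · exact (((Δ.edge_flip (Q.flag t (.F, 1) 1)).trans (Q.edge_flag_F t 1)).trans
      ((Δ.edge_flip (Q.flag t (.I, 2) 1)).trans (Q.edge_flag_P t 1).symm)).trans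
      (Δ.edge_flip (Q.flag t (.P, 2) 1)).symm
  · exact ((Δ.edge_flip (Q.flag t (.F, 1) 2)).trans (Q.edge_flag_F t 2)).trans
      (Δ.edge_flip (Q.flag t (.I, 1) 2)).symm

theorem edgeOpp_up_one (e : SEdge) : Δ.edgeOpp (Q.up e) 1 = Δ.edgeOpp (Q.lo e) 1 := by
  rw [edgeOpp_up, edge_flag_up_diag, edgeOpp_lo]

theorem edge_flag_past (t : Tri) (k : Fin 3) :
    Δ.edge (Q.flag t (.P, 3) k) = Δ.edgeOpp (Q.lo (S.edgeOf (t, k))) 2 := by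
  rw [← edge_flag_lo]
  fin_cases k
  · exact Δ.edge_flip (Q.flag t (.P, 0) 2)
  · exact Δ.edge_flip (Q.flag t (.P, 1) 2)
  · exact ((Δ.edge_flip (Q.flag t (.P, 2) 2)).trans (Q.edge_flag_P t 2)).trans
      (Δ.edge_flip (Q.flag t (.I, 2) 2)).symm

theorem edge_flag_future (t : Tri) (k : Fin 3) :
    Δ.edge (Q.flag t (.F, 0) k) = Δ.edgeOpp (Q.up (S.edgeOf (t, k))) 0 := by
  rw [← edge_flag_up]
  fin_cases k
  · exact ((Δ.edge_flip (Q.flag t (.F, 1) 0)).trans (Q.edge_flag_F t 0)).trans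
      (Δ.edge_flip (Q.flag t (.I, 1) 0)).symm
  · exact Δ.edge_flip (Q.flag t (.F, 2) 0)
  · exact Δ.edge_flip (Q.flag t (.F, 3) 0)

theorem edgeOpp_pi (t : Tri) (m : Fin 3) :
    Δ.edgeOpp (Q.pi t) m = Δ.edge (Q.flag t (.P, 2) m) := by
  change Δ.edge ((Δ.sides (.inl (Q.pi t))).1, (Δ.sides (.inl (Q.pi t))).2, m) = _
  rw [Q.sides_pi_inl]; rfl

theorem edgeOpp_fi (t : Tri) (m : Fin 3) :
    Δ.edgeOpp (Q.fi t) m = Δ.edge (Q.flag t (.F, 1) m) := by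
  change Δ.edge ((Δ.sides (.inl (Q.fi t))).1, (Δ.sides (.inl (Q.fi t))).2, m) = _
  rw [Q.sides_fi_inl, edge_flag_F]; rfl

/-- The three edges of the triangle between `P` and `I`. -/
theorem edgeOpp_pi_cases (t : Tri) (m : Fin 3) : Δ.edgeOpp (Q.pi t) m =
    match m with
    | 0 => Δ.edgeOpp (Q.lo (S.edgeOf (t, 0))) 1
    | 1 => Δ.edgeOpp (Q.lo (S.edgeOf (t, 1))) 1
    | 2 => Δ.edgeOpp (Q.lo (S.edgeOf (t, 2))) 2 := by
  rw [edgeOpp_pi, ← Δ.edge_flip]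
  fin_cases m
  · exact Q.edge_flag_lo t 0 1
  · exact Q.edge_flag_lo t 1 1
  · exact Q.edge_flag_past t 2

/-- The three edges of the triangle between `I` and `F`. -/
theorem edgeOpp_fi_cases (t : Tri) (m : Fin 3) : Δ.edgeOpp (Q.fi t) m =
    match m with
    | 0 => Δ.edgeOpp (Q.up (S.edgeOf (t, 0))) 0
    | 1 => Δ.edgeOpp (Q.lo (S.edgeOf (t, 1))) 1
    | 2 => Δ.edgeOpp (Q.lo (S.edgeOf (t, 2))) 1 := by
  rw [edgeOpp_fi, ← Δ.edge_flip]
  fin_cases m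
  · exact Q.edge_flag_future t 0
  · exact (Q.edge_flag_up t 1 1).trans (Q.edgeOpp_up_one _)
  · exact (Q.edge_flag_up t 2 1).trans (Q.edgeOpp_up_one _)

end edges

section curvature
variable [Finite Tet] {u : Face → SU2} {χ : SU2 → ℝ}

theorem curvature_of_walk_lo (hχ : IsClassFunction χ) (e : SEdge) (m : Fin 3) {w : SU2}
    (h : Q.Walk u (S.sides (.inl e)).1 (loPos (S.sides (.inl e)).2) m
      (Δ.flip (Q.flag (S.sides (.inr e)).1 (loPos (S.sides (.inr e)).2) m)) w) :
    χ (Δ.curvature u (Δ.edgeOpp (Q.lo e) m)) = χ (u (Q.lo e) * w) := by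
  have ht := Q.turn_lo (S.sides (.inl e)).1 (S.sides (.inl e)).2 m
  have hc := Q.cross_lo u (S.sides (.inl e)).1 (S.sides (.inl e)).2
  rw [Prod.mk.eta, S.glue_sides] at ht
  rw [Prod.mk.eta, S.cross_sides] at hc
  rw [edgeOpp_lo]
  refine (Δ.classFunction_curvature_of_walkTo hχ (ht.symm ▸ h)).trans ?_
  exact congrArg (fun z => χ (z * w)) hc

theorem curvature_of_walk_up (hχ : IsClassFunction χ) (e : SEdge) (m : Fin 3) {w : SU2}
    (h : Q.Walk u (S.sides (.inl e)).1 (upPos (S.sides (.inl e)).2) m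
      (Δ.flip (Q.flag (S.sides (.inr e)).1 (upPos (S.sides (.inr e)).2) m)) w) :
    χ (Δ.curvature u (Δ.edgeOpp (Q.up e) m)) = χ (u (Q.up e) * w) := by
  have ht := Q.turn_up (S.sides (.inl e)).1 (S.sides (.inl e)).2 m
  have hc := Q.cross_up u (S.sides (.inl e)).1 (S.sides (.inl e)).2
  rw [Prod.mk.eta, S.glue_sides] at ht
  rw [Prod.mk.eta, S.cross_sides] at hc
  rw [edgeOpp_up]
  refine (Δ.classFunction_curvature_of_walkTo hχ (ht.symm ▸ h)).trans ?_
  exact congrArg (fun z => χ (z * w)) hc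

/-- The curvature at a diagonal of a wall. -/
theorem curvature_diag (hp : ∀ t, u (Q.pi t) = 1) (hf : ∀ t, u (Q.fi t) = 1)
    (hχ : IsClassFunction χ) (e : SEdge) :
    χ (Δ.curvature u (Δ.edgeOpp (Q.lo e) 1)) = χ (u (Q.lo e) * (u (Q.up e))⁻¹) := by
  have h0 := isOuter_loPos (S.sides (.inl e)).2
  have h1 := Q.walk_cross_up (u := u) (m := 1) (.inr e)
    (Q.flag_ne (loPos_ne_upPos _ _).symm) (walk_up_lo hp hf h0 _ .done)
  refine (Q.curvature_of_walk_lo hχ e 1 (walk_lo_up hp hf h0 _ h1)).trans ?_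
  simp

end curvature
end PrismGluing

/-! ### Prisms over the one-vertex triangulation of `Σ_g` -/

namespace PrismGluing

variable {g : ℕ} [NeZero g] {Tet Face : Type} {Δ : Gluing Tet Face}
  (Q : PrismGluing (genusSurface g) Δ)

/-- All the edges over the vertex of the surface are identified. -/
theorem edge_vertFlag (F F' : (genusSurface g).Corner) :
    Δ.edge (Q.vertFlag F) = Δ.edge (Q.vertFlag F') := by
  have hg : 0 < 4 * g - 2 := by have := NeZero.pos g; omega
  have key := genusSurface.eq_of_turn_flip_invariant (Z := fun F => Δ.edge (Q.vertFlag F))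
    (fun F => by rw [← turn_vertFlag, Δ.edge_turn]) (fun F => by rw [← flip_vertFlag, Δ.edge_flip])
    hg
  exact (key F).trans (key F').symm

theorem edgeOpp_lo_zero (e e' : FanEdge g) : Δ.edgeOpp (Q.lo e) 0 = Δ.edgeOpp (Q.lo e') 0 := by
  rw [edgeOpp_lo, edgeOpp_lo]
  exact Q.edge_vertFlag (_, _, 0) (_, _, 0)

theorem edgeOpp_up_two (e e' : FanEdge g) : Δ.edgeOpp (Q.up e) 2 = Δ.edgeOpp (Q.lo e') 0 := by
  rw [edgeOpp_lo, edgeOpp_up]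
  exact Q.edge_vertFlag (_, _, 1) (_, _, 0)

/-- The curvature at the edge over the vertex of the surface, when upper and lower walls carry the
same gauge field, trivial on the diagonals. -/
theorem curvature_vert [Finite Tet] {u : Face → SU2} {χ : SU2 → ℝ} (hχ : IsClassFunction χ)
    {ℓ : FanEdge g → SU2} (hlo : ∀ e, u (Q.lo e) = ℓ e) (hup : ∀ e, u (Q.up e) = ℓ e)
    (hℓ : ∀ j, ℓ (.d j) = 1) (e : FanEdge g) :
    χ (Δ.curvature u (Δ.edgeOpp (Q.lo e) 0))
      = χ (surfaceWord (fun i => ℓ (.a i)) fun i => ℓ (.b i)) := by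
  have hg : 0 < 4 * g - 2 := by have := NeZero.pos g; omega
  obtain ⟨w, hw, hprod⟩ := genusSurface.walk_turn_apexCorner hg hℓ
  have h := Q.walk_vertFlag hlo hup hw
  rw [← turn_vertFlag] at h
  rw [edgeOpp_lo]
  rw [show Δ.edge (Q.flag _ _ 0) = Δ.edge (Q.vertFlag (genusSurface.apexCorner 0 hg)) from
    Q.edge_vertFlag (_, _, 0) _]
  refine (Δ.classFunction_curvature_of_walkTo hχ h).trans ?_
  have hc := Q.cross_up u (genusSurface.apexCorner 0 hg).1 (genusSurface.apexCorner 0 hg).2.1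
  rw [show u ∘ Q.up = ℓ from funext hup] at hc
  refine congrArg χ ?_
  refine (congrArg (· * w) hc).trans hprod

end PrismGluing

/-! ### Enumerating the edges of a gluing -/

namespace Gluing

variable {Tet Face : Type} (Δ : Gluing Tet Face)

theorem exists_edgeOpp_eq (e : Δ.Edge) : ∃ f m, Δ.edgeOpp f m = e := by
  induction e using Quot.ind with
  | mk F => exact ⟨_, _, Δ.edgeOpp_faceOf F⟩

open Classical in
/-- The product of delta functions over an enumerated set of edges. -/
theorem deltaProduct_range {κ : Type} [Fintype κ] {enum : κ → Δ.Edge}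
    (hinj : Function.Injective enum) (K : Set Δ.Edge) (χ δ : Δ.Edge → SU2 → ℝ) (u : Face → SU2) :
    Δ.deltaProduct (Set.range enum) K χ δ u =
      ∏ l, (if enum l ∈ K then χ (enum l) else δ (enum l)) (Δ.curvature u (enum l)) := by
  rw [deltaProduct, finprod_set_coe_eq_finprod_mem (s := Set.range enum)
    (f := fun e => (if e ∈ K then χ e else δ e) (Δ.curvature u e)), finprod_mem_range hinj,
    finprod_eq_prod_of_fintype]

end Gluing

/-! ### Labels of the edges of a prism -/

/-- The label of the `m`-th edge of the triangle at a position of a prism: `v` for the edges in the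
direction of the interval and, over the side `k` of the surface triangle, `dg k` for the diagonal of
the wall, `hp k` for the past edge, `hf k` for the future edge. -/
def prismLabel {α : Type} (v : α) (dg hp hf : Fin 3 → α) : PrismTet → Fin 4 → Fin 3 → α
  | .P, 0 => ![v, dg 0, hp 0]
  | .P, 1 => ![v, dg 1, hp 1]
  | .P, 2 => ![dg 0, dg 1, hp 2]
  | .P, 3 => hp
  | .I, 0 => ![hf 0, dg 0, v]
  | .I, 1 => ![hf 0, dg 1, dg 2]
  | .I, 2 => ![dg 0, dg 1, hp 2]
  | .I, 3 => ![v, dg 2, hp 2]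
  | .F, 0 => hf
  | .F, 1 => ![hf 0, dg 1, dg 2]
  | .F, 2 => ![hf 1, dg 1, v]
  | .F, 3 => ![hf 2, dg 2, v]

theorem prismLabel_flip {α : Type} (v : α) (dg hp hf : Fin 3 → α) (c : PrismTet) (l : Fin 4)
    (m : Fin 3) : prismLabel v dg hp hf c (l.succAbove m) (m.predAbove l)
      = prismLabel v dg hp hf c l m := by
  cases c <;> fin_cases l <;> fin_cases m <;> rfl

namespace PrismGluing

variable {Tri SEdge : Type} {S : SurfaceGluing Tri SEdge} {Tet Face : Type}
  {Δ : Gluing Tet Face} (Q : PrismGluing S Δ)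

theorem faceOf_lo (t : Tri) (k : Fin 3) :
    Δ.faceOf (Q.tet (t, (loPos k).1), (loPos k).2) = Q.lo (S.edgeOf (t, k)) := by
  rw [sides_lo', Gluing.faceOf_sides, SurfaceGluing.edgeOf]
  cases S.sides.symm (t, k) <;> rfl

theorem faceOf_up (t : Tri) (k : Fin 3) :
    Δ.faceOf (Q.tet (t, (upPos k).1), (upPos k).2) = Q.up (S.edgeOf (t, k)) := by
  rw [sides_up', Gluing.faceOf_sides, SurfaceGluing.edgeOf]
  cases S.sides.symm (t, k) <;> rfl

/-- A labelling of the sides of triangles which has the expected form on the triangles of the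
prisms is the same for the two triangles of a tetrahedron at each of its edges. -/
theorem label_flip {α : Type} {lab : Face → Fin 3 → α} {v : α} {dg hp hf : SEdge → α}
    (hlo : ∀ e, lab (Q.lo e) = ![v, dg e, hp e]) (hup : ∀ e, lab (Q.up e) = ![hf e, dg e, v])
    (hpi : ∀ t, lab (Q.pi t) =
      ![dg (S.edgeOf (t, 0)), dg (S.edgeOf (t, 1)), hp (S.edgeOf (t, 2))])
    (hfi : ∀ t, lab (Q.fi t) =
      ![hf (S.edgeOf (t, 0)), dg (S.edgeOf (t, 1)), dg (S.edgeOf (t, 2))])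
    (hpast : ∀ t, lab (Δ.faceOf (Q.tet (t, .P), 3)) = fun k => hp (S.edgeOf (t, k)))
    (hfuture : ∀ t, lab (Δ.faceOf (Q.tet (t, .F), 0)) = fun k => hf (S.edgeOf (t, k)))
    (c : Tri × PrismTet) (l : Fin 4) (m : Fin 3) :
    lab (Δ.faceOf (Δ.exit (Δ.flip (Q.tet c, l, m)))) (Δ.flip (Q.tet c, l, m)).2.2
      = lab (Δ.faceOf (Δ.exit (Q.tet c, l, m))) m := by
  obtain ⟨t, c⟩ := c
  have key : ∀ l, lab (Δ.faceOf (Q.tet (t, c), l)) = prismLabel v (fun k => dg (S.edgeOf (t, k)))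
      (fun k => hp (S.edgeOf (t, k))) (fun k => hf (S.edgeOf (t, k))) c l := by
    have hP : Δ.faceOf (Q.tet (t, .P), 2) = Q.pi t := by
      rw [← Q.sides_pi_inl, Gluing.faceOf_sides]; rfl
    have hI : Δ.faceOf (Q.tet (t, .I), 2) = Q.pi t := by
      rw [← Q.sides_pi_inr, Gluing.faceOf_sides]; rfl
    have hI' : Δ.faceOf (Q.tet (t, .I), 1) = Q.fi t := by
      rw [← Q.sides_fi_inl, Gluing.faceOf_sides]; rfl
    have hF : Δ.faceOf (Q.tet (t, .F), 1) = Q.fi t := by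
      rw [← Q.sides_fi_inr, Gluing.faceOf_sides]; rfl
    intro l
    cases c <;> fin_cases l
    · exact (congrArg lab (Q.faceOf_lo t 0)).trans (hlo _)
    · exact (congrArg lab (Q.faceOf_lo t 1)).trans (hlo _)
    · exact (congrArg lab hP).trans (hpi t)
    · exact hpast t
    · exact (congrArg lab (Q.faceOf_up t 0)).trans (hup _)
    · exact (congrArg lab hI').trans (hfi t)
    · exact (congrArg lab hI).trans (hpi t)
    · exact (congrArg lab (Q.faceOf_lo t 2)).trans (hlo _)
    · exact hfuture t
    · exact (congrArg lab hF).trans (hfi t)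
    · exact (congrArg lab (Q.faceOf_up t 1)).trans (hup _)
    · exact (congrArg lab (Q.faceOf_up t 2)).trans (hup _)
  change lab (Δ.faceOf (Q.tet (t, c), l.succAbove m)) (m.predAbove l)
    = lab (Δ.faceOf (Q.tet (t, c), l)) m
  rw [key, key, prismLabel_flip]

end PrismGluing

instance : Fintype PrismTet := ⟨{.P, .I, .F}, fun x => by cases x <;> simp⟩

/-! ### The edges of `Σ × S¹` and their curvatures -/

namespace SurfaceGluing

variable {Tri SEdge : Type} (S : SurfaceGluing Tri SEdge)

/-- The prisms of `Σ × S¹`. -/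
def circlePrisms : PrismGluing S S.timesCircle where
  tet := id
  pi := .pi
  fi := .fi
  lo := .lo
  up := .up
  tet_injective := Function.injective_id
  sides_pi_inl _ := rfl
  sides_pi_inr _ := rfl
  sides_fi_inl _ := rfl
  sides_fi_inr _ := rfl
  sides_lo x := by cases x <;> rfl
  sides_up x := by cases x <;> rfl

theorem timesCircle_glue_P (t : Tri) : S.timesCircle.glue ((t, .P), 3) = ((t, .F), 0) :=
  S.timesCircle.glue_inr (.hor t)

theorem timesCircle_glue_F (t : Tri) : S.timesCircle.glue ((t, .F), 0) = ((t, .P), 3) :=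
  S.timesCircle.glue_inl (.hor t)

theorem edge_circle_future (t : Tri) (k : Fin 3) :
    S.timesCircle.edge (S.circlePrisms.flag t (.F, 0) k)
      = S.timesCircle.edge (S.circlePrisms.flag t (.P, 3) k) := by
  rw [← S.timesCircle.edge_turn, PrismGluing.turn_of_glue (S.timesCircle_glue_F t),
    S.timesCircle.edge_flip]
  rfl

/-- The upper wall and the lower wall over an edge have a common edge. -/
theorem edgeOpp_circle_up_zero (e : SEdge) :
    S.timesCircle.edgeOpp (.up e) 0 = S.timesCircle.edgeOpp (.lo e) 2 := by
  have h1 := S.circlePrisms.edge_flag_future (S.sides (.inl e)).1 (S.sides (.inl e)).2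
  have h2 := S.circlePrisms.edge_flag_past (S.sides (.inl e)).1 (S.sides (.inl e)).2
  rw [Prod.mk.eta, edgeOf_sides] at h1 h2
  exact h1.symm.trans ((S.edge_circle_future _ _).trans h2)

theorem edgeOpp_circle_hor (t : Tri) (k : Fin 3) :
    S.timesCircle.edgeOpp (.hor t) k = S.timesCircle.edgeOpp (.lo (S.edgeOf (t, k))) 2 :=
  (S.edge_circle_future t k).trans (S.circlePrisms.edge_flag_past t k)

/-- The curvature at an edge of the surface: going around the edge, one passes a lower wall, the
horizontal triangle of one of the adjacent prisms, an upper wall, and the horizontal triangle of the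
other prism. -/
theorem curvature_circle_hor [Finite Tri] {u : CircleFace Tri SEdge → SU2} {χ : SU2 → ℝ}
    (hp : ∀ t, u (.pi t) = 1) (hf : ∀ t, u (.fi t) = 1) (hχ : IsClassFunction χ) (e : SEdge) :
    χ (S.timesCircle.curvature u (S.timesCircle.edgeOpp (.lo e) 2)) =
      χ (u (.lo e) * (u (.hor (S.sides (.inr e)).1))⁻¹ * (u (.up e))⁻¹ *
        u (.hor (S.sides (.inl e)).1)) := by
  set Q := S.circlePrisms
  set t := (S.sides (.inl e)).1
  set k := (S.sides (.inl e)).2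
  set t' := (S.sides (.inr e)).1
  set k' := (S.sides (.inr e)).2
  have h0 : PrismGluing.IsOuter (loPos k) := PrismGluing.isOuter_loPos k
  have hP : ∀ k' : Fin 3, ((.P, 3) : PrismTet × Fin 4) ≠ loPos k' := by decide
  have hF : ∀ k' : Fin 3, ((.F, 0) : PrismTet × Fin 4) ≠ loPos k' := by decide
  have w1 : Q.Walk u t (loPos k) 2 (S.timesCircle.flip (Q.flag t (.P, 3) k)) 1 :=
    PrismGluing.walk_past_lo hp h0 k .done
  have w2 := WalkTo.step_to (wt := fun F => S.timesCircle.cross u (S.timesCircle.exit F))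
    (Q.flag_ne (t := t) (t' := t) (m := k) (m' := 2) (hF k))
    (PrismGluing.turn_of_glue (F := Q.flag t (.F, 0) k) (S.timesCircle_glue_F t)) w1
  have w3 := PrismGluing.walk_up_future hf h0 k w2
  have w4 := Q.walk_cross_up (u := u) (m := 0) (.inr e)
    (Q.flag_ne (PrismGluing.loPos_ne_upPos _ _).symm) w3
  have w5 := PrismGluing.walk_future_up hf h0 k' w4
  have w6 := WalkTo.step_to (wt := fun F => S.timesCircle.cross u (S.timesCircle.exit F))
    (Q.flag_ne (t := t') (t' := t) (m := k') (m' := 2) (hP k))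
    (PrismGluing.turn_of_glue (F := Q.flag t' (.P, 3) k') (S.timesCircle_glue_P t')) w5
  refine (Q.curvature_of_walk_lo hχ e 2 (PrismGluing.walk_lo_past hp h0 k' w6)).trans ?_
  have c1 : S.timesCircle.cross u (S.timesCircle.exit (Q.flag t (.F, 0) k)) = u (.hor t) :=
    S.timesCircle.cross_inl u (.hor t)
  have c2 : S.timesCircle.cross u (S.timesCircle.exit (Q.flag t' (.P, 3) k')) = (u (.hor t'))⁻¹ :=
    S.timesCircle.cross_inr u (.hor t')
  rw [c1, c2]
  simp only [Sum.elim_inr, mul_one, mul_assoc]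
  rfl

/-- The labels of the edges of `Σ × S¹`: `none` for the edge in the direction of `S¹`, `inl e` for
the edge `e` of `Σ`, `inr e` for the diagonal of the walls over `e`. -/
def circleLabel : CircleFace Tri SEdge → Fin 3 → Option (SEdge ⊕ SEdge)
  | .hor t => fun k => some (.inl (S.edgeOf (t, k)))
  | .pi t => ![some (.inr (S.edgeOf (t, 0))), some (.inr (S.edgeOf (t, 1))),
      some (.inl (S.edgeOf (t, 2)))]
  | .fi t => ![some (.inl (S.edgeOf (t, 0))), some (.inr (S.edgeOf (t, 1))),
      some (.inr (S.edgeOf (t, 2)))]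
  | .lo e => ![none, some (.inr e), some (.inl e)]
  | .up e => ![some (.inl e), some (.inr e), none]

theorem circleLabel_flip (F : S.timesCircle.Flag) :
    S.circleLabel (S.timesCircle.faceOf (S.timesCircle.exit (S.timesCircle.flip F)))
      (S.timesCircle.flip F).2.2
      = S.circleLabel (S.timesCircle.faceOf (S.timesCircle.exit F)) F.2.2 := by
  obtain ⟨c, l, m⟩ := F
  exact S.circlePrisms.label_flip (lab := S.circleLabel) (v := none)
    (dg := fun e => some (.inr e)) (hp := fun e => some (.inl e)) (hf := fun e => some (.inl e))
    (fun _ => rfl) (fun _ => rfl) (fun _ => rfl) (fun _ => rfl) (fun _ => rfl) (fun _ => rfl) c l m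

end SurfaceGluing

/-! ### The edges of `Σ_g × S¹` -/

namespace ClosedCase

variable {g : ℕ} [NeZero g]

/-- The edges of the triangulation of `Σ_g × S¹`, enumerated by their labels. -/
noncomputable def enum : Option (FanEdge g ⊕ FanEdge g) → (Δ g).Edge
  | none => vert g
  | some (.inl e) => hor e
  | some (.inr e) => (Δ g).edgeOpp (.lo e) 1

theorem enum_injective : Function.Injective (enum (g := g)) := by
  refine Function.LeftInverse.injective
    (g := (Δ g).edgeLift (genusSurface g).circleLabel (genusSurface g).circleLabel_flip) ?_
  rintro (_ | e | e) <;> exact Gluing.edgeLift_edgeOpp _ _ _ _ _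

theorem range_enum : Set.range (enum (g := g)) = Set.univ := by
  refine Set.eq_univ_of_forall fun e => ?_
  set Q := (genusSurface g).circlePrisms
  obtain ⟨f, m, rfl⟩ := (Δ g).exists_edgeOpp_eq e
  rcases f with t | t | t | e | e
  · exact ⟨some (.inl _), ((genusSurface g).edgeOpp_circle_hor t m).symm⟩
  · refine Exists.imp (fun l (h : enum l = _) => h.trans (Q.edgeOpp_pi_cases t m).symm) ?_
    fin_cases m
    · exact ⟨some (.inr _), rfl⟩
    · exact ⟨some (.inr _), rfl⟩
    · exact ⟨some (.inl _), rfl⟩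
  · refine Exists.imp (fun l (h : enum l = _) => h.trans (Q.edgeOpp_fi_cases t m).symm) ?_
    fin_cases m
    · exact ⟨some (.inl _), ((genusSurface g).edgeOpp_circle_up_zero _).symm⟩
    · exact ⟨some (.inr _), rfl⟩
    · exact ⟨some (.inr _), rfl⟩
  · fin_cases m
    · exact ⟨none, Q.edgeOpp_lo_zero _ e⟩
    · exact ⟨some (.inr _), rfl⟩
    · exact ⟨some (.inl _), rfl⟩
  · fin_cases m
    · exact ⟨some (.inl _), ((genusSurface g).edgeOpp_circle_up_zero _).symm⟩
    · exact ⟨some (.inr _), (Q.edgeOpp_up_one e).symm⟩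
    · exact ⟨none, (Q.edgeOpp_up_two e _).symm⟩

theorem diag_notMem_kept (e : FanEdge g) : enum (some (.inr e)) ∉ kept g := by
  rintro (h | ⟨i, h⟩ | ⟨i, h⟩)
  · exact absurd (enum_injective (a₂ := none) h) (by simp)
  · exact absurd (enum_injective (a₂ := some (.inl (.a i))) h) (by simp)
  · exact absurd (enum_injective (a₂ := some (.inl (.b i))) h) (by simp)

theorem hor_d_notMem_kept (j : Fin (4 * g - 3)) : enum (g := g) (some (.inl (.d j))) ∉ kept g := by
  rintro (h | ⟨i, h⟩ | ⟨i, h⟩)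
  · exact absurd (enum_injective (a₂ := none) h) (by simp)
  · exact absurd (enum_injective (a₂ := some (.inl (.a i))) h) (by simp)
  · exact absurd (enum_injective (a₂ := some (.inl (.b i))) h) (by simp)

end ClosedCase

/-! ### The delta functions of `Σ_g × S¹` -/

theorem FanEdge.prod_univ {g : ℕ} (f : FanEdge g → ℝ) :
    ∏ e, f e = (∏ j, f (.d j)) * ∏ i, (f (.a i) * f (.b i)) := by
  rw [← (fanEdgeEquiv g).symm.prod_comp, Fintype.prod_sum_type, Fintype.prod_sum_type,
    Finset.prod_mul_distrib]
  simp only [fanEdgeEquiv, Equiv.coe_fn_symm_mk]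
  ring

namespace ClosedCase

variable {g : ℕ} [NeZero g]

/-- All the triangles but the horizontal ones and the upper walls, whose group elements are the
variables of `integral_chain`. -/
def walls (g : ℕ) : Set (CircleFace (Fin (4 * g - 2)) (FanEdge g)) :=
  {f | (∃ t, f = .pi t) ∨ (∃ t, f = .fi t) ∨ ∃ e, f = .lo e}

theorem card_fan (g : ℕ) [NeZero g] : 4 * g - 3 + 1 = 4 * g - 2 := by
  have := NeZero.pos g; omega

/-- The gauge field which is `1` inside the prisms, `ℓ` across the lower walls, `h` across the
horizontal triangles, and `v` across the upper walls. -/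
def conf (ℓ : FanEdge g → SU2) (h : Fin (4 * g - 3 + 1) → SU2) (v : FanEdge g → SU2) :
    CircleFace (Fin (4 * g - 2)) (FanEdge g) → SU2
  | .hor t => h (Fin.cast (card_fan g).symm t)
  | .pi _ => 1
  | .fi _ => 1
  | .lo e => ℓ e
  | .up e => v e

theorem continuous_conf {X : Type*} [TopologicalSpace X] {ℓ : X → FanEdge g → SU2}
    {h : X → Fin (4 * g - 3 + 1) → SU2} {v : X → FanEdge g → SU2} (hℓ : Continuous ℓ)
    (hh : Continuous h) (hv : Continuous v) : Continuous fun x => conf (ℓ x) (h x) (v x) := by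
  refine continuous_pi fun f => ?_
  cases f with
  | hor t => exact (continuous_apply _).comp hh
  | pi t => exact continuous_const
  | fi t => exact continuous_const
  | lo e => exact (continuous_apply e).comp hℓ
  | up e => exact (continuous_apply e).comp hv

theorem overwrite_walls {z : CircleFace (Fin (4 * g - 2)) (FanEdge g) → SU2}
    (hp : ∀ t, z (.pi t) = 1) (hf : ∀ t, z (.fi t) = 1)
    (y : CircleFace (Fin (4 * g - 2)) (FanEdge g) → SU2) :
    overwrite (walls g) z y = conf (z ∘ .lo) (y ∘ fun i => .hor (Fin.cast (card_fan g) i))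
      (y ∘ .up) := by
  funext f
  cases f <;> simp [overwrite, walls, conf, hp, hf]

/-- The factors of the kept edges. -/
noncomputable def keptFactor (χ : (Δ g).Edge → SU2 → ℝ)
    (u : CircleFace (Fin (4 * g - 2)) (FanEdge g) → SU2) : ℝ :=
  χ (vert g) ((Δ g).curvature u (vert g)) *
    ∏ i, (χ (hor (.a i)) ((Δ g).curvature u (hor (.a i))) *
      χ (hor (.b i)) ((Δ g).curvature u (hor (.b i))))

theorem vert_mem_kept : vert g ∈ kept g := .inl rfl

theorem hor_a_mem_kept (i : Fin g) : hor (.a i) ∈ kept g := .inr (.inl ⟨i, rfl⟩)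

theorem hor_b_mem_kept (i : Fin g) : hor (.b i) ∈ kept g := .inr (.inr ⟨i, rfl⟩)

variable {χ : (Δ g).Edge → SU2 → ℝ} {δ : ℕ → (Δ g).Edge → SU2 → ℝ}

theorem continuous_keptFactor (hχ : ∀ e ∈ kept g, Continuous (χ e) ∧ IsClassFunction (χ e)) :
    Continuous (keptFactor χ) := by
  have h : ∀ e ∈ kept g, Continuous fun u => χ e ((Δ g).curvature u e) := fun e he =>
    (hχ e he).1.comp ((Δ g).continuous_curvature e)
  exact (h _ vert_mem_kept).mul (continuous_finsetProd _ fun i _ =>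
    (h _ (hor_a_mem_kept i)).mul (h _ (hor_b_mem_kept i)))

/-- The delta functions of the edges which are not kept form the integrand of `integral_chain`. -/
theorem deltaProduct_conf (hδ : ∀ e ∉ kept g, IsDeltaSequence fun n => δ n e) (n : ℕ)
    {ℓ : FanEdge g → SU2} (hℓ : ∀ j, ℓ (.d j) = 1) (h : Fin (4 * g - 3 + 1) → SU2)
    (v : FanEdge g → SU2) :
    (Δ g).deltaProduct Set.univ (kept g) χ (δ n) (conf ℓ h v) =
      (∏ e, δ n (enum (some (.inr e))) (ℓ e * (v e)⁻¹)) *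
        (∏ j, δ n (enum (some (.inl (.d j))))
          ((h j.succ)⁻¹ * (v (.d j))⁻¹ * h j.castSucc)) * keptFactor χ (conf ℓ h v) := by
  classical
  rw [← range_enum, Gluing.deltaProduct_range _ enum_injective, Fintype.prod_option,
    Fintype.prod_sum_type, FanEdge.prod_univ]
  have hdiag : ∀ e, δ n (enum (some (.inr e))) ((Δ g).curvature (conf ℓ h v)
      (enum (some (.inr e)))) = δ n (enum (some (.inr e))) (ℓ e * (v e)⁻¹) := fun e =>
    (genusSurface g).circlePrisms.curvature_diag (fun _ => rfl) (fun _ => rfl)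
      ((hδ _ (diag_notMem_kept e)).classFunction n) e
  have hd : ∀ j, δ n (enum (some (.inl (.d j)))) ((Δ g).curvature (conf ℓ h v)
      (enum (some (.inl (.d j))))) = δ n (enum (some (.inl (.d j))))
        ((h j.succ)⁻¹ * (v (.d j))⁻¹ * h j.castSucc) := by
    intro j
    refine ((genusSurface g).curvature_circle_hor (u := conf ℓ h v) (fun _ => rfl) (fun _ => rfl)
      ((hδ _ (hor_d_notMem_kept j)).classFunction n) (.d j)).trans ?_
    simp only [conf, hℓ, one_mul]
    rfl
  have hv : enum (g := g) none ∈ kept g := vert_mem_kept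
  have ha : ∀ i, enum (g := g) (some (.inl (.a i))) ∈ kept g := hor_a_mem_kept
  have hb : ∀ i, enum (g := g) (some (.inl (.b i))) ∈ kept g := hor_b_mem_kept
  simp only [diag_notMem_kept, hor_d_notMem_kept, hv, ha, hb, if_true, if_false, hdiag, hd]
  simp only [enum, keptFactor]
  ring

/-- Where the removed delta functions are concentrated, the kept ones are those of the reduced
formula, at `k⁻¹`. -/
theorem keptFactor_conf_const (hχ : ∀ e ∈ kept g, Continuous (χ e) ∧ IsClassFunction (χ e))
    {ℓ : FanEdge g → SU2} (hℓ : ∀ j, ℓ (.d j) = 1) (k : SU2) :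
    keptFactor χ (conf ℓ (fun _ => k) ℓ)
      = reduced χ k⁻¹ (fun i => ℓ (.a i)) (fun i => ℓ (.b i)) := by
  have h : ∀ e, hor e ∈ kept g → χ (hor e) ((Δ g).curvature (conf ℓ (fun _ => k) ℓ) (hor e))
      = χ (hor e) (ℓ e * k⁻¹ * (ℓ e)⁻¹ * k⁻¹⁻¹) := by
    intro e he
    rw [inv_inv]
    exact (genusSurface g).curvature_circle_hor (fun _ => rfl) (fun _ => rfl) (hχ _ he).2 e
  rw [keptFactor, reduced]
  congr 1
  · exact (genusSurface g).circlePrisms.curvature_vert (hχ _ vert_mem_kept).2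
      (fun _ => rfl) (fun _ => rfl) hℓ _
  · refine Finset.prod_congr rfl fun i _ => ?_
    rw [h _ (hor_a_mem_kept i), h _ (hor_b_mem_kept i)]

theorem continuous_reduced {X : Type*} [TopologicalSpace X]
    (hχ : ∀ e ∈ kept g, Continuous (χ e) ∧ IsClassFunction (χ e)) {k : X → SU2}
    {a b : X → Fin g → SU2} (hk : Continuous k) (ha : Continuous a) (hb : Continuous b) :
    Continuous fun x => reduced χ (k x) (a x) (b x) := by
  unfold reduced
  refine ((hχ _ vert_mem_kept).1.comp ?_).mul (continuous_finsetProd _ fun i _ =>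
    ((hχ _ (hor_a_mem_kept i)).1.comp ?_).mul ((hχ _ (hor_b_mem_kept i)).1.comp ?_))
  · unfold surfaceWord
    simp only [List.ofFn_eq_map]
    exact continuous_list_prod _ fun i _ => by fun_prop
  · fun_prop
  · fun_prop

/-- The limit of the integral over the group elements across the horizontal triangles and the upper
walls. -/
theorem tendsto_integral_overwrite_walls {Ω : Type*} [TopologicalSpace Ω] [CompactSpace Ω]
    [LocallyCompactSpace Ω] [SecondCountableTopology Ω] [MeasurableSpace Ω] [OpensMeasurableSpace Ω]
    (ν : Measure Ω) [IsFiniteMeasure ν]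
    {z : Ω → CircleFace (Fin (4 * g - 2)) (FanEdge g) → SU2} (hz : Continuous z)
    (hp : ∀ ω t, z ω (.pi t) = 1) (hf : ∀ ω t, z ω (.fi t) = 1) (hd : ∀ ω j, z ω (.lo (.d j)) = 1)
    (hχ : ∀ e ∈ kept g, Continuous (χ e) ∧ IsClassFunction (χ e))
    (hδ : ∀ e ∉ kept g, IsDeltaSequence fun n => δ n e) :
    Tendsto (fun n => ∫ ω, ∫ y, (Δ g).deltaProduct Set.univ (kept g) χ (δ n)
        (overwrite (walls g) (z ω) y) ∂haarPi _ ∂ν) atTop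
      (𝓝 (∫ ω, ∫ k, reduced χ k (fun i => z ω (.lo (.a i))) (fun i => z ω (.lo (.b i)))
        ∂haarSU2 ∂ν)) := by
  have hkc := continuous_keptFactor hχ
  set ℓ : Ω × (Empty → SU2) → FanEdge g → SU2 := fun p e => z p.1 (.lo e) with hℓ
  have hℓc : Continuous ℓ := continuous_pi fun e => (continuous_apply _).comp (by fun_prop)
  have main := tendsto_integral_chain ν (κ := Empty) (d := fun j : Fin (4 * g - 3) => FanEdge.d j)
    (β := fun _ => Empty.elim) (fun i => i.elim)
    (δ := fun n e => δ n (enum (some (.inr e)))) (fun e => hδ _ (diag_notMem_kept e))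
    (η := fun n j => δ n (enum (some (.inl (.d j))))) (fun j => hδ _ (hor_d_notMem_kept j))
    hℓc (V := fun p q => keptFactor χ (conf (ℓ p) q.1 q.2))
    (hkc.comp (continuous_conf (by fun_prop) (by fun_prop) (by fun_prop)))
  -- the kept factors are those of the reduced formula at `k⁻¹`, exchanged for `k` by inversion
  have hlim : ∀ ω, ∫ k, reduced χ k (fun i => z ω (.lo (.a i))) (fun i => z ω (.lo (.b i)))
      ∂haarSU2 = ∫ k, keptFactor χ (conf (ℓ (ω, 1)) (fun i =>
        (Fin.partialProd (fun j => ℓ (ω, 1) (.d j)) i)⁻¹ * k) (ℓ (ω, 1))) ∂haarSU2 := by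
    intro ω
    rw [← integral_inv_eq_self (fun k => reduced χ k (fun i => z ω (.lo (.a i)))
      (fun i => z ω (.lo (.b i)))) haarSU2]
    refine integral_congr_ae (ae_of_all _ fun k => ?_)
    have h1 : ∀ i, Fin.partialProd (fun j => ℓ (ω, 1) (.d j)) i = 1 := by
      intro i
      induction i using Fin.induction with
      | zero => simp
      | succ j ih => rw [Fin.partialProd_succ, ih, one_mul]; exact hd ω j
    simp only [h1, inv_one, one_mul]
    rw [keptFactor_conf_const hχ (ℓ := ℓ (ω, 1)) (hd ω)]
  simp only [hlim]
  refine main.congr fun n => integral_congr_ae (ae_of_all _ fun ω => ?_)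
  have hj : Function.Injective (Sum.elim
      (fun i => (.hor (Fin.cast (card_fan g) i) : CircleFace (Fin (4 * g - 2)) (FanEdge g)))
      CircleFace.up) := by
    rintro (i | e) (i' | e') h <;> simp_all
  set F : (Fin (4 * g - 3 + 1) → SU2) → (FanEdge g → SU2) → ℝ := fun h v =>
    (Δ g).deltaProduct Set.univ (kept g) χ (δ n) (conf (fun e => z ω (.lo e)) h v) with hF
  have hFc : Continuous fun p : (Fin (4 * g - 3 + 1) → SU2) × (FanEdge g → SU2) => F p.1 p.2 := by
    refine (Gluing.continuous_deltaProduct _ fun e _ => ?_).comp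
      (continuous_conf (by fun_prop) (by fun_prop) (by fun_prop))
    split_ifs with he
    · exact (hχ e he).1
    · exact (hδ e he).continuous n
  have h2 : ∫ y, (Δ g).deltaProduct Set.univ (kept g) χ (δ n) (overwrite (walls g) (z ω) y)
      ∂haarPi _ = ∫ h, ∫ v, F h v ∂haarPi _ ∂haarPi _ := by
    rw [← integral_prod_of_continuous _ _ hFc,
      ← (measurePreserving_comp_sum hj).integral_comp_of_continuous hFc]
    simp only [overwrite_walls (hp ω) (hf ω), hF]
    rfl
  dsimp only
  rw [h2]
  simp only [hF, deltaProduct_conf hδ n (ℓ := fun e => z ω (.lo e)) (hd ω)]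
  simp [hℓ]

end ClosedCase

/-! ### Gauge fixed partition functions of `Σ_g × S¹` -/

namespace ClosedCase

theorem tree_subset_walls {g : ℕ} : tree g ⊆ walls g := by
  rintro f (h | h | ⟨j, h⟩)
  exacts [.inl h, .inr (.inl h), .inr (.inr ⟨_, h⟩)]

variable {g : ℕ} [NeZero g] {χ : (Δ g).Edge → SU2 → ℝ} {δ : ℕ → (Δ g).Edge → SU2 → ℝ}

theorem continuous_deltaProduct (hχ : ∀ e ∈ kept g, Continuous (χ e) ∧ IsClassFunction (χ e))
    (hδ : ∀ e ∉ kept g, IsDeltaSequence fun n => δ n e) (n : ℕ) :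
    Continuous ((Δ g).deltaProduct Set.univ (kept g) χ (δ n)) := by
  refine Gluing.continuous_deltaProduct _ fun e _ => ?_
  split_ifs with he
  exacts [(hχ e he).1, (hδ e he).continuous n]

/-- The amplitude gauge fixed along a forest does not depend on the forest. -/
theorem amplitude_eq (hχ : ∀ e ∈ kept g, Continuous (χ e) ∧ IsClassFunction (χ e))
    (hδ : ∀ e ∉ kept g, IsDeltaSequence fun n => δ n e) (n : ℕ)
    {T : Set (CircleFace (Fin (4 * g - 2)) (FanEdge g))}
    (hT : (Δ g).IsForest ∅ T) :
    (Δ g).amplitude T (fun _ => 1) Set.univ (kept g) χ (δ n) =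
      ∫ x, (Δ g).deltaProduct Set.univ (kept g) χ (δ n) x ∂haarPi _ := by
  have hD := continuous_deltaProduct hχ hδ n
  rw [Gluing.amplitude, integral_fillIn _ _ hD]
  have h := (Δ g).integral_gaugeFixing (B := ∅) (L := ∅) (c := fun _ => 1) hD
    (fun γ u _ => Gluing.deltaProduct_gauge _ (fun e _ => ?_) γ u) (by simp) (fun _ _ => rfl) hT
  · rw [Set.empty_union] at h
    rw [h]
    have h0 : ∀ x : CircleFace (Fin (4 * g - 2)) (FanEdge g) → SU2,
        overwrite ∅ (fun _ => 1) x = x := fun x =>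
      funext fun f => overwrite_of_notMem (Set.notMem_empty f) _ x
    simp only [h0]
  · split_ifs with he
    exacts [(hχ e he).2, (hδ e he).classFunction n]

/-- Gauge fixing along any forest may be replaced by gauge fixing along `tree g`, for which the
limit is that of `tendsto_integral_overwrite_walls`. -/
theorem tendsto_amplitude (hχ : ∀ e ∈ kept g, Continuous (χ e) ∧ IsClassFunction (χ e))
    (hδ : ∀ e ∉ kept g, IsDeltaSequence fun n => δ n e)
    (htree : (Δ g).IsForest ∅ (tree g))
    {T : Set (CircleFace (Fin (4 * g - 2)) (FanEdge g))} (hT : (Δ g).IsForest ∅ T) :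
    Tendsto (fun n => (Δ g).amplitude T (fun _ => 1) Set.univ (kept g) χ (δ n)) atTop
      (𝓝 (∫ k, ∫ a, ∫ b, reduced χ k a b ∂haarPi (Fin g) ∂haarPi (Fin g) ∂haarSU2)) := by
  have hz : Continuous fun x : CircleFace (Fin (4 * g - 2)) (FanEdge g) → SU2 =>
      overwrite (tree g) (fun _ => 1) x :=
    (continuous_overwrite _).comp (Continuous.prodMk_right _)
  have main := tendsto_integral_overwrite_walls (haarPi _) hz
    (fun x t => overwrite_of_mem (.inl ⟨t, rfl⟩) _ _)
    (fun x t => overwrite_of_mem (.inr (.inl ⟨t, rfl⟩)) _ _)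
    (fun x j => overwrite_of_mem (.inr (.inr ⟨j, rfl⟩)) _ _) hχ hδ
  have ha : ∀ x i, overwrite (tree g) (fun _ => 1) x (.lo (.a i)) = x (.lo (.a i)) := fun x i =>
    overwrite_of_notMem (by simp [tree]) _ _
  have hb : ∀ x i, overwrite (tree g) (fun _ => 1) x (.lo (.b i)) = x (.lo (.b i)) := fun x i =>
    overwrite_of_notMem (by simp [tree]) _ _
  simp only [ha, hb] at main
  convert main using 1
  · funext n
    rw [amplitude_eq hχ hδ n hT, ← amplitude_eq hχ hδ n htree, Gluing.amplitude,
      integral_fillIn _ _ (continuous_deltaProduct hχ hδ n),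
      integral_overwrite_of_subset tree_subset_walls _ (continuous_deltaProduct hχ hδ n)]
  · congr 1
    have hr : Continuous fun q : (CircleFace (Fin (4 * g - 2)) (FanEdge g) → SU2) × SU2 =>
        reduced χ q.2 (fun i => q.1 (.lo (.a i))) (fun i => q.1 (.lo (.b i))) :=
      continuous_reduced hχ (by fun_prop) (by fun_prop) (by fun_prop)
    refine Eq.trans ?_ (integral_integral_swap_of_continuous _ _ hr).symm
    · refine integral_congr_ae (ae_of_all _ fun k => ?_)
      have hc : Continuous fun p : (Fin g → SU2) × (Fin g → SU2) => reduced χ k p.1 p.2 :=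
        continuous_reduced hχ (by fun_prop) (by fun_prop) (by fun_prop)
      have hj : Function.Injective (Sum.elim
          (fun i => (.lo (.a i) : CircleFace (Fin (4 * g - 2)) (FanEdge g)))
          (fun i => .lo (.b i))) := by
        rintro (i | e) (i' | e') h <;> simp_all
      dsimp only
      rw [← integral_prod_of_continuous _ _ hc,
        ← (measurePreserving_comp_sum hj).integral_comp_of_continuous hc]
      rfl

/-- In the residual gauge fixing, the values over `a₁` and `b₁` are further parameters of
`tendsto_integral_overwrite_walls`, distributed with the measure `dμ`. -/
theorem tendsto_integral_amplitude_residual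
    (hχ : ∀ e ∈ kept g, Continuous (χ e) ∧ IsClassFunction (χ e))
    (hδ : ∀ e ∉ kept g, IsDeltaSequence fun n => δ n e)
    (s : SU2 ⧸ cartan → SU2) :
    Tendsto (fun n => ∫ p, (Δ g).amplitude (tree g ∪ {.lo (.a 0), .lo (.b 0)}) (fixedValues p)
        Set.univ (kept g) χ (δ n) ∂residualMeasure s) atTop
      (𝓝 (∫ k, ∫ p, ∫ a, ∫ b,
        reduced χ k (fillIn {0} (fun _ => p.1) a) (fillIn {0} (fun _ => p.2) b)
        ∂haarPi ↥({0} : Set (Fin g))ᶜ ∂haarPi ↥({0} : Set (Fin g))ᶜ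
        ∂residualMeasure s ∂haarSU2)) := by
  have : IsFiniteMeasure (residualMeasure s) := by unfold residualMeasure; infer_instance
  set S : Set (CircleFace (Fin (4 * g - 2)) (FanEdge g)) :=
    tree g ∪ {.lo (.a 0), .lo (.b 0)} with hS
  have hSw : S ⊆ walls g := by
    refine Set.union_subset tree_subset_walls ?_
    rintro f (rfl | rfl)
    exacts [.inr (.inr ⟨_, rfl⟩), .inr (.inr ⟨_, rfl⟩)]
  have hfix : Continuous fun p : SU2 × SU2 => fixedValues (g := g) p := by
    refine continuous_pi fun f => ?_
    unfold fixedValues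
    split_ifs <;> fun_prop
  set z : (SU2 × SU2) × (CircleFace (Fin (4 * g - 2)) (FanEdge g) → SU2) →
      CircleFace (Fin (4 * g - 2)) (FanEdge g) → SU2 := fun q =>
    overwrite S (fixedValues q.1) q.2 with hz
  have hzc : Continuous z := (continuous_overwrite S).comp
    (f := fun q : (SU2 × SU2) × (CircleFace (Fin (4 * g - 2)) (FanEdge g) → SU2) =>
      (fixedValues q.1, q.2)) ((hfix.comp continuous_fst).prodMk continuous_snd)
  have main := tendsto_integral_overwrite_walls ((residualMeasure s).prod (haarPi _)) hzc
    (fun q t => (overwrite_of_mem (.inl (.inl ⟨t, rfl⟩)) _ _).trans (by simp [fixedValues]))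
    (fun q t => (overwrite_of_mem (.inl (.inr (.inl ⟨t, rfl⟩))) _ _).trans (by simp [fixedValues]))
    (fun q j => (overwrite_of_mem (.inl (.inr (.inr ⟨j, rfl⟩))) _ _).trans (by simp [fixedValues]))
    hχ hδ
  have ha : ∀ q, (fun i => z q (.lo (.a i))) =
      overwrite {0} (fun _ => q.1.1) fun i => q.2 (.lo (.a i)) := by
    intro q
    funext i
    by_cases hi : i = 0
    · subst hi; simp [hz, hS, overwrite, fixedValues]
    · simp [hz, hS, overwrite, hi, tree]
  have hb : ∀ q, (fun i => z q (.lo (.b i))) =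
      overwrite {0} (fun _ => q.1.2) fun i => q.2 (.lo (.b i)) := by
    intro q
    funext i
    by_cases hi : i = 0
    · subst hi; simp [hz, hS, overwrite, fixedValues]
    · simp [hz, hS, overwrite, hi, tree]
  simp only [ha, hb] at main
  have hov : ∀ {X : Type} [TopologicalSpace X] {c : X → SU2} {x : X → Fin g → SU2},
      Continuous c → Continuous x →
      Continuous fun q => overwrite {0} (fun _ => c q) (x q) := fun hc hx =>
    (continuous_overwrite _).comp ((continuous_pi fun _ => hc).prodMk hx)
  convert main using 1
  · funext n
    have hD := continuous_deltaProduct hχ hδ n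
    have hDw : Continuous fun q : ((SU2 × SU2) × (CircleFace (Fin (4 * g - 2)) (FanEdge g) → SU2)) ×
        (CircleFace (Fin (4 * g - 2)) (FanEdge g) → SU2) =>
        (Δ g).deltaProduct Set.univ (kept g) χ (δ n) (overwrite (walls g) (z q.1) q.2) :=
      hD.comp ((continuous_overwrite (walls g)).comp
        ((hzc.comp continuous_fst).prodMk continuous_snd))
    refine Eq.trans ?_ (integral_prod_of_continuous _ _
      (continuous_integral_of_continuous _ hDw)).symm
    refine integral_congr_ae (ae_of_all _ fun p => ?_)
    dsimp only
    rw [Gluing.amplitude, integral_fillIn _ _ hD, integral_overwrite_of_subset hSw _ hD]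
  · congr 1
    have hr : Continuous fun q : ((SU2 × SU2) × (CircleFace (Fin (4 * g - 2)) (FanEdge g) → SU2)) ×
        SU2 => reduced χ q.2 (overwrite {0} (fun _ => q.1.1.1) fun i => q.1.2 (.lo (.a i)))
          (overwrite {0} (fun _ => q.1.1.2) fun i => q.1.2 (.lo (.b i))) :=
      continuous_reduced hχ (by fun_prop) (hov (by fun_prop) (by fun_prop))
        (hov (by fun_prop) (by fun_prop))
    refine Eq.trans ?_ (integral_integral_swap_of_continuous _ _ hr).symm
    refine integral_congr_ae (ae_of_all _ fun k => ?_)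
    dsimp only
    refine Eq.trans ?_
      (integral_prod_of_continuous _ _ (hr.comp (Continuous.prodMk_left k))).symm
    refine integral_congr_ae (ae_of_all _ fun p => ?_)
    have hc : Continuous fun q : (Fin g → SU2) × (Fin g → SU2) =>
        reduced χ k (overwrite {0} (fun _ => p.1) q.1) (overwrite {0} (fun _ => p.2) q.2) :=
      continuous_reduced hχ (by fun_prop) (hov (by fun_prop) (by fun_prop))
        (hov (by fun_prop) (by fun_prop))
    have hj : Function.Injective (Sum.elim
        (fun i => (.lo (.a i) : CircleFace (Fin (4 * g - 2)) (FanEdge g)))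
        (fun i => .lo (.b i))) := by
      rintro (i | e) (i' | e') h <;> simp_all
    have h1 : ∀ a, ∫ b, reduced χ k a (fillIn {0} (fun _ => p.2) b)
        ∂haarPi ↥({0} : Set (Fin g))ᶜ =
          ∫ b, reduced χ k a (overwrite {0} (fun _ => p.2) b) ∂haarPi (Fin g) := fun a =>
      integral_fillIn {0} _
        (continuous_reduced hχ (k := fun _ => k) (by fun_prop) (by fun_prop) (by fun_prop))
    have h2 : Continuous fun a => ∫ b, reduced χ k a (overwrite {0} (fun _ => p.2) b)
        ∂haarPi (Fin g) := by
      refine continuous_integral_of_continuous _ (f := fun (a b : Fin g → SU2) => reduced χ k a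
        (overwrite {0} (fun _ => p.2) b)) ?_
      exact continuous_reduced hχ (by fun_prop) (by fun_prop) (hov (by fun_prop) (by fun_prop))
    simp only [h1]
    rw [integral_fillIn {0} _ h2, ← integral_prod_of_continuous _ _ hc,
      ← (measurePreserving_comp_sum hj).integral_comp_of_continuous hc]
    rfl

end ClosedCase

/-! ### The maximal dual tree and the vertex of `Σ_g × S¹` -/

namespace Gluing

variable {Tet Face : Type} {Δ : Gluing Tet Face}

/-- A colouring of the dual vertices which is constant on `B` and along the dual edges of `T` is
constant on the components. A colouring which distinguishes the end points of a dual edge thus shows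
that this dual edge does not close a loop with those of `T`. -/
theorem Joined.eq_of_invariant {B : Set Tet} {T : Set Face} {α : Type} {φ : Tet → α} {c : α}
    (hB : ∀ b ∈ B, φ b = c) (hT : ∀ f ∈ T, φ (Δ.src f) = φ (Δ.tgt f)) {t t' : Tet}
    (h : Δ.Joined B T t t') : φ t = φ t' := by
  induction h with
  | rel t t' h =>
    rcases h with ⟨h1, h2⟩ | ⟨f, hf, rfl, rfl⟩
    · rw [hB t h1, hB t' h2]
    · exact hT f hf
  | refl => rfl
  | symm _ _ _ ih => exact ih.symm
  | trans _ _ _ _ _ ih1 ih2 => exact ih1.trans ih2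

end Gluing

namespace ClosedCase

variable {g : ℕ}

theorem joined_of_mem_tree {f : CircleFace (Fin (4 * g - 2)) (FanEdge g)} (hf : f ∈ tree g) :
    (Δ g).Joined ∅ (tree g) ((Δ g).src f) ((Δ g).tgt f) :=
  .rel _ _ (.inr ⟨f, hf, rfl, rfl⟩)

/-- All the tetrahedra of a prism are joined by the tree. -/
theorem joined_prism (t : Fin (4 * g - 2)) (c c' : PrismTet) :
    (Δ g).Joined ∅ (tree g) (t, c) (t, c') := by
  have hP : (Δ g).Joined ∅ (tree g) (t, .P) (t, .I) := joined_of_mem_tree (.inl ⟨t, rfl⟩)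
  have hF : (Δ g).Joined ∅ (tree g) (t, .I) (t, .F) := joined_of_mem_tree (.inr (.inl ⟨t, rfl⟩))
  have h : ∀ c, (Δ g).Joined ∅ (tree g) (t, .I) (t, c) := by
    rintro (_ | _ | _)
    exacts [hP.symm _ _, .refl _, hF]
  exact ((h c).symm _ _).trans _ _ _ (h c')

/-- The lower walls over the diagonals join consecutive prisms. -/
theorem joined_prism_zero [NeZero g] (n : ℕ) (hn : n < 4 * g - 2) (c : PrismTet) :
    (Δ g).Joined ∅ (tree g) (⟨0, by have := NeZero.pos g; omega⟩, .P) (⟨n, hn⟩, c) := by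
  induction n generalizing c with
  | zero => exact joined_prism _ _ _
  | succ n ih =>
    have hj : (Δ g).Joined ∅ (tree g) ((Δ g).src (.lo (.d ⟨n, by omega⟩)))
      ((Δ g).tgt (.lo (.d ⟨n, by omega⟩))) := joined_of_mem_tree (.inr (.inr ⟨_, rfl⟩))
    exact ((ih (by omega) _).trans _ _ _ hj).trans _ _ _ (joined_prism _ _ _)

/-- The tetrahedron of the prism over the triangle `j` of the fan to which the lower wall over the
diagonal `v₀ v_{j+2}` is attached. It depends on the order of the vertices of the triangle, that is,
on the orientation of its outer side, which is of type `a`, `b`, `a⁻¹` or `b⁻¹` modulo `4`. -/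
theorem src_lo_d (j : Fin (4 * g - 3)) : (Δ g).src (.lo (.d j)) =
    (⟨j.1, by omega⟩, if (j.1 + 1) % 4 < 2 then .P else .I) := by
  change ((fanGlue (.inl (.d j))).1, (loPos (fanGlue (.inl (.d j))).2).1) = _
  by_cases h : (j.1 + 1) % 4 < 2 <;> simp [fanGlue, h, loPos]

theorem tgt_lo_d (j : Fin (4 * g - 3)) : (Δ g).tgt (.lo (.d j)) =
    (⟨j.1 + 1, by omega⟩, if (j.1 + 2) % 4 < 2 then .I else .P) := by
  change ((fanGlue (.inr (.d j))).1, (loPos (fanGlue (.inr (.d j))).2).1) = _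
  by_cases h : (j.1 + 2) % 4 < 2 <;> simp [fanGlue, h, loPos]

theorem isForest_tree : (Δ g).IsForest ∅ (tree g) := by
  rintro f hf hj
  rcases hf with ⟨t, rfl⟩ | ⟨t, rfl⟩ | ⟨j, rfl⟩
  · -- without the dual edge inside the prism over `t`, the later prisms hang on `I` if the wall
    -- towards them is attached to `I`, and on `P` otherwise
    have := hj.eq_of_invariant (φ := fun x : Fin (4 * g - 2) × PrismTet =>
      if x.1 = t then x.2 = .P else if (t.1 + 1) % 4 < 2 then t < x.1 else x.1 < t)
      (c := False) (fun _ h => absurd h (Set.notMem_empty _)) ?_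
    · change (if t = t then PrismTet.P = PrismTet.P else _) =
        (if t = t then PrismTet.I = PrismTet.P else _) at this
      simp at this
    · rintro e ⟨⟨t', rfl⟩ | ⟨t', rfl⟩ | ⟨j, rfl⟩, hne⟩
      · have htt : t' ≠ t := by rintro rfl; exact hne rfl
        change (if t' = t then PrismTet.P = PrismTet.P else _) =
          (if t' = t then PrismTet.I = PrismTet.P else _)
        rw [if_neg htt, if_neg htt]
        rfl
      · change (if t' = t then PrismTet.I = PrismTet.P else _) =
          (if t' = t then PrismTet.F = PrismTet.P else _)
        by_cases htt : t' = t
        · simp [htt]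
        · rw [if_neg htt, if_neg htt]
          rfl
      · rw [src_lo_d, tgt_lo_d]
        simp only [Fin.ext_iff, Fin.lt_def]
        by_cases h1 : j.1 = t.1
        · have h2 : ¬ j.1 + 1 = t.1 := by omega
          by_cases ho : (t.1 + 1) % 4 < 2 <;> simp [h1, ho]
        · by_cases h2 : j.1 + 1 = t.1
          · have h3 : (j.1 + 2) % 4 = (t.1 + 1) % 4 := by omega
            by_cases ho : (t.1 + 1) % 4 < 2 <;> simp [h1, h2, h3, ho] <;> omega
          · by_cases ho : (t.1 + 1) % 4 < 2 <;> simp [h1, h2, ho] <;> omega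
  · have := hj.eq_of_invariant (φ := fun x : Fin (4 * g - 2) × PrismTet => x = (t, .F))
      (c := False) (fun _ h => absurd h (Set.notMem_empty _)) ?_
    · change ((t, PrismTet.I) = (t, .F)) = ((t, PrismTet.F) = (t, .F)) at this
      simp at this
    · rintro e ⟨⟨t', rfl⟩ | ⟨t', rfl⟩ | ⟨j, rfl⟩, hne⟩
      · change ((t', PrismTet.P) = (t, .F)) = ((t', PrismTet.I) = (t, .F))
        simp
      · have htt : t' ≠ t := by rintro rfl; exact hne rfl
        change ((t', PrismTet.I) = (t, .F)) = ((t', PrismTet.F) = (t, .F))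
        simp [htt]
      · rw [src_lo_d, tgt_lo_d]
        by_cases h1 : (j.1 + 1) % 4 < 2 <;> by_cases h2 : (j.1 + 2) % 4 < 2 <;> simp [h1, h2]
  · have := hj.eq_of_invariant (φ := fun x : Fin (4 * g - 2) × PrismTet => x.1.1 ≤ j.1)
      (c := False) (fun _ h => absurd h (Set.notMem_empty _)) ?_
    · rw [src_lo_d, tgt_lo_d] at this
      simp at this
    · rintro e ⟨⟨t', rfl⟩ | ⟨t', rfl⟩ | ⟨i, rfl⟩, hne⟩
      · rfl
      · rfl
      · have hij : i.1 ≠ j.1 := by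
          intro h
          exact hne (by rw [Fin.ext h]; rfl)
        rw [src_lo_d, tgt_lo_d]
        simp only [eq_iff_iff]
        omega

theorem isMaximalTree_tree [NeZero g] : (Δ g).IsMaximalTree ∅ (tree g) where
  forest := isForest_tree
  connected t t' := ((joined_prism_zero t.1.1 t.1.2 t.2).symm _ _).trans _ _ _
    (joined_prism_zero t'.1.1 t'.1.2 t'.2)

/-- The vertices of the prisms are the end points of the single edge in the direction of `S¹`, and
the two end points of this edge are identified. -/
theorem vertex_eq [NeZero g] (v w : (Δ g).Vertex) : v = w := by
  have hg : 0 < 4 * g - 2 := by have := NeZero.pos g; omega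
  set Q := (genusSurface g).circlePrisms with hQ
  set E : Fin 2 → (Δ g).Vertex := fun j =>
    (Δ g).endpoint j (Q.vertFlag (genusSurface.apexCorner 0 hg)) with hE
  have key : ∀ j F, (Δ g).endpoint j (Q.vertFlag F) = E j := fun j =>
    genusSurface.eq_of_turn_flip_invariant (Z := fun F => (Δ g).endpoint j (Q.vertFlag F))
      (fun F => by rw [← Q.turn_vertFlag, Gluing.endpoint_turn])
      (fun F => by rw [← Q.flip_vertFlag, Gluing.endpoint_flip]) hg
  have hglue : ∀ (f : CircleFace (Fin (4 * g - 2)) (FanEdge g)) (m : Fin 3),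
      (Δ g).vertex (((Δ g).sides (.inr f)).1, ((Δ g).sides (.inr f)).2.succAbove m) =
        (Δ g).vertex (((Δ g).sides (.inl f)).1, ((Δ g).sides (.inl f)).2.succAbove m) := by
    intro f m
    rw [← Gluing.vertex_glue, Gluing.glue_inr]
  have hpi : ∀ (t : Fin (4 * g - 2)) m, (Δ g).vertex ((t, .I), Fin.succAbove 2 m)
      = (Δ g).vertex ((t, .P), Fin.succAbove 2 m) := fun t => hglue (.pi t)
  have hfi : ∀ (t : Fin (4 * g - 2)) m, (Δ g).vertex ((t, .F), Fin.succAbove 1 m)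
      = (Δ g).vertex ((t, .I), Fin.succAbove 1 m) := fun t => hglue (.fi t)
  have hP2 : ∀ t : Fin (4 * g - 2), (Δ g).vertex ((t, .P), 2) = E 0 := fun t => key 0 (t, 0, 0)
  have hP3 : ∀ t : Fin (4 * g - 2), (Δ g).vertex ((t, .P), 3) = E 1 := fun t => key 1 (t, 0, 0)
  have hI1 : ∀ t : Fin (4 * g - 2), (Δ g).vertex ((t, .I), 1) = E 0 := fun t => key 0 (t, 0, 1)
  have hI2 : ∀ t : Fin (4 * g - 2), (Δ g).vertex ((t, .I), 2) = E 1 := fun t => key 1 (t, 0, 1)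
  have hF0 : ∀ t : Fin (4 * g - 2), (Δ g).vertex ((t, .F), 0) = E 0 := fun t => key 0 (t, 1, 1)
  have hF1 : ∀ t : Fin (4 * g - 2), (Δ g).vertex ((t, .F), 1) = E 1 := fun t => key 1 (t, 1, 1)
  have hI0 : ∀ t : Fin (4 * g - 2), (Δ g).vertex ((t, .I), 0) = E 0 := fun t =>
    (hfi t 0).symm.trans (hF0 t)
  have hP0 : ∀ t : Fin (4 * g - 2), (Δ g).vertex ((t, .P), 0) = E 0 := fun t =>
    (hpi t 0).symm.trans (hI0 t)
  have hP1 : ∀ t : Fin (4 * g - 2), (Δ g).vertex ((t, .P), 1) = E 0 := fun t =>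
    (hpi t 1).symm.trans (hI1 t)
  have hI3 : ∀ t : Fin (4 * g - 2), (Δ g).vertex ((t, .I), 3) = E 1 := fun t =>
    (hpi t 2).trans (hP3 t)
  have hF2 : ∀ t : Fin (4 * g - 2), (Δ g).vertex ((t, .F), 2) = E 1 := fun t =>
    (hfi t 1).trans (hI2 t)
  have hF3 : ∀ t : Fin (4 * g - 2), (Δ g).vertex ((t, .F), 3) = E 1 := fun t =>
    (hfi t 2).trans (hI3 t)
  -- the future end point of this edge is glued to its past end point
  have h01 : E 1 = E 0 :=
    (hF1 ⟨0, hg⟩).symm.trans ((hglue (.hor ⟨0, hg⟩) 0).symm.trans (hP0 ⟨0, hg⟩))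
  have hall : ∀ v : (Δ g).Vertex, v = E 0 := by
    intro v
    induction v using Quot.ind with
    | mk v =>
      obtain ⟨⟨t, c⟩, i⟩ := v
      cases c <;> fin_cases i
      exacts [hP0 t, hP1 t, hP2 t, (hP3 t).trans h01, hI0 t, hI1 t, (hI2 t).trans h01,
        (hI3 t).trans h01, hF0 t, (hF1 t).trans h01, (hF2 t).trans h01, (hF3 t).trans h01]
  rw [hall v, hall w]

theorem card_tetrahedra (g : ℕ) : Nat.card (Fin (4 * g - 2) × PrismTet) = 12 * g - 6 := by
  have : Fintype.card PrismTet = 3 := rfl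
  rw [Nat.card_eq_fintype_card, Fintype.card_prod, Fintype.card_fin, this]
  omega

theorem card_vertex [NeZero g] : Nat.card (Δ g).Vertex = 1 := by
  have hg : 0 < 4 * g - 2 := by have := NeZero.pos g; omega
  rw [Nat.card_eq_one_iff_unique]
  exact ⟨⟨vertex_eq⟩, ⟨(Δ g).vertex ((⟨0, hg⟩, .P), 0)⟩⟩

end ClosedCase

/-! ### Labels of the edges of a cone -/

namespace Gluing

variable {Tet Face : Type} (Δ : Gluing Tet Face)

theorem flip_three (x : Tet) (k : Fin 3) : Δ.flip (x, 3, k) = (x, k.castSucc, 2) := by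
  fin_cases k <;> rfl

theorem flip_castSucc (x : Tet) (k : Fin 3) : Δ.flip (x, k.castSucc, 2) = (x, 3, k) := by
  rw [← flip_three, flip_flip]

end Gluing

/-- The label of the `m`-th edge of a triangle of a cone: `v` for the edges at the apex, and `h k`
for the side `k` of the base. -/
def coneLabel {α : Type} (v : α) (h : Fin 3 → α) : Fin 4 → Fin 3 → α
  | 0 => ![v, v, h 0]
  | 1 => ![v, v, h 1]
  | 2 => ![v, v, h 2]
  | 3 => h

theorem coneLabel_flip {α : Type} (v : α) (h : Fin 3 → α) (l : Fin 4) (m : Fin 3) :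
    coneLabel v h (l.succAbove m) (m.predAbove l) = coneLabel v h l m := by
  fin_cases l <;> fin_cases m <;> rfl

/-! ### The edges of `Σ × I` and their curvatures -/

namespace SurfaceGluing

variable {Tri SEdge : Type} (S : SurfaceGluing Tri SEdge)

/-- The prisms of `Σ × I`. -/
def intervalPrisms : PrismGluing S S.timesInterval where
  tet := .inl
  pi := .pi
  fi := .fi
  lo := .lo
  up := .up
  tet_injective := Sum.inl_injective
  sides_pi_inl _ := rfl
  sides_pi_inr _ := rfl
  sides_fi_inl _ := rfl
  sides_fi_inr _ := rfl
  sides_lo x := by cases x <;> rfl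
  sides_up x := by cases x <;> rfl

theorem edgeOpp_interval_bot (t : Tri) (k : Fin 3) :
    S.timesInterval.edgeOpp (.bot t) k = S.timesInterval.edgeOpp (.lo (S.edgeOf (t, k))) 2 := by
  refine Eq.trans ?_ (S.intervalPrisms.edge_flag_past t k)
  rw [← S.timesInterval.edge_turn (S.intervalPrisms.flag t (.P, 3) k),
    PrismGluing.turn_of_glue (F := S.intervalPrisms.flag t (.P, 3) k)
      (S.timesInterval.glue_inr (.bot t)), S.timesInterval.edge_flip]
  rfl

theorem edgeOpp_interval_top (t : Tri) (k : Fin 3) :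
    S.timesInterval.edgeOpp (.top t) k = S.timesInterval.edgeOpp (.up (S.edgeOf (t, k))) 0 :=
  S.intervalPrisms.edge_flag_future t k

section curvature
variable [Finite Tri] {u : CylinderFace Tri SEdge → SU2} {χ : SU2 → ℝ}

/-- The curvature at an edge of the past boundary. -/
theorem curvature_interval_past (hp : ∀ t, u (.pi t) = 1) (hb : ∀ t, u (.bot t) = 1)
    (hχ : IsClassFunction χ) (e : SEdge) :
    χ (S.timesInterval.curvature u (S.timesInterval.edgeOpp (.lo e) 2)) =
      χ (u (.lo e) * (u (.past e))⁻¹) := by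
  set Q := S.intervalPrisms
  set t := (S.sides (.inl e)).1
  set k := (S.sides (.inl e)).2
  set t' := (S.sides (.inr e)).1
  set k' := (S.sides (.inr e)).2
  have h0 : PrismGluing.IsOuter (loPos k) := PrismGluing.isOuter_loPos k
  have hP : ∀ k' : Fin 3, ((.P, 3) : PrismTet × Fin 4) ≠ loPos k' := by decide
  have hne : ∀ b l m, (.inr b, l, m) ≠ Q.flag t (loPos k) 2 := fun b l m h =>
    Sum.inr_ne_inl (congrArg Prod.fst h)
  have c1 : S.timesInterval.cross u (S.timesInterval.exit (Q.flag t' (.P, 3) k'))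
    = (u (.bot t'))⁻¹ := S.timesInterval.cross_inr u (.bot t')
  have c2 : S.timesInterval.cross u (S.timesInterval.exit (.inr (t', false), k'.castSucc, 2))
    = (u (.past e))⁻¹ := S.timesInterval.cross_inr u (.past e)
  have c3 : S.timesInterval.cross u (S.timesInterval.exit (.inr (t, false), 3, k))
    = u (.bot t) := S.timesInterval.cross_inl u (.bot t)
  have w1 : Q.Walk u t (loPos k) 2 (S.timesInterval.flip (Q.flag t (.P, 3) k)) 1 :=
    PrismGluing.walk_past_lo hp h0 k .done
  have w2 := WalkTo.step_to (wt := fun F => S.timesInterval.cross u (S.timesInterval.exit F))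
    (hne (t, false) 3 k) (PrismGluing.turn_of_glue (Δ := S.timesInterval)
      (F := (.inr (t, false), 3, k)) (S.timesInterval.glue_inl (.bot t))) w1
  rw [c3, ← S.timesInterval.flip_castSucc] at w2
  have w3 := WalkTo.step_to (wt := fun F => S.timesInterval.cross u (S.timesInterval.exit F))
    (hne (t', false) k'.castSucc 2)
    (PrismGluing.turn_of_glue (Δ := S.timesInterval) (F := (.inr (t', false), k'.castSucc, 2))
      (S.timesInterval.glue_inr (.past e))) w2
  rw [c2, ← S.timesInterval.flip_three] at w3
  have w4 := WalkTo.step_to (wt := fun F => S.timesInterval.cross u (S.timesInterval.exit F))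
    (Q.flag_ne (t := t') (t' := t) (m := k') (m' := 2) (hP k))
    (PrismGluing.turn_of_glue (F := Q.flag t' (.P, 3) k') (S.timesInterval.glue_inr (.bot t'))) w3
  refine (Q.curvature_of_walk_lo hχ e 2 (PrismGluing.walk_lo_past hp h0 k' w4)).trans ?_
  rw [c1, hb, hb]
  simp only [inv_one, one_mul, mul_one]
  rfl

/-- The curvature at an edge of the future boundary. -/
theorem curvature_interval_future (hf : ∀ t, u (.fi t) = 1) (hχ : IsClassFunction χ) (e : SEdge) :
    χ (S.timesInterval.curvature u (S.timesInterval.edgeOpp (.up e) 0)) =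
      χ (u (.future e) * (u (.top (S.sides (.inr e)).1))⁻¹ * (u (.up e))⁻¹ *
        u (.top (S.sides (.inl e)).1)) := by
  set Q := S.intervalPrisms
  set t := (S.sides (.inl e)).1
  set k := (S.sides (.inl e)).2
  set t' := (S.sides (.inr e)).1
  set k' := (S.sides (.inr e)).2
  have h0 : PrismGluing.IsOuter (upPos k) := PrismGluing.isOuter_upPos k
  have hF : ∀ k' : Fin 3, ((.F, 0) : PrismTet × Fin 4) ≠ upPos k' := by decide
  have hne : ∀ b l m, (.inr b, l, m) ≠ Q.flag t (upPos k) 0 := fun b l m h =>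
    Sum.inr_ne_inl (congrArg Prod.fst h)
  have c1 : S.timesInterval.cross u (S.timesInterval.exit (Q.flag t' (.F, 0) k'))
    = u (.top t') := S.timesInterval.cross_inl u (.top t')
  have c2 : S.timesInterval.cross u (S.timesInterval.exit (.inr (t', true), k'.castSucc, 2))
    = (u (.future e))⁻¹ := S.timesInterval.cross_inr u (.future e)
  have c3 : S.timesInterval.cross u (S.timesInterval.exit (.inr (t, true), 3, k))
    = (u (.top t))⁻¹ := S.timesInterval.cross_inr u (.top t)
  have w1 : Q.Walk u t (upPos k) 0 (S.timesInterval.flip (Q.flag t (.F, 0) k)) 1 :=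
    PrismGluing.walk_future_up hf h0 k .done
  have w2 := WalkTo.step_to (wt := fun F => S.timesInterval.cross u (S.timesInterval.exit F))
    (hne (t, true) 3 k) (PrismGluing.turn_of_glue (Δ := S.timesInterval)
      (F := (.inr (t, true), 3, k)) (S.timesInterval.glue_inr (.top t))) w1
  rw [c3, ← S.timesInterval.flip_castSucc] at w2
  have w3 := WalkTo.step_to (wt := fun F => S.timesInterval.cross u (S.timesInterval.exit F))
    (hne (t', true) k'.castSucc 2)
    (PrismGluing.turn_of_glue (Δ := S.timesInterval) (F := (.inr (t', true), k'.castSucc, 2))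
      (S.timesInterval.glue_inr (.future e))) w2
  rw [c2, ← S.timesInterval.flip_three] at w3
  have w4 := WalkTo.step_to (wt := fun F => S.timesInterval.cross u (S.timesInterval.exit F))
    (Q.flag_ne (t := t') (t' := t) (m := k') (m' := 0) (hF k))
    (PrismGluing.turn_of_glue (F := Q.flag t' (.F, 0) k') (S.timesInterval.glue_inl (.top t'))) w3
  refine (Q.curvature_of_walk_up hχ e 0 (PrismGluing.walk_up_future hf h0 k' w4)).trans ?_
  rw [c1, ← hχ.inv]
  -- the inverse of the word read, and a cyclic permutation
  have hw : (u (Q.up e) * (u (.top t') * ((u (.future e))⁻¹ * ((u (.top t))⁻¹ * 1))))⁻¹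
      = u (.top t) * (u (.future e) * (u (.top t'))⁻¹ * (u (.up e))⁻¹) := by
    rw [show Q.up e = .up e from rfl]
    group
  rw [hw, hχ.mul_comm]

end curvature

/-- The labels of the edges of `Σ × I`: `none` for the edge in the direction of `I`, `inl e` for the
edge `e` of the past boundary, `inr (inl e)` for that of the future boundary, `inr (inr e)` for the
diagonal of the walls over `e`. The edges at the apices of the auxiliary cones get the additional
label `none`. -/
def intervalLabel : CylinderFace Tri SEdge → Fin 3 → Option (Option (SEdge ⊕ SEdge ⊕ SEdge))
  | .bot t => fun k => some (some (.inl (S.edgeOf (t, k))))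
  | .top t => fun k => some (some (.inr (.inl (S.edgeOf (t, k)))))
  | .pi t => ![some (some (.inr (.inr (S.edgeOf (t, 0))))),
      some (some (.inr (.inr (S.edgeOf (t, 1))))), some (some (.inl (S.edgeOf (t, 2))))]
  | .fi t => ![some (some (.inr (.inl (S.edgeOf (t, 0))))),
      some (some (.inr (.inr (S.edgeOf (t, 1))))), some (some (.inr (.inr (S.edgeOf (t, 2)))))]
  | .lo e => ![some none, some (some (.inr (.inr e))), some (some (.inl e))]
  | .up e => ![some (some (.inr (.inl e))), some (some (.inr (.inr e))), some none]
  | .past e => ![none, none, some (some (.inl e))]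
  | .future e => ![none, none, some (some (.inr (.inl e)))]

theorem intervalLabel_cone (t : Tri) (b : Bool) (l : Fin 4) :
    S.intervalLabel (S.timesInterval.faceOf (.inr (t, b), l)) = coneLabel none
      (fun k => some (some (if b then .inr (.inl (S.edgeOf (t, k))) else .inl (S.edgeOf (t, k)))))
      l := by
  have hpast : ∀ k : Fin 3, S.timesInterval.faceOf (.inr (t, false), k.castSucc)
      = .past (S.edgeOf (t, k)) := by
    intro k
    have h : S.timesInterval.sides.symm (.inr (t, false), k.castSucc)
        = (S.sides.symm (t, k)).map .past .past := by
      fin_cases k <;> rfl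
    rw [Gluing.faceOf, h, edgeOf]
    cases S.sides.symm (t, k) <;> rfl
  have hfuture : ∀ k : Fin 3, S.timesInterval.faceOf (.inr (t, true), k.castSucc)
      = .future (S.edgeOf (t, k)) := by
    intro k
    have h : S.timesInterval.sides.symm (.inr (t, true), k.castSucc)
        = (S.sides.symm (t, k)).map .future .future := by
      fin_cases k <;> rfl
    rw [Gluing.faceOf, h, edgeOf]
    cases S.sides.symm (t, k) <;> rfl
  cases b <;> fin_cases l
  · exact congrArg S.intervalLabel (hpast 0)
  · exact congrArg S.intervalLabel (hpast 1)
  · exact congrArg S.intervalLabel (hpast 2)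
  · rfl
  · exact congrArg S.intervalLabel (hfuture 0)
  · exact congrArg S.intervalLabel (hfuture 1)
  · exact congrArg S.intervalLabel (hfuture 2)
  · rfl

theorem intervalLabel_flip (F : S.timesInterval.Flag) :
    S.intervalLabel (S.timesInterval.faceOf (S.timesInterval.exit (S.timesInterval.flip F)))
      (S.timesInterval.flip F).2.2
      = S.intervalLabel (S.timesInterval.faceOf (S.timesInterval.exit F)) F.2.2 := by
  obtain ⟨c | ⟨t, b⟩, l, m⟩ := F
  · exact S.intervalPrisms.label_flip (lab := S.intervalLabel) (v := some none)
      (dg := fun e => some (some (.inr (.inr e)))) (hp := fun e => some (some (.inl e)))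
      (hf := fun e => some (some (.inr (.inl e))))
      (fun _ => rfl) (fun _ => rfl) (fun _ => rfl) (fun _ => rfl) (fun _ => rfl) (fun _ => rfl)
      c l m
  · change S.intervalLabel (S.timesInterval.faceOf (.inr (t, b), l.succAbove m)) (m.predAbove l)
      = S.intervalLabel (S.timesInterval.faceOf (.inr (t, b), l)) m
    rw [intervalLabel_cone, intervalLabel_cone, coneLabel_flip]

end SurfaceGluing

/-! ### The edges of `Σ_g × I` -/

namespace CylinderCase

variable {g : ℕ} [NeZero g]

/-- The edges of the triangulation of `Σ_g × I`, enumerated by their labels. -/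
noncomputable def enum : Option (FanEdge g ⊕ FanEdge g ⊕ FanEdge g) → (Δ g).Edge
  | none => vert g
  | some (.inl e) => (Δ g).edgeOpp (.lo e) 2
  | some (.inr (.inl e)) => top e
  | some (.inr (.inr e)) => (Δ g).edgeOpp (.lo e) 1

theorem enum_injective : Function.Injective (enum (g := g)) := by
  have h : (Δ g).edgeLift (genusSurface g).intervalLabel (genusSurface g).intervalLabel_flip ∘
      enum = some := by
    funext l
    rcases l with _ | e | e | e <;> exact Gluing.edgeLift_edgeOpp _ _ _ _ _
  exact Function.Injective.of_comp (h ▸ Option.some_injective _)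

theorem range_enum : Set.range (enum (g := g)) = edges g := by
  set Q := (genusSurface g).intervalPrisms
  ext e
  constructor
  · rintro ⟨_ | e | e | e, rfl⟩
    · exact ⟨_, by simp [links], 0, rfl⟩
    · exact ⟨_, by simp [links], 2, rfl⟩
    · exact ⟨_, by simp [links], 0, rfl⟩
    · exact ⟨_, by simp [links], 1, rfl⟩
  · rintro ⟨f, hf, m, rfl⟩
    rcases f with t | t | t | t | e | e | e | e
    · exact ⟨some (.inl _), ((genusSurface g).edgeOpp_interval_bot t m).symm⟩
    · exact ⟨some (.inr (.inl _)), ((genusSurface g).edgeOpp_interval_top t m).symm⟩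
    · refine Exists.imp (fun l (h : enum l = _) => h.trans (Q.edgeOpp_pi_cases t m).symm) ?_
      fin_cases m
      · exact ⟨some (.inr (.inr _)), rfl⟩
      · exact ⟨some (.inr (.inr _)), rfl⟩
      · exact ⟨some (.inl _), rfl⟩
    · refine Exists.imp (fun l (h : enum l = _) => h.trans (Q.edgeOpp_fi_cases t m).symm) ?_
      fin_cases m
      · exact ⟨some (.inr (.inl _)), rfl⟩
      · exact ⟨some (.inr (.inr _)), rfl⟩
      · exact ⟨some (.inr (.inr _)), rfl⟩
    · fin_cases m
      · exact ⟨none, Q.edgeOpp_lo_zero _ e⟩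
      · exact ⟨some (.inr (.inr _)), rfl⟩
      · exact ⟨some (.inl _), rfl⟩
    · fin_cases m
      · exact ⟨some (.inr (.inl _)), rfl⟩
      · exact ⟨some (.inr (.inr _)), (Q.edgeOpp_up_one e).symm⟩
      · exact ⟨none, (Q.edgeOpp_up_two e _).symm⟩
    · exact absurd (.inl ⟨e, rfl⟩) hf
    · exact absurd (.inr ⟨e, rfl⟩) hf

theorem enum_mem_kept_iff {l : Option (FanEdge g ⊕ FanEdge g ⊕ FanEdge g)} : enum l ∈ kept g ↔
    l = none ∨ (∃ i, l = some (.inr (.inl (.a i)))) ∨ ∃ i, l = some (.inr (.inl (.b i))) := by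
  have h0 : vert g = enum none := rfl
  have h1 : ∀ e : FanEdge g, top e = enum (some (.inr (.inl e))) := fun _ => rfl
  simp only [kept, Set.mem_ofPred_eq, h0, h1, enum_injective.eq_iff]

theorem enum_mem_edges (l : Option (FanEdge g ⊕ FanEdge g ⊕ FanEdge g)) : enum l ∈ edges g :=
  range_enum.subset (Set.mem_range_self l)

end CylinderCase

/-! ### The propagator of `Σ_g × I` -/

/-- The integral of a function of two disjoint families of coordinates. -/
theorem integral_comp_sum {ι κ₁ κ₂ : Type} [Finite ι] [Finite κ₁] [Finite κ₂]
    {j₁ : κ₁ → ι} {j₂ : κ₂ → ι} (hj : Function.Injective (Sum.elim j₁ j₂))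
    {F : (κ₁ → SU2) → (κ₂ → SU2) → ℝ} (hF : Continuous fun p : (κ₁ → SU2) × (κ₂ → SU2) =>
      F p.1 p.2) :
    ∫ x, F (x ∘ j₁) (x ∘ j₂) ∂haarPi ι = ∫ y, ∫ z, F y z ∂haarPi κ₂ ∂haarPi κ₁ := by
  rw [← integral_prod_of_continuous _ _ hF,
    ← (measurePreserving_comp_sum hj).integral_comp_of_continuous hF]

namespace CylinderCase

variable {g : ℕ}

/-- A gauge in which the propagator is computed: the dual edges inside the prisms, and those
towards the past boundary. -/
def tree (g : ℕ) : Set (CylinderFace (Fin (4 * g - 2)) (FanEdge g)) :=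
  {f | (∃ t, f = .pi t) ∨ (∃ t, f = .fi t) ∨ ∃ t, f = .bot t}

/-- The tetrahedra `P`, `I`, `F` of each prism form a path, which is attached to the boundary nodes
only at `P`. -/
theorem isForest_tree : (Δ g).IsForest (nodes g) (tree g) := by
  have hnodes : ∀ {φ : (Fin (4 * g - 2) × PrismTet) ⊕ (Fin (4 * g - 2) × Bool) → Prop},
      (∀ b, φ (.inr b) = False) → ∀ b ∈ nodes g, φ b = False := by
    rintro φ h _ ⟨b, rfl⟩
    exact h b
  have hsp : ∀ t, (Δ g).src (.pi t) = .inl (t, .P) := fun _ => rfl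
  have htp : ∀ t, (Δ g).tgt (.pi t) = .inl (t, .I) := fun _ => rfl
  have hsf : ∀ t, (Δ g).src (.fi t) = .inl (t, .I) := fun _ => rfl
  have htf : ∀ t, (Δ g).tgt (.fi t) = .inl (t, .F) := fun _ => rfl
  have hsb : ∀ t, (Δ g).src (.bot t) = .inr (t, false) := fun _ => rfl
  have htb : ∀ t, (Δ g).tgt (.bot t) = .inl (t, .P) := fun _ => rfl
  rintro f hf hj
  rcases hf with ⟨t, rfl⟩ | ⟨t, rfl⟩ | ⟨t, rfl⟩
  · have := hj.eq_of_invariant (φ := fun x => x = .inl (t, .I) ∨ x = .inl (t, .F))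
      (hnodes (by simp)) ?_
    · simp [hsp, htp] at this
    · rintro e ⟨⟨t', rfl⟩ | ⟨t', rfl⟩ | ⟨t', rfl⟩, hne⟩
      · have htt : t' ≠ t := by rintro rfl; exact hne rfl
        simp [hsp, htp, htt]
      · simp [hsf, htf]
      · simp [hsb, htb]
  · have := hj.eq_of_invariant (φ := fun x => x = .inl (t, .F)) (hnodes (by simp)) ?_
    · simp [hsf, htf] at this
    · rintro e ⟨⟨t', rfl⟩ | ⟨t', rfl⟩ | ⟨t', rfl⟩, hne⟩
      · simp [hsp, htp]
      · have htt : t' ≠ t := by rintro rfl; exact hne rfl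
        simp [hsf, htf, htt]
      · simp [hsb, htb]
  · have := hj.eq_of_invariant (φ := fun x => ∃ c, x = .inl (t, c)) (hnodes (by simp)) ?_
    · simp [hsb, htb] at this
    · rintro e ⟨⟨t', rfl⟩ | ⟨t', rfl⟩ | ⟨t', rfl⟩, hne⟩
      · simp [hsp, htp]
      · simp [hsf, htf]
      · have htt : t' ≠ t := by rintro rfl; exact hne rfl
        simp [hsb, htb, htt]

/-- The group elements fixed on the links over the past boundary. -/
def boundaryValues (a b : Fin g → SU2) : FanEdge g → SU2
  | .a i => a i
  | .b i => b i
  | .d _ => 1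

variable [NeZero g]

/-- The gauge field which is `1` inside the prisms and towards the past boundary, `ℓ` across the
lower walls, `h` towards the future boundary, `v` across the upper walls, `p` and `f` on the links
of the past and of the future boundary. -/
def conf (p f ℓ : FanEdge g → SU2) (h : Fin (4 * g - 3 + 1) → SU2) (v : FanEdge g → SU2) :
    CylinderFace (Fin (4 * g - 2)) (FanEdge g) → SU2
  | .bot _ => 1
  | .top t => h (Fin.cast (ClosedCase.card_fan g).symm t)
  | .pi _ => 1
  | .fi _ => 1
  | .lo e => ℓ e
  | .up e => v e
  | .past e => p e
  | .future e => f e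

theorem continuous_conf {X : Type*} [TopologicalSpace X] (p f : FanEdge g → SU2)
    {ℓ : X → FanEdge g → SU2} {h : X → Fin (4 * g - 3 + 1) → SU2} {v : X → FanEdge g → SU2}
    (hℓ : Continuous ℓ) (hh : Continuous h) (hv : Continuous v) :
    Continuous fun x => conf p f (ℓ x) (h x) (v x) := by
  refine continuous_pi fun s => ?_
  cases s with
  | bot t => exact continuous_const
  | top t => exact (continuous_apply _).comp hh
  | pi t => exact continuous_const
  | fi t => exact continuous_const
  | lo e => exact (continuous_apply e).comp hℓ
  | up e => exact (continuous_apply e).comp hv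
  | past e => exact continuous_const
  | future e => exact continuous_const

theorem overwrite_links_union_tree (a b a' b' : Fin g → SU2)
    (x : CylinderFace (Fin (4 * g - 2)) (FanEdge g) → SU2) :
    overwrite (links g ∪ tree g) (fixedValues a b a' b') x =
      conf (boundaryValues a b) (boundaryValues a' b') (x ∘ .lo)
        (x ∘ fun i => .top (Fin.cast (ClosedCase.card_fan g) i)) (x ∘ .up) := by
  funext s
  cases s with
  | past e => cases e <;> simp [overwrite, links, tree, conf, boundaryValues, fixedValues]
  | future e => cases e <;> simp [overwrite, links, tree, conf, boundaryValues, fixedValues]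
  | _ => simp [overwrite, links, tree, conf, fixedValues]

/-- The factors of the kept edges. -/
noncomputable def keptFactor (χ : (Δ g).Edge → SU2 → ℝ)
    (u : CylinderFace (Fin (4 * g - 2)) (FanEdge g) → SU2) : ℝ :=
  χ (vert g) ((Δ g).curvature u (vert g)) *
    ∏ i, (χ (top (.a i)) ((Δ g).curvature u (top (.a i))) *
      χ (top (.b i)) ((Δ g).curvature u (top (.b i))))

theorem vert_mem_kept : vert g ∈ kept g := .inl rfl

theorem top_a_mem_kept (i : Fin g) : top (.a i) ∈ kept g := .inr (.inl ⟨i, rfl⟩)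

theorem top_b_mem_kept (i : Fin g) : top (.b i) ∈ kept g := .inr (.inr ⟨i, rfl⟩)

theorem past_notMem_kept (e : FanEdge g) : enum (some (.inl e)) ∉ kept g := by
  simp [enum_mem_kept_iff]

theorem diag_notMem_kept (e : FanEdge g) : enum (some (.inr (.inr e))) ∉ kept g := by
  simp [enum_mem_kept_iff]

theorem top_d_notMem_kept (j : Fin (4 * g - 3)) :
    enum (g := g) (some (.inr (.inl (.d j)))) ∉ kept g := by
  simp [enum_mem_kept_iff]

variable {χ : (Δ g).Edge → SU2 → ℝ} {δ : ℕ → (Δ g).Edge → SU2 → ℝ}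

theorem continuous_keptFactor (hχ : ∀ e ∈ kept g, Continuous (χ e) ∧ IsClassFunction (χ e)) :
    Continuous (keptFactor χ) := by
  have h : ∀ e ∈ kept g, Continuous fun u => χ e ((Δ g).curvature u e) := fun e he =>
    (hχ e he).1.comp ((Δ g).continuous_curvature e)
  exact (h _ vert_mem_kept).mul (continuous_finsetProd _ fun i _ =>
    (h _ (top_a_mem_kept i)).mul (h _ (top_b_mem_kept i)))

/-- The delta functions of the edges which are not kept are those at the past edges, which fix the
group elements across the lower walls, and the integrand of `integral_chain`. -/
theorem deltaProduct_conf (hδ : ∀ l, enum l ∉ kept g → IsDeltaSequence fun n => δ n (enum l))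
    (n : ℕ) {p f : FanEdge g → SU2} (hf : ∀ j, f (.d j) = 1) (ℓ : FanEdge g → SU2)
    (h : Fin (4 * g - 3 + 1) → SU2) (v : FanEdge g → SU2) :
    (Δ g).deltaProduct (edges g) (kept g) χ (δ n) (conf p f ℓ h v) =
      (∏ e, δ n (enum (some (.inl e))) (ℓ e * (p e)⁻¹)) *
      ((∏ e, δ n (enum (some (.inr (.inr e)))) (ℓ e * (v e)⁻¹)) *
        (∏ j, δ n (enum (some (.inr (.inl (.d j)))))
          ((h j.succ)⁻¹ * (v (.d j))⁻¹ * h j.castSucc)) * keptFactor χ (conf p f ℓ h v)) := by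
  classical
  rw [← range_enum, Gluing.deltaProduct_range _ enum_injective, Fintype.prod_option,
    Fintype.prod_sum_type, Fintype.prod_sum_type,
    FanEdge.prod_univ (fun e => (if enum (some (.inr (.inl e))) ∈ kept g
      then χ (enum (some (.inr (.inl e)))) else δ n (enum (some (.inr (.inl e)))))
        ((Δ g).curvature (conf p f ℓ h v) (enum (some (.inr (.inl e))))))]
  have hpast : ∀ e, δ n (enum (some (.inl e))) ((Δ g).curvature (conf p f ℓ h v)
      (enum (some (.inl e)))) = δ n (enum (some (.inl e))) (ℓ e * (p e)⁻¹) := fun e =>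
    (genusSurface g).curvature_interval_past (fun _ => rfl) (fun _ => rfl)
      ((hδ _ (past_notMem_kept e)).classFunction n) e
  have hdiag : ∀ e, δ n (enum (some (.inr (.inr e)))) ((Δ g).curvature (conf p f ℓ h v)
      (enum (some (.inr (.inr e))))) = δ n (enum (some (.inr (.inr e)))) (ℓ e * (v e)⁻¹) := fun e =>
    (genusSurface g).intervalPrisms.curvature_diag (fun _ => rfl) (fun _ => rfl)
      ((hδ _ (diag_notMem_kept e)).classFunction n) e
  have hd : ∀ j, δ n (enum (some (.inr (.inl (.d j))))) ((Δ g).curvature (conf p f ℓ h v)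
      (enum (some (.inr (.inl (.d j)))))) = δ n (enum (some (.inr (.inl (.d j)))))
        ((h j.succ)⁻¹ * (v (.d j))⁻¹ * h j.castSucc) := by
    intro j
    refine ((genusSurface g).curvature_interval_future (u := conf p f ℓ h v) (fun _ => rfl)
      ((hδ _ (top_d_notMem_kept j)).classFunction n) (.d j)).trans ?_
    simp only [conf, hf, one_mul]
    rfl
  have hv : enum (g := g) none ∈ kept g := vert_mem_kept
  have ha : ∀ i, enum (g := g) (some (.inr (.inl (.a i)))) ∈ kept g := top_a_mem_kept
  have hb : ∀ i, enum (g := g) (some (.inr (.inl (.b i)))) ∈ kept g := top_b_mem_kept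
  simp only [past_notMem_kept, diag_notMem_kept, top_d_notMem_kept, hv, ha, hb, if_true, if_false,
    hpast, hdiag, hd]
  simp only [enum, keptFactor]
  ring

/-- Where the removed delta functions are concentrated, the kept ones are those of the reduced
formula, at `k⁻¹`. -/
theorem keptFactor_conf_const (hχ : ∀ e ∈ kept g, Continuous (χ e) ∧ IsClassFunction (χ e))
    (a b a' b' : Fin g → SU2) (k : SU2) :
    keptFactor χ (conf (boundaryValues a b) (boundaryValues a' b') (boundaryValues a b)
      (fun _ => k) (boundaryValues a b)) = reduced χ k⁻¹ a b a' b' := by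
  set u := conf (boundaryValues a b) (boundaryValues a' b') (boundaryValues a b)
      (fun _ => k) (boundaryValues a b)
  have h : ∀ e, top e ∈ kept g → χ (top e) ((Δ g).curvature u (top e))
      = χ (top e) (boundaryValues a' b' e * k⁻¹ * (boundaryValues a b e)⁻¹ * k⁻¹⁻¹) := by
    intro e he
    rw [inv_inv]
    exact (genusSurface g).curvature_interval_future (fun _ => rfl) (hχ _ he).2 e
  rw [keptFactor, reduced]
  congr 1
  · exact (genusSurface g).intervalPrisms.curvature_vert (hχ _ vert_mem_kept).2
      (fun _ => rfl) (fun _ => rfl) (fun _ => rfl) _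
  · refine Finset.prod_congr rfl fun i _ => ?_
    rw [h _ (top_a_mem_kept i), h _ (top_b_mem_kept i)]
    rfl

/-- The propagator in an arbitrary gauge is computed in the gauge `tree g`, after the translation
`l = z * p` of the group elements across the lower walls by their values on the past boundary. -/
theorem tendsto_amplitude (hχ : ∀ e ∈ kept g, Continuous (χ e) ∧ IsClassFunction (χ e))
    (hδ : ∀ e ∈ edges g \ kept g, IsDeltaSequence fun n => δ n e)
    {T : Set (CylinderFace (Fin (4 * g - 2)) (FanEdge g))} (hT : (Δ g).IsForest (nodes g) T)
    (a b a' b' : Fin g → SU2) :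
    Tendsto (fun n => (Δ g).amplitude (links g ∪ T) (fixedValues a b a' b') (edges g) (kept g)
      χ (δ n)) atTop (𝓝 (∫ k, reduced χ k a b a' b' ∂haarSU2)) := by
  have hδ' : ∀ l, enum l ∉ kept g → IsDeltaSequence fun n => δ n (enum l) := fun l hl =>
    hδ _ ⟨enum_mem_edges l, hl⟩
  have hD : ∀ n, Continuous ((Δ g).deltaProduct (edges g) (kept g) χ (δ n)) := by
    refine fun n => Gluing.continuous_deltaProduct _ fun e he => ?_
    split_ifs with hk
    exacts [(hχ e hk).1, (hδ e ⟨he, hk⟩).continuous n]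
  -- the amplitude does not depend on the forest
  have hfix : ∀ (n : ℕ) {T : Set (CylinderFace (Fin (4 * g - 2)) (FanEdge g))},
      (Δ g).IsForest (nodes g) T →
      ∫ x, (Δ g).deltaProduct (edges g) (kept g) χ (δ n)
        (overwrite (links g ∪ T) (fixedValues a b a' b') x) ∂haarPi _ =
      ∫ x, (Δ g).deltaProduct (edges g) (kept g) χ (δ n)
        (overwrite (links g) (fixedValues a b a' b') x) ∂haarPi _ := by
    intro n T hT
    refine (Δ g).integral_gaugeFixing (hD n)
      (fun γ u _ => Gluing.deltaProduct_gauge _ (fun e he => ?_) γ u) ?_ ?_ hT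
    · split_ifs with hk
      exacts [(hχ e hk).2, (hδ e ⟨he, hk⟩).classFunction n]
    · rintro f (⟨e, rfl⟩ | ⟨e, rfl⟩)
      · exact ⟨⟨_, rfl⟩, ⟨_, rfl⟩⟩
      · exact ⟨⟨_, rfl⟩, ⟨_, rfl⟩⟩
    · intro f hf
      cases f with
      | past e => exact absurd (.inl ⟨e, rfl⟩) hf
      | future e => exact absurd (.inr ⟨e, rfl⟩) hf
      | _ => rfl
  set p := boundaryValues a b with hp
  set f := boundaryValues a' b'
  set ℓ : Unit × (FanEdge g → SU2) → FanEdge g → SU2 := fun q => q.2 * p with hℓ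
  have main := tendsto_integral_chain (Measure.dirac ()) (d := fun j : Fin (4 * g - 3) =>
      FanEdge.d j) (β := fun n e => δ n (enum (some (.inl e))))
    (fun e => hδ' _ (past_notMem_kept e))
    (δ := fun n e => δ n (enum (some (.inr (.inr e))))) (fun e => hδ' _ (diag_notMem_kept e))
    (η := fun n j => δ n (enum (some (.inr (.inl (.d j)))))) (fun j => hδ' _ (top_d_notMem_kept j))
    (ℓ := ℓ) (by fun_prop) (V := fun q r => keptFactor χ (conf p f (ℓ q) r.1 r.2))
    ((continuous_keptFactor hχ).comp (continuous_conf _ _ (by fun_prop) (by fun_prop)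
      (by fun_prop)))
  have hlim : ∫ k, reduced χ k a b a' b' ∂haarSU2 =
      ∫ k, keptFactor χ (conf p f (ℓ ((), 1)) (fun i =>
        (Fin.partialProd (fun j => ℓ ((), 1) (.d j)) i)⁻¹ * k) (ℓ ((), 1))) ∂haarSU2 := by
    rw [← integral_inv_eq_self (fun k => reduced χ k a b a' b') haarSU2]
    refine integral_congr_ae (ae_of_all _ fun k => ?_)
    have h0 : ℓ ((), 1) = p := one_mul p
    have h1 : ∀ i, Fin.partialProd (fun j : Fin (4 * g - 3) => p (.d j)) i = 1 := by
      intro i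
      induction i using Fin.induction with
      | zero => simp
      | succ j ih => rw [Fin.partialProd_succ, ih, one_mul]; rfl
    simp only [h0, h1, inv_one, one_mul]
    exact (keptFactor_conf_const hχ a b a' b' k).symm
  simp only [integral_dirac] at main
  rw [hlim]
  refine main.congr fun n => ?_
  set G : (FanEdge g → SU2) → (Fin (4 * g - 3 + 1) → SU2) → (FanEdge g → SU2) → ℝ := fun z h v =>
    (Δ g).deltaProduct (edges g) (kept g) χ (δ n) (conf p f z h v) with hG
  have hGc : Continuous fun q : (FanEdge g → SU2) × (Fin (4 * g - 3 + 1) → SU2) ×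
      (FanEdge g → SU2) => G q.1 q.2.1 q.2.2 :=
    (hD n).comp (continuous_conf _ _ (by fun_prop) (by fun_prop) (by fun_prop))
  have hj : Function.Injective (Sum.elim
      (CylinderFace.lo : FanEdge g → CylinderFace (Fin (4 * g - 2)) (FanEdge g))
      (Sum.elim (fun i => .top (Fin.cast (ClosedCase.card_fan g) i)) CylinderFace.up)) := by
    rintro (i | i | i) (i' | i' | i') h <;> simp_all
  have hj' : Function.Injective (Sum.elim
      (Sum.inl : Fin (4 * g - 3 + 1) → Fin (4 * g - 3 + 1) ⊕ FanEdge g) Sum.inr) := by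
    rw [Sum.elim_inl_inr]; exact Function.injective_id
  have hsplit : ∫ x, (Δ g).deltaProduct (edges g) (kept g) χ (δ n)
      (overwrite (links g ∪ tree g) (fixedValues a b a' b') x) ∂haarPi _ =
      ∫ z, ∫ h, ∫ v, G z h v ∂haarPi _ ∂haarPi _ ∂haarPi _ := by
    simp only [overwrite_links_union_tree]
    refine (integral_comp_sum hj (F := fun z y => G z (y ∘ Sum.inl) (y ∘ Sum.inr)) ?_).trans ?_
    · exact hGc.comp (f := fun q : (FanEdge g → SU2) × (Fin (4 * g - 3 + 1) ⊕ FanEdge g → SU2) =>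
        (q.1, q.2 ∘ Sum.inl, q.2 ∘ Sum.inr)) (by fun_prop)
    · refine integral_congr_ae (ae_of_all _ fun z => integral_comp_sum hj' ?_)
      exact hGc.comp (Continuous.prodMk_right z)
  rw [Gluing.amplitude, integral_fillIn _ _ (hD n), hfix n hT, ← hfix n isForest_tree, hsplit]
  -- the translation by `p`, after which the delta functions of the past edges depend on `z` alone
  refine Eq.trans ?_ (integral_mul_right_eq_self
    (fun z => ∫ h, ∫ v, G z h v ∂haarPi _ ∂haarPi _) p)
  refine integral_congr_ae (ae_of_all _ fun z => ?_)
  simp only [hG, deltaProduct_conf hδ' n (p := p) (f := f) (fun _ => rfl), integral_const_mul]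
  simp only [hℓ, Pi.mul_apply, mul_inv_cancel_right]

end CylinderCase

theorem mainTheorem3 (g : ℕ) [NeZero g] :
    -- the triangulation of `Σ_g × S¹`, and the maximal dual tree
    (Nat.card (Fin (4 * g - 2) × PrismTet) = 12 * g - 6 ∧
      Nat.card (ClosedCase.Δ g).Vertex = 1 ∧
      (ClosedCase.Δ g).IsMaximalTree ∅ (ClosedCase.tree g)) ∧
    -- the partition function of `Σ_g × S¹`
    (∀ (χ : (ClosedCase.Δ g).Edge → SU2 → ℝ) (δ : ℕ → (ClosedCase.Δ g).Edge → SU2 → ℝ),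
      (∀ e ∈ ClosedCase.kept g, Continuous (χ e) ∧ IsClassFunction (χ e)) →
      (∀ e ∉ ClosedCase.kept g, IsDeltaSequence fun n => δ n e) →
      -- Lorentz gauge fixing along `T`
      (∀ T, (ClosedCase.Δ g).IsForest ∅ T →
        Tendsto
          (fun n => (ClosedCase.Δ g).amplitude T (fun _ => 1) Set.univ (ClosedCase.kept g) χ (δ n))
          atTop
          (𝓝 (∫ k, ∫ a, ∫ b, ClosedCase.reduced χ k a b
            ∂haarPi (Fin g) ∂haarPi (Fin g) ∂haarSU2))) ∧
      -- Lorentz gauge fixing along the tree, and residual gauge fixing by the measure `dμ`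
      (∀ s : SU2 ⧸ cartan → SU2, Measurable s → (∀ x, (s x : SU2 ⧸ cartan) = x) →
        Tendsto
          (fun n => ∫ p, (ClosedCase.Δ g).amplitude
            (ClosedCase.tree g ∪ {.lo (.a 0), .lo (.b 0)}) (ClosedCase.fixedValues p)
            Set.univ (ClosedCase.kept g) χ (δ n) ∂residualMeasure s)
          atTop
          (𝓝 (∫ k, ∫ p, ∫ a, ∫ b,
            ClosedCase.reduced χ k (fillIn {0} (fun _ => p.1) a) (fillIn {0} (fun _ => p.2) b)
            ∂haarPi ↥({0} : Set (Fin g))ᶜ ∂haarPi ↥({0} : Set (Fin g))ᶜ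
            ∂residualMeasure s ∂haarSU2)))) ∧
    -- the propagator of `Σ_g × I`
    (∀ (χ : (CylinderCase.Δ g).Edge → SU2 → ℝ) (δ : ℕ → (CylinderCase.Δ g).Edge → SU2 → ℝ),
      (∀ e ∈ CylinderCase.kept g, Continuous (χ e) ∧ IsClassFunction (χ e)) →
      (∀ e ∈ CylinderCase.edges g \ CylinderCase.kept g, IsDeltaSequence fun n => δ n e) →
      ∀ T, (CylinderCase.Δ g).IsForest (CylinderCase.nodes g) T →
      ∀ a b a' b' : Fin g → SU2,
        Tendsto
          (fun n => (CylinderCase.Δ g).amplitude (CylinderCase.links g ∪ T)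
            (CylinderCase.fixedValues a b a' b') (CylinderCase.edges g) (CylinderCase.kept g)
            χ (δ n))
          atTop
          (𝓝 (∫ k, CylinderCase.reduced χ k a b a' b' ∂haarSU2))) := by
  refine ⟨⟨ClosedCase.card_tetrahedra g, ClosedCase.card_vertex, ClosedCase.isMaximalTree_tree⟩,
    fun χ δ hχ hδ => ⟨fun T hT => ClosedCase.tendsto_amplitude hχ hδ ClosedCase.isForest_tree hT,
      fun s _ _ => ClosedCase.tendsto_integral_amplitude_residual hχ hδ s⟩,
    fun χ δ hχ hδ T hT a b a' b' => CylinderCase.tendsto_amplitude hχ hδ hT a b a' b'⟩
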